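/- Let $N\ge 2$ and let $M\subset\mathbb R^{N+k}$ be an embedded $N$-dimensional submanifold of class $C^3$. Let $F:TM\to\mathbb R$ be a Finsler metric on $M$: $F$ is continuous on $TM$ and $C^3$ on $TM\setminus 0$, $F(q,cv)=cF(q,v)$ for all $c>0$, $F(q,v)>0$ for $v\ne 0$, and for every $v\ne 0$ in $T_qM$ the form $g_v(\xi,\eta)=\frac12\frac{\partial^2}{\partial s\,\partial t}F^2(q,v+s\xi+t\eta)|_{s=t=0}$ on $T_qM$ is positive definite. Put $G=F^2$. Let $\Phi:M\to\mathbb R$ be of class $C^2$, let $\Omega=\{\Phi<0\}$, $\partial\Omega=\{\Phi=0\}$, $\overline\Omega=\{\Phi\le 0\}$, and assume that $d\Phi(q)\ne0$ for every $q\in\partial\Omega$ and that $\overline\Omega$ is compact and homeomorphic to the closed $N$-dimensional disk. A curve $\gamma:[a,b]\to\overline\Omega$, $a<b$, is a *Finsler geodesic chord* if it is a regular $C^2$ curve which in local coordinates satisfies the geodesic equations $\ddot\gamma^i+\Gamma^i_{jk}(\gamma,\dot\gamma)\dot\gamma^j\dot\gamma^k=0$ on $[a,b]$, where $\Gamma^i_{jk}$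 are the components of the Chern connection of $F$, and if $\gamma(a),\gamma(b)\in\partial\Omega$ and $\gamma(]a,b[)\subset\Omega$. A vector $v\in T_qM$, $q\in\partial\Omega$, is *orthogonal* to $\partial\Omega$ if $d_vF^2(q,v)[\xi]=0$ for all $\xi\in T_q\partial\Omega=\ker d\Phi(q)$. A Finsler geodesic chord is *orthogonal* if $\dot\gamma(a)$ and $\dot\gamma(b)$ are both orthogonal to $\partial\Omega$; it is *orthogonal-tangent* if $\dot\gamma(a)$ is orthogonal to $\partial\Omega$ and $\dot\gamma(b)\in T_{\gamma(b)}\partial\Omega$. Let $\mathfrak M$ be the set of curves $x\in H^{1,2}([0,1],\mathbb R^{N+k})$ with $x([0,1])\subset\overline\Omega$ and $x(0),x(1)\in\partial\Omega$, and let $\mathcal J(x)=\frac12\int_0^1G(x,\dot x)\,ds$, with differential $d\mathcal J(x)[\xi]=\frac12\int_0^1\bigl(d_qG(x,\dot x)[\xi]+d_vG(x,\dot x)[\dot\xi]\bigr)ds$. For $x\in\mathfrak M$ let $\mathcal V^-(x)$ be the set of $\xi\in H^{1,2}([0,1],\mathbb R^{N+k})$ with $\xi(s)\in T_{x(s)}M$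 for all $s\in[0,1]$, $d\Phi(x(0))[\xi(0)]=d\Phi(x(1))[\xi(1)]=0$, and $d\Phi(x(s))[\xi(s)]\le 0$ for every $s\in(0,1)$ with $x(s)\in\partial\Omega$. A curve $x\in\mathfrak M$ is *$\mathcal V^-$-critical* for $\mathcal J$ on $\mathfrak M$ if $d\mathcal J(x)[\xi]\ge0$ for all $\xi\in\mathcal V^-(x)$. **Proposition.** Let $x$ be a non-constant $\mathcal V^-$-critical curve for $\mathcal J$ on $\mathfrak M$. Then either there exists $\bar s\in\,]0,1[$ such that $x|_{[0,\bar s]}$ is an orthogonal-tangent Finsler geodesic chord, or $x$ is an orthogonal Finsler geodesic chord. -/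

import Mathlib

open Set Filter Topology MeasureTheory

namespace FinslerChord

noncomputable section

/-! ### Embedded submanifolds, tangent vectors and local coordinates -/

/-- A slice chart of class `C³` for `M ⊆ E`: a `C³` diffeomorphism `φ` from an open subset of `E`
onto an open subset of `ℝᴺ × ℝᵏ` that carries `M` to the slice `ℝᴺ × {0}`. The first component of
`φ` is a local coordinate system `(q¹, …, qᴺ)` on `M`. -/
structure IsSliceChart {E : Type*} [NormedAddCommGroup E] [NormedSpace ℝ E] {N k : ℕ} (M : Set E)
    (φ : OpenPartialHomeomorph E (EuclideanSpace ℝ (Fin N) × EuclideanSpace ℝ (Fin k))) :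
    Prop where
  contDiffOn : ContDiffOn ℝ 3 φ φ.source
  contDiffOn_symm : ContDiffOn ℝ 3 φ.symm φ.target
  mem_iff : ∀ p ∈ φ.source, p ∈ M ↔ (φ p).2 = 0

/-- `M ⊆ E` is an `N`-dimensional embedded submanifold of class `C³` (and codimension `k`). -/
def IsSubmanifold {E : Type*} [NormedAddCommGroup E] [NormedSpace ℝ E] (N k : ℕ) (M : Set E) :
    Prop :=
  ∀ p ∈ M, ∃ φ : OpenPartialHomeomorph E (EuclideanSpace ℝ (Fin N) × EuclideanSpace ℝ (Fin k)),
    p ∈ φ.source ∧ IsSliceChart M φ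

/-- The tangent space `T_q M`: the velocities at `q` of curves in `M`. -/
def tangentVectors {E : Type*} [NormedAddCommGroup E] [NormedSpace ℝ E] (M : Set E) (q : E) :
    Set E :=
  {v | ∃ γ : ℝ → E, γ 0 = q ∧ (∀ᶠ t in 𝓝 0, γ t ∈ M) ∧ HasDerivAt γ v 0}

/-- The tangent bundle `TM`, as a subset of `E × E`. -/
def tangentBundle {E : Type*} [NormedAddCommGroup E] [NormedSpace ℝ E] (M : Set E) :
    Set (E × E) :=
  {p | p.1 ∈ M ∧ p.2 ∈ tangentVectors M p.1}

/-! ### Finsler metrics -/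

/-- The function `G = F²`. -/
def sqMetric {E : Type*} (F : E × E → ℝ) : E × E → ℝ := fun p => F p ^ 2

/-- The fundamental tensor
`g_v(ξ, η) = 1/2 ∂²/∂s∂t F²(q, v + s ξ + t η)` at `s = t = 0`. -/
def fundamentalTensor {E : Type*} [NormedAddCommGroup E] [NormedSpace ℝ E] (F : E × E → ℝ)
    (q v ξ η : E) : ℝ :=
  1 / 2 * deriv (fun s : ℝ => deriv (fun t : ℝ => sqMetric F (q, v + s • ξ + t • η)) 0) 0

/-- `F : TM → ℝ` is a Finsler metric on `M`. Only the values of `F` on `TM` matter. -/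
structure IsFinslerMetric {E : Type*} [NormedAddCommGroup E] [NormedSpace ℝ E] (M : Set E)
    (F : E × E → ℝ) : Prop where
  continuousOn : ContinuousOn F (tangentBundle M)
  contDiffOn : ContDiffOn ℝ 3 F {p | p ∈ tangentBundle M ∧ p.2 ≠ 0}
  homogeneous : ∀ q ∈ M, ∀ v ∈ tangentVectors M q, ∀ c : ℝ, 0 < c → F (q, c • v) = c * F (q, v)
  pos : ∀ q ∈ M, ∀ v ∈ tangentVectors M q, v ≠ 0 → 0 < F (q, v)
  posDef : ∀ q ∈ M, ∀ v ∈ tangentVectors M q, v ≠ 0 →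
    ∀ ξ ∈ tangentVectors M q, ξ ≠ 0 → 0 < fundamentalTensor F q v ξ ξ

/-! ### Geodesics, through the Chern connection in local coordinates

In local coordinates a point of `TM` is a pair `(q, v) ∈ ℝᴺ × ℝᴺ`, and `L` stands for the
expression of `G = F²` in these coordinates. -/

/-- The expression of `G = F²` in the local coordinates `(qⁱ, vⁱ)` induced by `φ`. -/
def localG {E : Type*} [NormedAddCommGroup E] [NormedSpace ℝ E] {N k : ℕ} (F : E × E → ℝ)
    (φ : OpenPartialHomeomorph E (EuclideanSpace ℝ (Fin N) × EuclideanSpace ℝ (Fin k))) :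
    EuclideanSpace ℝ (Fin N) × EuclideanSpace ℝ (Fin N) → ℝ :=
  fun p => sqMetric F
    (φ.symm (p.1, 0), fderiv ℝ (fun u : EuclideanSpace ℝ (Fin N) => φ.symm (u, 0)) p.1 p.2)

/-- The partial derivative `∂f/∂qʲ`. -/
def dq {N : ℕ} (j : Fin N) (f : EuclideanSpace ℝ (Fin N) × EuclideanSpace ℝ (Fin N) → ℝ)
    (p : EuclideanSpace ℝ (Fin N) × EuclideanSpace ℝ (Fin N)) : ℝ :=
  fderiv ℝ f p (EuclideanSpace.single j 1, 0)

/-- The partial derivative `∂f/∂vʲ`. -/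
def dv {N : ℕ} (j : Fin N) (f : EuclideanSpace ℝ (Fin N) × EuclideanSpace ℝ (Fin N) → ℝ)
    (p : EuclideanSpace ℝ (Fin N) × EuclideanSpace ℝ (Fin N)) : ℝ :=
  fderiv ℝ f p (0, EuclideanSpace.single j 1)

/-- The components `g_ij = 1/2 ∂²L/∂vⁱ∂vʲ` of the fundamental tensor. -/
def gLow {N : ℕ} (L : EuclideanSpace ℝ (Fin N) × EuclideanSpace ℝ (Fin N) → ℝ) (i j : Fin N)
    (p : EuclideanSpace ℝ (Fin N) × EuclideanSpace ℝ (Fin N)) : ℝ :=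
  1 / 2 * dv i (dv j L) p

/-- The components `gⁱʲ` of the inverse of the matrix `(g_ij)`. -/
def gUp {N : ℕ} (L : EuclideanSpace ℝ (Fin N) × EuclideanSpace ℝ (Fin N) → ℝ) (i j : Fin N)
    (p : EuclideanSpace ℝ (Fin N) × EuclideanSpace ℝ (Fin N)) : ℝ :=
  (Matrix.of fun a b => gLow L a b p)⁻¹ i j

/-- The spray coefficients `1/4 gⁱˡ (∂²L/∂qᵐ∂vˡ vᵐ - ∂L/∂qˡ)`. -/
def spray {N : ℕ} (L : EuclideanSpace ℝ (Fin N) × EuclideanSpace ℝ (Fin N) → ℝ) (i : Fin N)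
    (p : EuclideanSpace ℝ (Fin N) × EuclideanSpace ℝ (Fin N)) : ℝ :=
  1 / 4 * ∑ l, gUp L i l p * ((∑ m, dq m (dv l L) p * p.2 m) - dq l L p)

/-- The horizontal derivative `δf/δqʲ = ∂f/∂qʲ - Nᵐ_j ∂f/∂vᵐ`, where `Nᵐ_j = ∂(sprayᵐ)/∂vʲ` are
the coefficients of the nonlinear connection. -/
def horizontalDeriv {N : ℕ} (L : EuclideanSpace ℝ (Fin N) × EuclideanSpace ℝ (Fin N) → ℝ)
    (j : Fin N) (f : EuclideanSpace ℝ (Fin N) × EuclideanSpace ℝ (Fin N) → ℝ)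
    (p : EuclideanSpace ℝ (Fin N) × EuclideanSpace ℝ (Fin N)) : ℝ :=
  dq j f p - ∑ m, dv j (spray L m) p * dv m f p

/-- The components of the Chern connection:
`Γⁱ_jl = 1/2 gⁱᵐ (δg_ml/δqʲ + δg_jm/δqˡ - δg_jl/δqᵐ)`. -/
def chern {N : ℕ} (L : EuclideanSpace ℝ (Fin N) × EuclideanSpace ℝ (Fin N) → ℝ) (i j l : Fin N)
    (p : EuclideanSpace ℝ (Fin N) × EuclideanSpace ℝ (Fin N)) : ℝ :=
  1 / 2 * ∑ m, gUp L i m p *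
    (horizontalDeriv L j (gLow L m l) p + horizontalDeriv L l (gLow L j m) p
      - horizontalDeriv L m (gLow L j l) p)

/-- `γ` restricted to `[a, b]` is a geodesic of `(M, F)`: a regular `C²` curve in `M` that in all
local coordinates satisfies `γ̈ⁱ + Γⁱ_jl(γ, γ̇) γ̇ʲ γ̇ˡ = 0`. Derivatives at `a` and `b` are
one-sided. -/
structure IsGeodesicOn {E : Type*} [NormedAddCommGroup E] [NormedSpace ℝ E] (N k : ℕ) (M : Set E)
    (F : E × E → ℝ) (γ : ℝ → E) (a b : ℝ) : Prop where
  mem : ∀ s ∈ Icc a b, γ s ∈ M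
  contDiffOn : ContDiffOn ℝ 2 γ (Icc a b)
  regular : ∀ s ∈ Icc a b, derivWithin γ (Icc a b) s ≠ 0
  equation :
    ∀ φ : OpenPartialHomeomorph E (EuclideanSpace ℝ (Fin N) × EuclideanSpace ℝ (Fin k)),
      IsSliceChart M φ → ∀ s ∈ Icc a b, γ s ∈ φ.source → ∀ i : Fin N,
        let y : ℝ → EuclideanSpace ℝ (Fin N) := fun t => (φ (γ t)).1
        let y' : ℝ → EuclideanSpace ℝ (Fin N) := derivWithin y (Icc a b)
        derivWithin y' (Icc a b) s i
          + ∑ j, ∑ l, chern (localG F φ) i j l (y s, y' s) * y' s j * y' s l = 0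

/-! ### The domain -/

/-- `Ω = Φ⁻¹(]-∞, 0[)`. -/
def openDomain {E : Type*} (M : Set E) (Φ : E → ℝ) : Set E := {q | q ∈ M ∧ Φ q < 0}

/-- `∂Ω = Φ⁻¹(0)`. -/
def bdry {E : Type*} (M : Set E) (Φ : E → ℝ) : Set E := {q | q ∈ M ∧ Φ q = 0}

/-- `Ω ∪ ∂Ω`. -/
def closedDomain {E : Type*} (M : Set E) (Φ : E → ℝ) : Set E := {q | q ∈ M ∧ Φ q ≤ 0}

/-- `dΦ(q)[v]`, for `q ∈ M` and `v ∈ T_q M`; this equals `⟨∇Φ(q), v⟩`. -/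
def dPhi {E : Type*} [NormedAddCommGroup E] [NormedSpace ℝ E] (M : Set E) (Φ : E → ℝ) (q v : E) :
    ℝ :=
  fderivWithin ℝ Φ M q v

/-- The tangent space `T_q ∂Ω`, the kernel of `dΦ(q)` in `T_q M`. -/
def bdryTangent {E : Type*} [NormedAddCommGroup E] [NormedSpace ℝ E] (M : Set E) (Φ : E → ℝ)
    (q : E) : Set E :=
  {v | v ∈ tangentVectors M q ∧ dPhi M Φ q v = 0}

/-- `Φ : M → ℝ` is a `C²` function with `dΦ ≠ 0` on `∂Ω`, whose sublevel set `Ω ∪ ∂Ω` is compact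
and homeomorphic to the closed `N`-dimensional disk. -/
structure IsDiskDomain {E : Type*} [NormedAddCommGroup E] [NormedSpace ℝ E] (N : ℕ) (M : Set E)
    (Φ : E → ℝ) : Prop where
  contDiffOn : ContDiffOn ℝ 2 Φ M
  regular : ∀ q ∈ bdry M Φ, ∃ v ∈ tangentVectors M q, dPhi M Φ q v ≠ 0
  isCompact : IsCompact (closedDomain M Φ)
  disk : Nonempty (closedDomain M Φ ≃ₜ Metric.closedBall (0 : EuclideanSpace ℝ (Fin N)) 1)

/-! ### Geodesic chords -/

/-- Finsler geodesic chord `γ : [a, b] → Ω ∪ ∂Ω`. -/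
structure IsGeodesicChord {E : Type*} [NormedAddCommGroup E] [NormedSpace ℝ E] (N k : ℕ)
    (M : Set E) (F : E × E → ℝ) (Φ : E → ℝ) (γ : ℝ → E) (a b : ℝ) : Prop where
  lt : a < b
  geodesic : IsGeodesicOn N k M F γ a b
  left_mem : γ a ∈ bdry M Φ
  right_mem : γ b ∈ bdry M Φ
  interior_mem : ∀ s ∈ Ioo a b, γ s ∈ openDomain M Φ

/-- `v` is orthogonal to `T_q ∂Ω`, i.e. `d_v F²(q, v)` vanishes on `T_q ∂Ω`. -/
def OrthogonalToBdry {E : Type*} [NormedAddCommGroup E] [NormedSpace ℝ E] (M : Set E)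
    (F : E × E → ℝ) (Φ : E → ℝ) (q v : E) : Prop :=
  ∀ ξ ∈ bdryTangent M Φ q, HasLineDerivAt ℝ (fun w => sqMetric F (q, w)) 0 v ξ

/-- Orthogonal Finsler geodesic chord. -/
structure IsOrthogonalChord {E : Type*} [NormedAddCommGroup E] [NormedSpace ℝ E] (N k : ℕ)
    (M : Set E) (F : E × E → ℝ) (Φ : E → ℝ) (γ : ℝ → E) (a b : ℝ) : Prop where
  chord : IsGeodesicChord N k M F Φ γ a b
  orthogonal_left : OrthogonalToBdry M F Φ (γ a) (derivWithin γ (Icc a b) a)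
  orthogonal_right : OrthogonalToBdry M F Φ (γ b) (derivWithin γ (Icc a b) b)

/-- Orthogonal-tangent Finsler geodesic chord. -/
structure IsOrthogonalTangentChord {E : Type*} [NormedAddCommGroup E] [NormedSpace ℝ E] (N k : ℕ)
    (M : Set E) (F : E × E → ℝ) (Φ : E → ℝ) (γ : ℝ → E) (a b : ℝ) : Prop where
  chord : IsGeodesicChord N k M F Φ γ a b
  orthogonal_left : OrthogonalToBdry M F Φ (γ a) (derivWithin γ (Icc a b) a)
  tangent_right : derivWithin γ (Icc a b) b ∈ bdryTangent M Φ (γ b)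

/-! ### The variational problem -/

/-- `x ∈ H^{1,2}([0,1], E)`: absolutely continuous on `[0,1]` with square integrable derivative.
Only the values of `x` on `[0,1]` matter. -/
def IsH1 {E : Type*} [NormedAddCommGroup E] [NormedSpace ℝ E] (x : ℝ → E) : Prop :=
  AbsolutelyContinuousOnInterval x 0 1 ∧ MemLp (deriv x) 2 (volume.restrict (Icc (0 : ℝ) 1))

/-- The space of `H^{1,2}` curves in `Ω ∪ ∂Ω` with endpoints in `∂Ω`. -/
def curveSpace {E : Type*} [NormedAddCommGroup E] [NormedSpace ℝ E] (M : Set E) (Φ : E → ℝ) :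
    Set (ℝ → E) :=
  {x | IsH1 x ∧ (∀ s ∈ Icc (0 : ℝ) 1, x s ∈ closedDomain M Φ) ∧ x 0 ∈ bdry M Φ ∧ x 1 ∈ bdry M Φ}

/-- The differential
`dJ(x)[ξ] = 1/2 ∫₀¹ (d_q G(x, ẋ)[ξ] + d_v G(x, ẋ)[ξ̇]) ds`
of the energy functional `J(x) = 1/2 ∫₀¹ G(x, ẋ) ds`. The integrand is the differential of
`G : TM → ℝ` at `(x, ẋ) ∈ TM`, applied to the vector `(ξ, ξ̇)` tangent to `TM`. -/
def energyDifferential {E : Type*} [NormedAddCommGroup E] [NormedSpace ℝ E] (M : Set E)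
    (F : E × E → ℝ) (x ξ : ℝ → E) : ℝ :=
  1 / 2 * ∫ s in (0 : ℝ)..1,
    fderivWithin ℝ (sqMetric F) (tangentBundle M) (x s, deriv x s) (ξ s, deriv ξ s)

/-- The admissible infinitesimal variations `V⁻(x)`: the `H^{1,2}` vector fields along `x` that
are tangent to `∂Ω` at the endpoints and do not point outside whenever `x(s) ∈ ∂Ω`. -/
def admissibleVariations {E : Type*} [NormedAddCommGroup E] [NormedSpace ℝ E] (M : Set E)
    (Φ : E → ℝ) (x : ℝ → E) : Set (ℝ → E) :=
  {ξ | IsH1 ξ ∧ (∀ s ∈ Icc (0 : ℝ) 1, ξ s ∈ tangentVectors M (x s)) ∧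
    dPhi M Φ (x 0) (ξ 0) = 0 ∧ dPhi M Φ (x 1) (ξ 1) = 0 ∧
    ∀ s ∈ Ioo (0 : ℝ) 1, x s ∈ bdry M Φ → dPhi M Φ (x s) (ξ s) ≤ 0}

/-- `x` is a `V⁻`-critical curve for `J`. -/
def IsVCritical {E : Type*} [NormedAddCommGroup E] [NormedSpace ℝ E] (M : Set E)
    (F : E × E → ℝ) (Φ : E → ℝ) (x : ℝ → E) : Prop :=
  x ∈ curveSpace M Φ ∧ ∀ ξ ∈ admissibleVariations M Φ x, 0 ≤ energyDifferential M F x ξ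

end

end FinslerChord

open FinslerChord

/-! In a slice chart the energy is the action of a Lagrangian `L = localG F φ` that is positively
2-homogeneous and strictly convex in the velocity. Near a contact time choose a vector `w` with
`dΦ(w) > 0` and put `ν = dΦ / dΦ(w)`. A variation splits as `e = (e - ν(e) w) + ν(e) w`. The first
summand is tangent to the boundary at contact, so it is admissible with both signs and yields an
Euler-Lagrange equation in integrated form. The second is admissible with one sign only, so the
corresponding residual is monotone. Together (`WeakExtremal.exists_momentum_eq`,
`WeakExtremal.monotoneOn_multiplier`) the momentum is almost everywhere `Q + m ν`, with `Q`
continuous and `m` nondecreasing, `m` being locally constant off contact.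

Interior regularity (`IsLagrangian.regularity`): a monotone `m` has one-sided limits and the inverse
Legendre transform is continuous, so one-sided velocities exist. At a contact time `Φ` has a local
maximum along the curve, so `ν` is nonpositive on the right velocity and nonnegative on the left
one. As `m` can only jump upwards, strict convexity excludes a jump. Hence the curve is
differentiable with continuous velocity, and `m` is continuous.

Energy (`IsLagrangian.energy_constant`): `m` need not be absolutely continuous, so the energy is not
differentiated. Fenchel's inequality, used in both directions, bounds an increment of the energy by
`o(Δs + Δm)`, because `ν` vanishes on the velocity at contact; continuous induction then makes the
energy constant. For a nonconstant curve the constant is positive.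

Ends (`IsVCritical.exists_end_velocity`): constant energy keeps the multiplier bounded up to the
ends, so the velocity has a limit there. Variations that are tangent to the boundary but do not
vanish at the end force the limit momentum to be a multiple of `ν`, which is orthogonality. Euler's
identity and positive energy make `ν` nonzero on that velocity, so the curve leaves the boundary at
once.

Consequently, if there is contact inside `]0,1[`, there is a first contact time. Before it the
Euler-Lagrange equation holds without multiplier, and `IsRegularLagrangian.geodesic_equation`
identifies it with the geodesic equation of the Chern connection; at it the velocity is tangent
because `Φ` has a maximum along the curve. If there is no interior contact, the whole curve is a
geodesic, orthogonal at both ends. -/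

namespace FinslerChord

/-! ### Absolutely continuous curves -/

section Curves

variable {X Y : Type*} [NormedAddCommGroup X] [NormedSpace ℝ X]
  [NormedAddCommGroup Y] [NormedSpace ℝ Y]

/-- `x` is absolutely continuous on `[a, b]` with square integrable derivative. -/
def IsH1On (x : ℝ → X) (a b : ℝ) : Prop :=
  AbsolutelyContinuousOnInterval x a b ∧ MemLp (deriv x) 2 (volume.restrict (Icc a b))

theorem IsH1On.mono {x : ℝ → X} {a b c d : ℝ} (h : IsH1On x a b) (hab : a ≤ b) (hcd : c ≤ d)
    (hac : a ≤ c) (hdb : d ≤ b) : IsH1On x c d := by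
  refine ⟨h.1.mono ?_, h.2.mono_measure (Measure.restrict_mono (Icc_subset_Icc hac hdb) le_rfl)⟩
  rw [uIcc_of_le hab, uIcc_of_le hcd]
  exact Icc_subset_Icc hac hdb

theorem IsH1On.continuousOn {x : ℝ → X} {a b : ℝ} (h : IsH1On x a b) (hab : a ≤ b) :
    ContinuousOn x (Icc a b) := by
  have := h.1.continuousOn
  rwa [uIcc_of_le hab] at this

theorem IsH1On.ae_differentiableAt [FiniteDimensional ℝ X] {x : ℝ → X} {a b : ℝ}
    (h : IsH1On x a b) (hab : a ≤ b) :
    ∀ᵐ s, s ∈ Icc a b → DifferentiableAt ℝ x s := by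
  have := h.1.boundedVariationOn.ae_differentiableAt_of_mem_uIcc
  rwa [uIcc_of_le hab] at this

theorem IsH1On.intervalIntegrable {x : ℝ → X} {a b : ℝ} (h : IsH1On x a b) (hab : a ≤ b) :
    IntervalIntegrable (deriv x) volume a b := by
  rw [intervalIntegrable_iff_integrableOn_Icc_of_le hab]
  exact h.2.integrable (by norm_num)

/-- Testing against continuous functionals reduces this to the scalar fundamental theorem for
absolutely continuous functions, since a functional is Lipschitz. -/
theorem IsH1On.integral_deriv [FiniteDimensional ℝ X] {x : ℝ → X} {a b : ℝ}
    (h : IsH1On x a b) (hab : a ≤ b) : ∫ s in a..b, deriv x s = x b - x a := by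
  have : CompleteSpace X := FiniteDimensional.complete ℝ X
  rw [SeparatingDual.eq_iff_forall_dual_eq (R := ℝ)]
  intro l
  rw [← ContinuousLinearMap.intervalIntegral_comp_comm _ (h.intervalIntegrable hab), map_sub]
  have hac : AbsolutelyContinuousOnInterval (fun s => l (x s)) a b := by
    have h1 := Filter.Tendsto.const_mul ‖l‖ h.1
    rw [mul_zero] at h1
    refine squeeze_zero (fun E => Finset.sum_nonneg fun _ _ => dist_nonneg) (fun E => ?_) h1
    rw [Finset.mul_sum]
    refine Finset.sum_le_sum fun i _ => ?_
    rw [dist_eq_norm, dist_eq_norm, ← map_sub]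
    exact l.le_opNorm _
  rw [← hac.integral_deriv_eq_sub]
  refine intervalIntegral.integral_congr_ae ?_
  filter_upwards [h.ae_differentiableAt hab] with s hs hs'
  rw [uIoc_of_le hab] at hs'
  exact ((l.hasFDerivAt.comp_hasDerivAt s (hs (Ioc_subset_Icc_self hs')).hasDerivAt).deriv).symm

/-- Increments dominated by those of time and of an `H^{1,2}` curve give absolute continuity at
once, and passing to difference quotients gives `‖ξ'‖ ≤ K (1 + ‖x'‖)`. This is how all variations
are shown to be of class `H^{1,2}`. -/
theorem IsH1On.of_dist_le [FiniteDimensional ℝ X] {x : ℝ → X}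
    {ξ : ℝ → Y} [FiniteDimensional ℝ Y] {a b K : ℝ} (h : IsH1On x a b) (hab : a ≤ b) (hK : 0 ≤ K)
    (hd : ∀ s ∈ Icc a b, ∀ t ∈ Icc a b, dist (ξ s) (ξ t) ≤ K * (dist s t + dist (x s) (x t))) :
    IsH1On ξ a b := by
  constructor
  · have h1 := h.1
    rw [absolutelyContinuousOnInterval_iff] at h1 ⊢
    intro ε hε
    obtain ⟨δ, hδ, H⟩ := h1 (ε / (2 * (K + 1))) (by positivity)
    refine ⟨min δ (ε / (2 * (K + 1))), by positivity, fun E hE hlen => ?_⟩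
    have h2 := H E hE (hlen.trans_le (min_le_left _ _))
    have h3 := hlen.trans_le (min_le_right _ _)
    have hab' : uIcc a b = Icc a b := uIcc_of_le hab
    calc _ ≤ ∑ i ∈ Finset.range E.1, K * (dist (E.2 i).1 (E.2 i).2
            + dist (x (E.2 i).1) (x (E.2 i).2)) := by
          refine Finset.sum_le_sum fun i hi => hd _ ?_ _ ?_
          · exact hab' ▸ (hE.1 i hi).1
          · exact hab' ▸ (hE.1 i hi).2
      _ = K * (∑ i ∈ Finset.range E.1, dist (E.2 i).1 (E.2 i).2
            + ∑ i ∈ Finset.range E.1, dist (x (E.2 i).1) (x (E.2 i).2)) := by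
          rw [← Finset.mul_sum, Finset.sum_add_distrib]
      _ ≤ K * (ε / (2 * (K + 1)) + ε / (2 * (K + 1))) := by gcongr
      _ < ε := by
          have : ε / (2 * (K + 1)) + ε / (2 * (K + 1)) = ε / (K + 1) := by field_simp; ring
          rw [this, mul_div_assoc', div_lt_iff₀ (by positivity)]
          nlinarith
  · have hmem : MemLp (fun s => K * (1 + ‖deriv x s‖)) 2 (volume.restrict (Icc a b)) :=
      ((memLp_const (1 : ℝ)).add h.2.norm).const_mul K
    have : CompleteSpace Y := FiniteDimensional.complete ℝ Y
    have : ProperSpace Y := FiniteDimensional.proper_real Y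
    refine hmem.mono' (aestronglyMeasurable_deriv _ _) ?_
    rw [ae_restrict_iff' measurableSet_Icc]
    -- The derivative is two-sided while the bound holds only inside `[a, b]`, so the two end
    -- points, a null set, are discarded.
    have hae : ∀ᵐ s : ℝ, s ≠ a ∧ s ≠ b := by
      have h1 : ∀ᵐ s : ℝ, s ≠ a := by simp [ae_iff, measure_singleton]
      have h2 : ∀ᵐ s : ℝ, s ≠ b := by simp [ae_iff, measure_singleton]
      filter_upwards [h1, h2] with s h1 h2 using ⟨h1, h2⟩
    filter_upwards [h.ae_differentiableAt hab, hae] with s hs hne hsI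
    by_cases hξ : DifferentiableAt ℝ ξ s
    · have hI : Icc a b ∈ 𝓝 s :=
        Icc_mem_nhds (lt_of_le_of_ne hsI.1 (Ne.symm hne.1)) (lt_of_le_of_ne hsI.2 hne.2)
      have t1 := (hasDerivAt_iff_tendsto_slope.1 hξ.hasDerivAt).norm
      have t2 := ((hasDerivAt_iff_tendsto_slope.1 (hs hsI).hasDerivAt).norm.const_add 1).const_mul K
      refine le_of_tendsto_of_tendsto t1 t2 ?_
      filter_upwards [self_mem_nhdsWithin, mem_nhdsWithin_of_mem_nhds hI] with t ht htI
      have hts : 0 < |t - s| := abs_pos.2 (sub_ne_zero.2 ht)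
      rw [slope_def_module, slope_def_module, norm_smul, norm_smul, norm_inv, Real.norm_eq_abs]
      have := hd t htI s hsI
      rw [dist_eq_norm, dist_eq_norm, dist_eq_norm, Real.norm_eq_abs] at this
      calc |t - s|⁻¹ * ‖ξ t - ξ s‖ ≤ |t - s|⁻¹ * (K * (|t - s| + ‖x t - x s‖)) := by gcongr
        _ = K * (1 + |t - s|⁻¹ * ‖x t - x s‖) := by field_simp
    · rw [deriv_zero_of_not_differentiableAt hξ, norm_zero]
      positivity

end Curves

/-! ### Ramps and the fundamental lemma of the calculus of variations -/

/-- The piecewise linear function equal to `0` before `s` and to `1` after `s + h`. -/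
noncomputable def ramp (s h r : ℝ) : ℝ := max 0 (min 1 ((r - s) / h))

theorem ramp_nonneg (s h r : ℝ) : 0 ≤ ramp s h r := le_max_left _ _

theorem ramp_eq_zero {s h r : ℝ} (hh : 0 < h) (hr : r ≤ s) : ramp s h r = 0 := by
  have : (r - s) / h ≤ 0 := div_nonpos_of_nonpos_of_nonneg (by linarith) hh.le
  exact max_eq_left ((min_le_right _ _).trans this)

theorem ramp_eq_one {s h r : ℝ} (hh : 0 < h) (hr : s + h ≤ r) : ramp s h r = 1 := by
  have : 1 ≤ (r - s) / h := by rw [le_div_iff₀ hh]; linarith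
  rw [ramp, min_eq_left this]; simp

theorem ramp_le_one (s h r : ℝ) : ramp s h r ≤ 1 := max_le zero_le_one (min_le_left _ _)

theorem ramp_anti {s t h : ℝ} (hh : 0 < h) (hst : s ≤ t) (r : ℝ) : ramp t h r ≤ ramp s h r := by
  unfold ramp; gcongr

theorem lipschitzWith_ramp (s h : ℝ) : ∃ K, LipschitzWith K (ramp s h) := by
  have h1 : LipschitzWith (Real.nnabs h⁻¹) (fun r : ℝ => (r - s) / h) := by
    refine LipschitzWith.of_dist_le_mul fun x y => ?_
    rw [Real.dist_eq, Real.dist_eq, Real.coe_nnabs, ← abs_mul]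
    apply le_of_eq; congr 1; ring
  exact ⟨_, (h1.const_min 1).const_max 0⟩

theorem deriv_ramp {s h r : ℝ} (hh : 0 < h) (h1 : r ≠ s) (h2 : r ≠ s + h) :
    HasDerivAt (ramp s h) (indicator (Ioo s (s + h)) (fun _ => h⁻¹) r) r := by
  rcases lt_or_gt_of_ne h1 with h1 | h1
  · rw [indicator_of_notMem (by simp [h1.le])]
    refine (hasDerivAt_const r (0 : ℝ)).congr_of_eventuallyEq ?_
    filter_upwards [Iio_mem_nhds h1] with t ht using ramp_eq_zero hh (le_of_lt ht)
  rcases lt_or_gt_of_ne h2 with h2 | h2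
  · rw [indicator_of_mem (show r ∈ Ioo s (s + h) from ⟨h1, h2⟩)]
    have : HasDerivAt (fun t : ℝ => (t - s) / h) h⁻¹ r := by
      simpa using ((hasDerivAt_id r).sub_const s).div_const h
    refine this.congr_of_eventuallyEq ?_
    filter_upwards [Ioo_mem_nhds h1 h2] with t ht
    have a1 : 0 ≤ (t - s) / h := div_nonneg (by linarith [ht.1]) hh.le
    have a2 : (t - s) / h ≤ 1 := by rw [div_le_iff₀ hh]; linarith [ht.2]
    rw [ramp, min_eq_right a2, max_eq_right a1]
  · rw [indicator_of_notMem (by simp [h2.le])]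
    refine (hasDerivAt_const r (1 : ℝ)).congr_of_eventuallyEq ?_
    filter_upwards [Ioi_mem_nhds h2] with t ht using ramp_eq_one hh (le_of_lt ht)

theorem ae_ne_ne (s t : ℝ) : ∀ᵐ r : ℝ, r ≠ s ∧ r ≠ t := by
  have h1 : ∀ᵐ r : ℝ, r ≠ s := by simp [ae_iff, measure_singleton]
  have h2 : ∀ᵐ r : ℝ, r ≠ t := by simp [ae_iff, measure_singleton]
  filter_upwards [h1, h2] with r h1 h2 using ⟨h1, h2⟩

/-- The first variation `∫ (τ A + τ' B)`. -/
noncomputable def weakPairing (A B : ℝ → ℝ) (a b : ℝ) (τ : ℝ → ℝ) : ℝ :=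
  ∫ r in a..b, (τ r * A r + deriv τ r * B r)

/-- `B` minus a primitive of `A`. -/
noncomputable def residual (A B : ℝ → ℝ) (a : ℝ) (r : ℝ) : ℝ := B r - ∫ q in a..r, A q

/-- The points of `]a, b[` where the primitive of `residual A B a` is differentiable with the
expected derivative. -/
def lebesguePoints (A B : ℝ → ℝ) (a b : ℝ) : Set ℝ :=
  {r | r ∈ Ioo a b ∧ HasDerivAt (fun q => ∫ t in a..q, residual A B a t) (residual A B a r) r}

/-! ### Du Bois-Reymond lemmas: equality, one-sided and free-end versions. -/

section DuBoisReymond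

variable {A B : ℝ → ℝ} {a b : ℝ}

theorem intervalIntegrable_residual (hA : IntervalIntegrable A volume a b)
    (hB : IntervalIntegrable B volume a b) :
    IntervalIntegrable (residual A B a) volume a b :=
  hB.sub (intervalIntegral.continuousOn_primitive_interval' hA left_mem_uIcc).intervalIntegrable

theorem ae_mem_lebesguePoints (hab : a ≤ b) (hA : IntervalIntegrable A volume a b)
    (hB : IntervalIntegrable B volume a b) :
    ∀ᵐ r, r ∈ Ioo a b → r ∈ lebesguePoints A B a b := by
  filter_upwards [(intervalIntegrable_residual hA hB).ae_hasDerivAt_integral] with r hr hr'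
  exact ⟨hr', hr (uIcc_of_le hab ▸ Ioo_subset_Icc_self hr') a left_mem_uIcc⟩

/-- The mean of the residual over `[s, s + h]`. -/
noncomputable def residualMean (A B : ℝ → ℝ) (a s h : ℝ) : ℝ :=
  h⁻¹ * ∫ r in s..(s + h), residual A B a r

theorem tendsto_residualMean (hab : a ≤ b) (hA : IntervalIntegrable A volume a b)
    (hB : IntervalIntegrable B volume a b) {s : ℝ} (hs : s ∈ lebesguePoints A B a b) :
    Tendsto (residualMean A B a s) (𝓝[>] 0) (𝓝 (residual A B a s)) := by
  have h1 := (hasDerivAt_iff_tendsto_slope_zero.1 hs.2).mono_left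
    (nhdsWithin_mono (0 : ℝ) (fun x (hx : 0 < x) => ne_of_gt hx))
  refine h1.congr' ?_
  have hlt : Ioo (0 : ℝ) (b - s) ∈ 𝓝[>] (0 : ℝ) := Ioo_mem_nhdsGT (by linarith [hs.1.2])
  filter_upwards [hlt] with h hh
  rw [residualMean, smul_eq_mul]
  congr 1
  have hr := intervalIntegrable_residual hA hB
  refine intervalIntegral.integral_interval_sub_left (hr.mono_set ?_) (hr.mono_set ?_)
  · rw [uIcc_of_le hab, uIcc_of_le (by linarith [hs.1.1, hh.1])]
    exact Icc_subset_Icc le_rfl (by linarith [hh.2])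
  · rw [uIcc_of_le hab, uIcc_of_le hs.1.1.le]
    exact Icc_subset_Icc le_rfl hs.1.2.le

theorem intervalIntegrable_ramp (hA : IntervalIntegrable A volume a b)
    (hB : IntervalIntegrable B volume a b) (s h : ℝ) :
    IntervalIntegrable (fun r => ramp s h r * A r) volume a b ∧
      IntervalIntegrable (fun r => deriv (ramp s h) r * B r) volume a b := by
  obtain ⟨K, hK⟩ := lipschitzWith_ramp s h
  refine ⟨hA.continuousOn_mul hK.continuous.continuousOn, ?_⟩
  rw [intervalIntegrable_iff] at hB ⊢
  refine Integrable.bdd_mul (c := K) hB (aestronglyMeasurable_deriv _ _)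
    (ae_of_all _ fun r => norm_deriv_le_of_lipschitz hK)

/-- Integrating `∫ ramp · A` by parts against the primitive `P` of `A` gives `P(b) - ∫ ramp' · P`,
the ramp being `0` at `a` and `1` at `b`. What remains is `∫ ramp' · (B - P)`, and `ramp'` is `1/h`
on an interval of length `h`. -/
theorem weakPairing_ramp (hab : a ≤ b) (hA : IntervalIntegrable A volume a b)
    (hB : IntervalIntegrable B volume a b) {s h : ℝ} (hs : a ≤ s) (hh : 0 < h)
    (hb : s + h ≤ b) :
    weakPairing A B a b (ramp s h) = (∫ r in a..b, A r) + residualMean A B a s h := by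
  obtain ⟨K, hK⟩ := lipschitzWith_ramp s h
  set P : ℝ → ℝ := fun r => ∫ q in a..r, A q with hP
  have hPac : AbsolutelyContinuousOnInterval P a b :=
    hA.absolutelyContinuousOnInterval_intervalIntegral left_mem_uIcc
  have hparts := AbsolutelyContinuousOnInterval.integral_mul_deriv_eq_deriv_mul
    (hK.lipschitzOnWith.absolutelyContinuousOnInterval (a := a) (b := b)) hPac
  have h1 : ∫ r in a..b, ramp s h r * A r = ∫ r in a..b, ramp s h r * deriv P r := by
    refine intervalIntegral.integral_congr_ae ?_
    filter_upwards [hA.ae_hasDerivAt_integral] with r hr hr'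
    rw [(hr (uIoc_subset_uIcc hr') a left_mem_uIcc).deriv]
  have hPi : IntervalIntegrable P volume a b := hPac.continuousOn.intervalIntegrable
  obtain ⟨i1, i2⟩ := intervalIntegrable_ramp hA hB s h
  obtain ⟨-, i3⟩ := intervalIntegrable_ramp hA hPi s h
  rw [weakPairing, intervalIntegral.integral_add i1 i2, h1, hparts, ramp_eq_one hh hb,
    ramp_eq_zero hh hs, one_mul, zero_mul, sub_zero, sub_add_eq_add_sub, add_sub_assoc,
    ← intervalIntegral.integral_sub i2 i3, hP]
  congr 1
  rw [residualMean, ← intervalIntegral.integral_const_mul]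
  have h2 : ∫ r in a..b, (deriv (ramp s h) r * B r - deriv (ramp s h) r * P r)
      = ∫ r in a..b, indicator (Ioc s (s + h)) (fun r => h⁻¹ * residual A B a r) r := by
    refine intervalIntegral.integral_congr_ae ?_
    filter_upwards [ae_ne_ne s (s + h)] with r hr _
    rw [(deriv_ramp hh hr.1 hr.2).deriv, ← mul_sub]
    by_cases hr' : r ∈ Ioo s (s + h)
    · rw [indicator_of_mem hr', indicator_of_mem (Ioo_subset_Ioc_self hr')]; rfl
    · rw [indicator_of_notMem hr', indicator_of_notMem, zero_mul]
      exact fun h' => hr' ⟨h'.1, lt_of_le_of_ne h'.2 hr.2⟩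
  rw [h2, intervalIntegral.integral_of_le hab, intervalIntegral.integral_of_le (by linarith),
    setIntegral_indicator measurableSet_Ioc]
  congr 2
  exact inter_eq_right.2 (Ioc_subset_Ioc hs hb)

theorem weakPairing_sub_ramp (hA : IntervalIntegrable A volume a b)
    (hB : IntervalIntegrable B volume a b) {s t h : ℝ} (hh : 0 < h) :
    weakPairing A B a b (fun r => ramp s h r - ramp t h r) =
      weakPairing A B a b (ramp s h) - weakPairing A B a b (ramp t h) := by
  obtain ⟨i1, i2⟩ := intervalIntegrable_ramp hA hB s h
  obtain ⟨i3, i4⟩ := intervalIntegrable_ramp hA hB t h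
  rw [weakPairing, weakPairing, weakPairing, ← intervalIntegral.integral_sub (i1.add i2) (i3.add i4)]
  refine intervalIntegral.integral_congr_ae ?_
  filter_upwards [ae_ne_ne s (s + h), ae_ne_ne t (t + h)] with r hr hr' _
  have d1 := deriv_ramp hh hr.1 hr.2
  have d2 := deriv_ramp hh hr'.1 hr'.2
  rw [(d1.fun_sub d2).deriv, d1.deriv, d2.deriv]; ring

theorem weakPairing_one_sub_ramp (hA : IntervalIntegrable A volume a b)
    (hB : IntervalIntegrable B volume a b) {t h : ℝ} (hh : 0 < h) :
    weakPairing A B a b (fun r => 1 - ramp t h r) =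
      (∫ r in a..b, A r) - weakPairing A B a b (ramp t h) := by
  obtain ⟨i3, i4⟩ := intervalIntegrable_ramp hA hB t h
  rw [weakPairing, weakPairing, ← intervalIntegral.integral_sub hA (i3.add i4)]
  refine intervalIntegral.integral_congr_ae ?_
  filter_upwards [ae_ne_ne t (t + h)] with r hr' _
  have d2 := deriv_ramp hh hr'.1 hr'.2
  rw [(d2.const_sub 1).deriv, d2.deriv]; ring

/-- The difference of the ramps at `s ≤ t` is a nonnegative plateau function, and its pairing is the
difference of the two means of the residual. The width `h` tends to `0` at Lebesgue points. -/
theorem monotoneOn_residual (hab : a ≤ b) (hA : IntervalIntegrable A volume a b)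
    (hB : IntervalIntegrable B volume a b) {c d : ℝ} (hac : a ≤ c) (hdb : d ≤ b)
    (H : ∀ τ : ℝ → ℝ, (∃ K, LipschitzWith K τ) → (∀ r, 0 ≤ τ r) → (∀ r, r ∉ Ioo c d → τ r = 0) →
      weakPairing A B a b τ ≤ 0) :
    MonotoneOn (residual A B a) (lebesguePoints A B a b ∩ Ioo c d) := by
  intro s hs t ht hst
  refine le_of_tendsto_of_tendsto (tendsto_residualMean hab hA hB hs.1)
    (tendsto_residualMean hab hA hB ht.1) ?_
  -- With `h < d - t` both ramps have reached `1` before `d`, so the plateau is supported in `]c,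
  -- d[`.
  have hlt : Ioo (0 : ℝ) (d - t) ∈ 𝓝[>] (0 : ℝ) := Ioo_mem_nhdsGT (by linarith [ht.2.2])
  filter_upwards [hlt] with h hh
  obtain ⟨K, hK⟩ := lipschitzWith_ramp s h
  obtain ⟨K', hK'⟩ := lipschitzWith_ramp t h
  have := H (fun r => ramp s h r - ramp t h r) ⟨_, hK.sub hK'⟩
    (fun r => sub_nonneg.2 (ramp_anti hh.1 hst r)) (fun r hr => by
      by_cases hr' : r ≤ s
      · rw [ramp_eq_zero hh.1 hr', ramp_eq_zero hh.1 (hr'.trans hst), sub_zero]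
      · have : d ≤ r := by
          by_contra h'
          exact hr ⟨by linarith [hs.2.1, not_le.1 hr'], not_le.1 h'⟩
        rw [ramp_eq_one hh.1 (by linarith [hh.2]), ramp_eq_one hh.1 (by linarith [hh.2]), sub_self])
  rw [weakPairing_sub_ramp hA hB hh.1,
    weakPairing_ramp hab hA hB (by linarith [hs.2.1]) hh.1 (by linarith [hh.2]),
    weakPairing_ramp hab hA hB (by linarith [ht.2.1]) hh.1 (by linarith [hh.2])] at this
  linarith

/-- The same plateau functions as in the monotone case; nonnegative tests suffice, since two times
can be ordered. -/
theorem residual_eq (hab : a ≤ b) (hA : IntervalIntegrable A volume a b)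
    (hB : IntervalIntegrable B volume a b) {c d : ℝ} (hac : a ≤ c) (hdb : d ≤ b)
    (H : ∀ τ : ℝ → ℝ, (∃ K, LipschitzWith K τ) → (∀ r, 0 ≤ τ r) → (∀ r, r ∉ Ioo c d → τ r = 0) →
      weakPairing A B a b τ = 0) {s t : ℝ} (hs : s ∈ lebesguePoints A B a b ∩ Ioo c d)
    (ht : t ∈ lebesguePoints A B a b ∩ Ioo c d) :
    residual A B a s = residual A B a t := by
  wlog hst : s ≤ t generalizing s t
  · exact (this ht hs (le_of_not_ge hst)).symm
  refine tendsto_nhds_unique_of_eventuallyEq (tendsto_residualMean hab hA hB hs.1)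
    (tendsto_residualMean hab hA hB ht.1) ?_
  have hlt : Ioo (0 : ℝ) (d - t) ∈ 𝓝[>] (0 : ℝ) := Ioo_mem_nhdsGT (by linarith [ht.2.2])
  filter_upwards [hlt] with h hh
  obtain ⟨K, hK⟩ := lipschitzWith_ramp s h
  obtain ⟨K', hK'⟩ := lipschitzWith_ramp t h
  have := H (fun r => ramp s h r - ramp t h r) ⟨_, hK.sub hK'⟩
    (fun r => sub_nonneg.2 (ramp_anti hh.1 hst r)) (fun r hr => by
      by_cases hr' : r ≤ s
      · rw [ramp_eq_zero hh.1 hr', ramp_eq_zero hh.1 (hr'.trans hst), sub_zero]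
      · have : d ≤ r := by
          by_contra h'
          exact hr ⟨by linarith [hs.2.1, not_le.1 hr'], not_le.1 h'⟩
        rw [ramp_eq_one hh.1 (by linarith [hh.2]), ramp_eq_one hh.1 (by linarith [hh.2]), sub_self])
  rw [weakPairing_sub_ramp hA hB hh.1,
    weakPairing_ramp hab hA hB (by linarith [hs.2.1]) hh.1 (by linarith [hh.2]),
    weakPairing_ramp hab hA hB (by linarith [ht.2.1]) hh.1 (by linarith [hh.2])] at this
  linarith

/-- The test `1 - ramp` equals `1` at the free end `a`; its pairing is minus the mean of the
residual, the term `∫ A` cancelling. This is the natural boundary condition at `a`. -/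
theorem residual_eq_of_left_free (hab : a ≤ b) (hA : IntervalIntegrable A volume a b)
    (hB : IntervalIntegrable B volume a b)
    (H : ∀ τ : ℝ → ℝ, (∃ K, LipschitzWith K τ) → (∀ r, 0 ≤ τ r) → (∀ r, b ≤ r → τ r = 0) →
      weakPairing A B a b τ = 0) {t : ℝ} (ht : t ∈ lebesguePoints A B a b) :
    residual A B a t = 0 := by
  refine tendsto_nhds_unique_of_eventuallyEq (tendsto_residualMean hab hA hB ht)
    tendsto_const_nhds ?_
  have hlt : Ioo (0 : ℝ) (b - t) ∈ 𝓝[>] (0 : ℝ) := Ioo_mem_nhdsGT (by linarith [ht.1.2])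
  filter_upwards [hlt] with h hh
  obtain ⟨K', hK'⟩ := lipschitzWith_ramp t h
  have := H (fun r => 1 - ramp t h r) ⟨_, (LipschitzWith.const 1).sub hK'⟩
    (fun r => sub_nonneg.2 (ramp_le_one _ _ _)) (fun r hr => by
      rw [ramp_eq_one hh.1 (by linarith [hh.2]), sub_self])
  rw [weakPairing_one_sub_ramp hA hB hh.1,
    weakPairing_ramp hab hA hB ht.1.1.le hh.1 (by linarith [hh.2])] at this
  linarith

/-- A single ramp equals `1` at the free end `b`, and its pairing is `∫ A` plus the mean of the
residual. -/
theorem residual_eq_of_right_free (hab : a ≤ b) (hA : IntervalIntegrable A volume a b)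
    (hB : IntervalIntegrable B volume a b)
    (H : ∀ τ : ℝ → ℝ, (∃ K, LipschitzWith K τ) → (∀ r, 0 ≤ τ r) → (∀ r, r ≤ a → τ r = 0) →
      weakPairing A B a b τ = 0) {t : ℝ} (ht : t ∈ lebesguePoints A B a b) :
    residual A B a t = - ∫ r in a..b, A r := by
  refine tendsto_nhds_unique_of_eventuallyEq (tendsto_residualMean hab hA hB ht)
    tendsto_const_nhds ?_
  have hlt : Ioo (0 : ℝ) (b - t) ∈ 𝓝[>] (0 : ℝ) := Ioo_mem_nhdsGT (by linarith [ht.1.2])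
  filter_upwards [hlt] with h hh
  have := H (ramp t h) (lipschitzWith_ramp t h) (fun r => ramp_nonneg _ _ _) (fun r hr =>
      ramp_eq_zero hh.1 (hr.trans ht.1.1.le))
  rw [weakPairing_ramp hab hA hB ht.1.1.le hh.1 (by linarith [hh.2])] at this
  linarith

end DuBoisReymond

/-! ### Quadratically homogeneous convex Lagrangians -/

section Lagrangian

variable {V : Type*} [NormedAddCommGroup V] [NormedSpace ℝ V]

/-- The derivative of a Lagrangian in the velocity. -/
noncomputable def momentum (L : V × V → ℝ) (u v : V) : V →L[ℝ] ℝ :=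
  (fderiv ℝ L (u, v)).comp (ContinuousLinearMap.inr ℝ V V)

/-- The derivative of a Lagrangian in the position. -/
noncomputable def force (L : V × V → ℝ) (u v : V) : V →L[ℝ] ℝ :=
  (fderiv ℝ L (u, v)).comp (ContinuousLinearMap.inl ℝ V V)

theorem momentum_apply (L : V × V → ℝ) (u v w : V) :
    momentum L u v w = fderiv ℝ L (u, v) (0, w) := rfl

theorem force_apply (L : V × V → ℝ) (u v w : V) :
    force L u v w = fderiv ℝ L (u, v) (w, 0) := rfl

theorem fderiv_apply_eq (L : V × V → ℝ) (u v η η' : V) :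
    fderiv ℝ L (u, v) (η, η') = force L u v η + momentum L u v η' := by
  rw [momentum_apply, force_apply, ← map_add, Prod.mk_add_mk, add_zero, zero_add]

/-- A Lagrangian over `U` which is `C¹`, positively homogeneous of degree two, positive and strictly
convex in the velocity. -/
structure IsLagrangian (U : Set V) (L : V × V → ℝ) : Prop where
  isOpen : IsOpen U
  contDiffOn : ContDiffOn ℝ 1 L (U ×ˢ univ)
  homog : ∀ u ∈ U, ∀ v : V, ∀ c : ℝ, 0 < c → L (u, c • v) = c ^ 2 * L (u, v)
  pos : ∀ u ∈ U, ∀ v : V, v ≠ 0 → 0 < L (u, v)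
  strictMono : ∀ u ∈ U, ∀ v v' : V, v ≠ v' →
    0 < (momentum L u v' - momentum L u v) (v' - v)

namespace IsLagrangian

variable {U : Set V} {L : V × V → ℝ}

theorem isOpen_prod (h : IsLagrangian U L) : IsOpen (U ×ˢ (univ : Set V)) :=
  h.isOpen.prod isOpen_univ

theorem contDiffAt (h : IsLagrangian U L) {u : V} (hu : u ∈ U) (v : V) :
    ContDiffAt ℝ 1 L (u, v) :=
  h.contDiffOn.contDiffAt (h.isOpen_prod.mem_nhds ⟨hu, mem_univ _⟩)

theorem hasStrictFDerivAt (h : IsLagrangian U L) {u : V} (hu : u ∈ U) (v : V) :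
    HasStrictFDerivAt L (fderiv ℝ L (u, v)) (u, v) :=
  (h.contDiffAt hu v).hasStrictFDerivAt (by norm_num)

theorem hasFDerivAt (h : IsLagrangian U L) {u : V} (hu : u ∈ U) (v : V) :
    HasFDerivAt L (fderiv ℝ L (u, v)) (u, v) :=
  (h.hasStrictFDerivAt hu v).hasFDerivAt

theorem continuousAt_fderiv (h : IsLagrangian U L) {u : V} (hu : u ∈ U) (v : V) :
    ContinuousAt (fderiv ℝ L) (u, v) :=
  ((h.contDiffAt hu v).fderiv_right (m := 0) (by norm_num)).continuousAt

theorem continuousAt_momentum (h : IsLagrangian U L) {u : V} (hu : u ∈ U) (v : V) :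
    ContinuousAt (fun q : V × V => momentum L q.1 q.2) (u, v) :=
  (h.continuousAt_fderiv hu v).clm_comp continuousAt_const

theorem continuousAt_force (h : IsLagrangian U L) {u : V} (hu : u ∈ U) (v : V) :
    ContinuousAt (fun q : V × V => force L q.1 q.2) (u, v) :=
  (h.continuousAt_fderiv hu v).clm_comp continuousAt_const

theorem hasFDerivAt_momentum (h : IsLagrangian U L) {u : V} (hu : u ∈ U) (v : V) :
    HasFDerivAt (fun w => L (u, w)) (momentum L u v) v :=
  (h.hasFDerivAt hu v).comp v (hasFDerivAt_prodMk_right u v)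

theorem hasFDerivAt_force (h : IsLagrangian U L) {u : V} (hu : u ∈ U) (v : V) :
    HasFDerivAt (fun q => L (q, v)) (force L u v) u :=
  (h.hasFDerivAt hu v).comp u (hasFDerivAt_prodMk_left u v)

theorem momentum_self (h : IsLagrangian U L) {u : V} (hu : u ∈ U) (v : V) :
    momentum L u v v = 2 * L (u, v) := by
  have h1 : HasDerivAt (fun c : ℝ => L (u, c • v)) (momentum L u v v) 1 := by
    have : HasDerivAt (fun c : ℝ => c • v) v 1 := by
      simpa using (hasDerivAt_id (1 : ℝ)).smul_const v
    have h2 := h.hasFDerivAt_momentum hu ((1 : ℝ) • v)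
    have := h2.comp_hasDerivAt (1 : ℝ) this
    rwa [one_smul] at this
  have h2 : HasDerivAt (fun c : ℝ => c ^ 2 * L (u, v)) (2 * L (u, v)) 1 := by
    simpa using (hasDerivAt_pow 2 (1 : ℝ)).mul_const (L (u, v))
  refine (h1.congr_of_eventuallyEq ?_).unique h2
  filter_upwards [Ioi_mem_nhds (zero_lt_one : (0 : ℝ) < 1)] with c hc
  exact (h.homog u hu v c hc).symm

theorem apply_zero (h : IsLagrangian U L) {u : V} (hu : u ∈ U) : L (u, 0) = 0 := by
  have := h.momentum_self hu 0
  rw [map_zero] at this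
  linarith

theorem apply_nonneg (h : IsLagrangian U L) {u : V} (hu : u ∈ U) (v : V) : 0 ≤ L (u, v) := by
  rcases eq_or_ne v 0 with rfl | hv
  · exact (h.apply_zero hu).ge
  · exact (h.pos u hu v hv).le

theorem momentum_injective (h : IsLagrangian U L) {u : V} (hu : u ∈ U) :
    Function.Injective (momentum L u) := by
  intro v v' e
  by_contra hne
  have := h.strictMono u hu v v' hne
  rw [e, sub_self] at this
  simp at this

/-- The mean value theorem on the segment, followed by monotonicity of the gradient in the velocity.
-/
theorem convex_le (h : IsLagrangian U L) {u : V} (hu : u ∈ U) (v v' : V) :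
    L (u, v) + momentum L u v (v' - v) ≤ L (u, v') := by
  set g : ℝ → ℝ := fun t => L (u, v + t • (v' - v)) with hg
  have hd : ∀ t, HasDerivAt g (momentum L u (v + t • (v' - v)) (v' - v)) t := by
    intro t
    have : HasDerivAt (fun c : ℝ => v + c • (v' - v)) (v' - v) t := by
      simpa using ((hasDerivAt_id t).smul_const (v' - v)).const_add v
    exact (h.hasFDerivAt_momentum hu _).comp_hasDerivAt t this
  obtain ⟨t, ht, e⟩ := exists_hasDerivAt_eq_slope g _ zero_lt_one
    (fun t _ => (hd t).continuousAt.continuousWithinAt) (fun t _ => hd t)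
  have e1 : g 1 = L (u, v') := by simp [hg]
  have e0 : g 0 = L (u, v) := by simp [hg]
  rw [e1, e0] at e
  have hm : momentum L u v (v' - v) ≤ momentum L u (v + t • (v' - v)) (v' - v) := by
    rcases eq_or_ne v v' with rfl | hne
    · simp
    have hne' : v ≠ v + t • (v' - v) := by
      intro e
      have : t • (v' - v) = 0 := by simpa using e
      rcases smul_eq_zero.1 this with h0 | h0
      · exact ht.1.ne' h0
      · exact hne (sub_eq_zero.1 h0).symm
    have := h.strictMono u hu v _ hne'
    rw [add_sub_cancel_left, map_smul, smul_eq_mul] at this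
    have := (pos_iff_pos_of_mul_pos this).1 ht.1
    rw [sub_apply] at this
    linarith
  linarith

theorem momentum_smul (h : IsLagrangian U L) {u : V} (hu : u ∈ U) (v : V) {c : ℝ} (hc : 0 < c) :
    momentum L u (c • v) = c • momentum L u v := by
  have h1 : HasFDerivAt (fun w : V => L (u, c • w)) (c • momentum L u (c • v)) v := by
    have h2 : HasFDerivAt (fun w : V => c • w) (c • ContinuousLinearMap.id ℝ V) v :=
      (hasFDerivAt_id v).const_smul c
    have h3 := (h.hasFDerivAt_momentum hu (c • v)).comp v h2
    convert! h3 using 1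
    ext w; simp
  have h2 : HasFDerivAt (fun w : V => c ^ 2 * L (u, w)) ((c ^ 2) • momentum L u v) v :=
    (h.hasFDerivAt_momentum hu v).const_mul (c ^ 2)
  have h3 : c • momentum L u (c • v) = (c ^ 2) • momentum L u v := by
    refine h1.unique (h2.congr_of_eventuallyEq ?_)
    exact Eventually.of_forall fun w => h.homog u hu w c hc
  rw [sq, mul_smul] at h3
  exact smul_right_injective _ hc.ne' h3

theorem force_smul (h : IsLagrangian U L) {u : V} (hu : u ∈ U) (v : V) {c : ℝ} (hc : 0 < c) :
    force L u (c • v) = c ^ 2 • force L u v := by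
  refine (h.hasFDerivAt_force hu (c • v)).unique
    (((h.hasFDerivAt_force hu v).const_mul (c ^ 2)).congr_of_eventuallyEq ?_)
  filter_upwards [h.isOpen.mem_nhds hu] with q hq using h.homog q hq v c hc

/-- Scaling the zero velocity by `2` multiplies the force by `4` and changes nothing. -/
theorem force_zero (h : IsLagrangian U L) {u : V} (hu : u ∈ U) : force L u 0 = 0 := by
  have := h.force_smul hu 0 (c := 2) (by norm_num)
  rw [smul_zero] at this
  ext w
  have h1 := congrArg (fun l : V →L[ℝ] ℝ => l w) this
  simp only [smul_apply, smul_eq_mul] at h1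
  rw [zero_apply]
  linarith

theorem momentum_zero (h : IsLagrangian U L) {u : V} (hu : u ∈ U) : momentum L u 0 = 0 := by
  have := h.momentum_smul hu 0 (c := 2) (by norm_num)
  rw [smul_zero] at this
  ext w
  have h1 := congrArg (fun l : V →L[ℝ] ℝ => l w) this
  simp only [smul_apply, smul_eq_mul] at h1
  rw [zero_apply]
  linarith

/-! ### Growth estimates over compact sets of positions, and the inverse Legendre transform. -/

section Compact

variable [FiniteDimensional ℝ V]

theorem exists_coercive (h : IsLagrangian U L) {K : Set V} (hK : IsCompact K) (hKU : K ⊆ U) :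
    ∃ c > 0, ∀ u ∈ K, ∀ v, c * ‖v‖ ^ 2 ≤ L (u, v) := by
  have : ProperSpace V := FiniteDimensional.proper_real V
  have hc : IsCompact (K ×ˢ Metric.sphere (0 : V) 1) := hK.prod (isCompact_sphere _ _)
  obtain ⟨c, hc0, H⟩ := hc.exists_forall_le' (f := L) (a := 0)
    (h.contDiffOn.continuousOn.mono (prod_mono hKU (subset_univ _)))
    (fun q hq => h.pos q.1 (hKU hq.1) q.2 (by
      intro e
      have := hq.2
      rw [e] at this
      simp at this))
  refine ⟨c, hc0, fun u hu v => ?_⟩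
  rcases eq_or_ne v 0 with rfl | hv
  · simp [h.apply_zero (hKU hu)]
  have hn : 0 < ‖v‖ := norm_pos_iff.2 hv
  have e : v = ‖v‖ • (‖v‖⁻¹ • v) := by rw [smul_smul, mul_inv_cancel₀ hn.ne', one_smul]
  rw [e, h.homog u (hKU hu) _ _ hn, ← e, mul_comm]
  gcongr
  exact H (u, _) ⟨hu, by simp [norm_smul, hn.ne']⟩

/-- Euler's identity bounds `2 L(u, v)` by `‖momentum‖ ‖v‖`, while coercivity bounds it below by a
multiple of `‖v‖ ^ 2`. A bounded momentum therefore means a bounded velocity. -/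
theorem exists_le_momentum (h : IsLagrangian U L) {K : Set V} (hK : IsCompact K) (hKU : K ⊆ U) :
    ∃ c > 0, ∀ u ∈ K, ∀ v, c * ‖v‖ ≤ ‖momentum L u v‖ := by
  obtain ⟨c, hc, H⟩ := h.exists_coercive hK hKU
  refine ⟨c, hc, fun u hu v => ?_⟩
  rcases eq_or_ne v 0 with rfl | hv
  · simp
  have hn : 0 < ‖v‖ := norm_pos_iff.2 hv
  have h1 := H u hu v
  have h2 := (le_abs_self _).trans ((momentum L u v).le_opNorm v)
  rw [h.momentum_self (hKU hu)] at h2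
  have h3 : c * ‖v‖ * ‖v‖ ≤ ‖momentum L u v‖ * ‖v‖ := by nlinarith [h.apply_nonneg (hKU hu) v]
  exact le_of_mul_le_mul_right h3 hn

theorem exists_growth (h : IsLagrangian U L) {K : Set V} (hK : IsCompact K) (hKU : K ⊆ U) :
    ∃ C, 0 ≤ C ∧ ∀ u ∈ K, ∀ v, ‖momentum L u v‖ ≤ C * ‖v‖ ∧ ‖force L u v‖ ≤ C * ‖v‖ ^ 2 := by
  have : ProperSpace V := FiniteDimensional.proper_real V
  have hc : IsCompact (K ×ˢ Metric.sphere (0 : V) 1) := hK.prod (isCompact_sphere _ _)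
  obtain ⟨C₁, H₁⟩ := hc.exists_bound_of_continuousOn (f := fun q : V × V => momentum L q.1 q.2)
    (fun q hq => (h.continuousAt_momentum (hKU hq.1) q.2).continuousWithinAt)
  obtain ⟨C₂, H₂⟩ := hc.exists_bound_of_continuousOn (f := fun q : V × V => force L q.1 q.2)
    (fun q hq => (h.continuousAt_force (hKU hq.1) q.2).continuousWithinAt)
  refine ⟨max 0 (max C₁ C₂), le_max_left _ _, fun u hu v => ?_⟩
  rcases eq_or_ne v 0 with rfl | hv
  · simp [h.momentum_zero (hKU hu), h.force_zero (hKU hu)]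
  have hn : 0 < ‖v‖ := norm_pos_iff.2 hv
  have e : v = ‖v‖ • (‖v‖⁻¹ • v) := by rw [smul_smul, mul_inv_cancel₀ hn.ne', one_smul]
  have hmem : (u, ‖v‖⁻¹ • v) ∈ K ×ˢ Metric.sphere (0 : V) 1 := ⟨hu, by simp [norm_smul, hn.ne']⟩
  constructor
  · have e1 : momentum L u v = ‖v‖ • momentum L u (‖v‖⁻¹ • v) := by
      rw [← h.momentum_smul (hKU hu) _ hn, ← e]
    rw [e1, norm_smul, norm_norm, mul_comm]
    gcongr
    exact (H₁ _ hmem).trans ((le_max_left _ _).trans (le_max_right _ _))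
  · have e1 : force L u v = ‖v‖ ^ 2 • force L u (‖v‖⁻¹ • v) := by
      rw [← h.force_smul (hKU hu) _ hn, ← e]
    rw [e1, norm_smul, norm_pow, norm_norm, mul_comm]
    gcongr
    exact (H₂ _ hmem).trans ((le_max_right _ _).trans (le_max_right _ _))

/-- The inverse Legendre transform is continuous. -/
theorem exists_tendsto_of_momentum (h : IsLagrangian U L) {ι : Type*} {l : Filter ι} [l.NeBot]
    {y v : ι → V} {u : V} (hu : u ∈ U) (hy : Tendsto y l (𝓝 u)) {P : V →L[ℝ] ℝ}
    (hP : Tendsto (fun i => momentum L (y i) (v i)) l (𝓝 P)) :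
    ∃ v₀, momentum L u v₀ = P ∧ Tendsto v l (𝓝 v₀) := by
  have : ProperSpace V := FiniteDimensional.proper_real V
  obtain ⟨K, hK, huK, hKU⟩ := exists_compact_subset h.isOpen hu
  obtain ⟨c, hc, H⟩ := h.exists_le_momentum hK hKU
  have hyK : ∀ᶠ i in l, y i ∈ K := hy (mem_interior_iff_mem_nhds.1 huK)
  -- The velocities stay in a compact ball. Each cluster point has momentum `P` by continuity, and
  -- injectivity of the momentum leaves only one cluster point.
  have hbd : ∀ᶠ i in l, v i ∈ Metric.closedBall (0 : V) ((‖P‖ + 1) / c) := by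
    filter_upwards [hyK, hP.norm.eventually_lt_const (lt_add_one ‖P‖)] with i h1 h2
    rw [mem_closedBall_zero_iff, le_div_iff₀ hc, mul_comm]
    exact (H _ h1 _).trans h2.le
  have hB := isCompact_closedBall (0 : V) ((‖P‖ + 1) / c)
  have key : ∀ w, MapClusterPt w l v → momentum L u w = P := by
    intro w hw
    obtain ⟨f, hf, hfw⟩ := mapClusterPt_iff_ultrafilter.1 hw
    have h1 : Tendsto (fun i => (y i, v i)) f (𝓝 (u, w)) :=
      (hy.mono_left hf).prodMk_nhds hfw
    exact tendsto_nhds_unique ((h.continuousAt_momentum hu w).tendsto.comp h1) (hP.mono_left hf)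
  obtain ⟨v₀, -, hv₀⟩ := hB.exists_mapClusterPt_of_frequently hbd.frequently
  refine ⟨v₀, key _ hv₀, hB.tendsto_nhds_of_unique_mapClusterPt hbd fun w _ hw => ?_⟩
  exact h.momentum_injective hu ((key w hw).trans (key v₀ hv₀).symm)

end Compact

/-- The Fenchel inequality for the energies at two times. -/
theorem energy_sub_le (h : IsLagrangian U L) {u u' : V} (hu : u ∈ U) (hu' : u' ∈ U) (v v' : V) :
    L (u', v') - L (u, v) ≤
      (momentum L u' v' - momentum L u v) v' - (L (u', v') - L (u, v')) := by
  -- With Euler's identity this is Fenchel's inequality `momentum L u v v' ≤ L (u, v) + L (u, v')`,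
  -- as `L` takes the same value as its Legendre dual at corresponding points.
  have h1 := h.convex_le hu v v'
  have h2 := h.momentum_self hu v
  have h3 := h.momentum_self hu' v'
  rw [map_sub] at h1
  rw [sub_apply]
  linarith

end IsLagrangian

end Lagrangian

/-! ### Regularity of curves whose momentum is continuous up to a monotone multiplier -/

/-- An interval of positive length meets every set of full measure. This permits limits along `𝓝[>]
s ⊓ ae volume`, which is needed because the formula for the momentum holds only almost everywhere.
-/
theorem neBot_inf_ae {l : Filter ℝ} (hl : ∀ s ∈ l, ∃ c d : ℝ, c < d ∧ Ioo c d ⊆ s) :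
    (l ⊓ ae volume).NeBot := by
  rw [inf_neBot_iff]
  intro s hs t ht
  obtain ⟨c, d, hcd, hsub⟩ := hl s hs
  by_contra hne
  rw [not_nonempty_iff_eq_empty] at hne
  have h1 : Ioo c d ⊆ tᶜ := fun r hr hr' => by
    have : r ∈ s ∩ t := ⟨hsub hr, hr'⟩
    rw [hne] at this
    exact this
  have h2 : volume (Ioo c d) = 0 := measure_mono_null h1 ht
  rw [Real.volume_Ioo, ENNReal.ofReal_eq_zero] at h2
  linarith

instance neBot_nhdsGT_inf_ae (s : ℝ) : (𝓝[>] s ⊓ ae volume).NeBot :=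
  neBot_inf_ae fun _ ht => by
    obtain ⟨d, hd, hsub⟩ := mem_nhdsGT_iff_exists_Ioo_subset.1 ht
    exact ⟨s, d, hd, hsub⟩

instance neBot_nhdsLT_inf_ae (s : ℝ) : (𝓝[<] s ⊓ ae volume).NeBot :=
  neBot_inf_ae fun _ ht => by
    obtain ⟨d, hd, hsub⟩ := mem_nhdsLT_iff_exists_Ioo_subset.1 ht
    exact ⟨d, s, hd, hsub⟩

section Regularity

variable {V : Type*} [NormedAddCommGroup V] [NormedSpace ℝ V] [FiniteDimensional ℝ V]
  {U : Set V} {L : V × V → ℝ} {y : ℝ → V} {a b : ℝ}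

theorem IsH1On.eq_add_integral (hy : IsH1On y a b) {s : ℝ} (hs : s ∈ Icc a b) :
    y s = y a + ∫ r in a..s, deriv y r := by
  rw [(hy.mono (hs.1.trans hs.2) hs.1 le_rfl hs.2).integral_deriv hs.1]
  abel

theorem IsH1On.stronglyMeasurableAtFilter_deriv [CompleteSpace V] (l : Filter ℝ) :
    StronglyMeasurableAtFilter (deriv y) l :=
  have : ProperSpace V := FiniteDimensional.proper_real V
  ⟨univ, univ_mem, aestronglyMeasurable_deriv _ _⟩

/-- Inverting the Legendre transform turns the limit of the momentum into an almost everywhere limit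
of `deriv y`; the fundamental theorem of calculus converts this into a one-sided derivative of `y`.
-/
theorem IsLagrangian.exists_right_velocity (h : IsLagrangian U L) (hy : IsH1On y a b)
    (hyU : ∀ s ∈ Icc a b, y s ∈ U) {P : ℝ → V →L[ℝ] ℝ}
    (hP : ∀ᵐ r, r ∈ Ioo a b → momentum L (y r) (deriv y r) = P r) {s : ℝ} (hs : s ∈ Ico a b)
    {p : V →L[ℝ] ℝ} (hp : Tendsto P (𝓝[>] s) (𝓝 p)) :
    ∃ v₀, momentum L (y s) v₀ = p ∧ HasDerivWithinAt y v₀ (Ici s) s := by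
  have : CompleteSpace V := FiniteDimensional.complete ℝ V
  have hab : a ≤ b := hs.1.trans hs.2.le
  have hI : Ioo s b ∈ 𝓝[>] s := Ioo_mem_nhdsGT hs.2
  have hyt : Tendsto y (𝓝[>] s) (𝓝 (y s)) :=
    ((hy.continuousOn hab s (Ico_subset_Icc_self hs)).mono_left
      (nhdsWithin_le_iff.2 (mem_of_superset hI fun r hr =>
        ⟨hs.1.trans hr.1.le, hr.2.le⟩)))
  have hev : ∀ᶠ r in 𝓝[>] s ⊓ ae volume, momentum L (y r) (deriv y r) = P r := by
    filter_upwards [mem_inf_of_left hI, mem_inf_of_right hP] with r h1 h2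
    exact h2 ⟨hs.1.trans_lt h1.1, h1.2⟩
  obtain ⟨v₀, hv, ht⟩ := h.exists_tendsto_of_momentum (l := 𝓝[>] s ⊓ ae volume)
    (hyU s (Ico_subset_Icc_self hs)) (hyt.mono_left inf_le_left)
    ((hp.mono_left inf_le_left).congr' (hev.mono fun _ e => e.symm))
  refine ⟨v₀, hv, ?_⟩
  have h1 : HasDerivWithinAt (fun u => ∫ r in a..u, deriv y r) v₀ (Ici s) s :=
    intervalIntegral.integral_hasDerivWithinAt_of_tendsto_ae_right
      ((hy.mono hab hs.1 le_rfl hs.2.le).intervalIntegrable hs.1)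
      (IsH1On.stronglyMeasurableAtFilter_deriv _) ht
  refine (h1.const_add (y a)).congr_of_eventuallyEq ?_
    (hy.eq_add_integral (Ico_subset_Icc_self hs))
  filter_upwards [Ico_mem_nhdsGE hs.2] with r hr
  exact hy.eq_add_integral ⟨hs.1.trans hr.1, hr.2.le⟩

theorem IsLagrangian.exists_left_velocity (h : IsLagrangian U L) (hy : IsH1On y a b)
    (hyU : ∀ s ∈ Icc a b, y s ∈ U) {P : ℝ → V →L[ℝ] ℝ}
    (hP : ∀ᵐ r, r ∈ Ioo a b → momentum L (y r) (deriv y r) = P r) {s : ℝ} (hs : s ∈ Ioc a b)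
    {p : V →L[ℝ] ℝ} (hp : Tendsto P (𝓝[<] s) (𝓝 p)) :
    ∃ v₀, momentum L (y s) v₀ = p ∧ HasDerivWithinAt y v₀ (Iic s) s := by
  have : CompleteSpace V := FiniteDimensional.complete ℝ V
  have hab : a ≤ b := hs.1.le.trans hs.2
  have hI : Ioo a s ∈ 𝓝[<] s := Ioo_mem_nhdsLT hs.1
  have hyt : Tendsto y (𝓝[<] s) (𝓝 (y s)) :=
    ((hy.continuousOn hab s (Ioc_subset_Icc_self hs)).mono_left
      (nhdsWithin_le_iff.2 (mem_of_superset hI fun r hr =>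
        ⟨hr.1.le, hr.2.le.trans hs.2⟩)))
  have hev : ∀ᶠ r in 𝓝[<] s ⊓ ae volume, momentum L (y r) (deriv y r) = P r := by
    filter_upwards [mem_inf_of_left hI, mem_inf_of_right hP] with r h1 h2
    exact h2 ⟨h1.1, h1.2.trans_le hs.2⟩
  obtain ⟨v₀, hv, ht⟩ := h.exists_tendsto_of_momentum (l := 𝓝[<] s ⊓ ae volume)
    (hyU s (Ioc_subset_Icc_self hs)) (hyt.mono_left inf_le_left)
    ((hp.mono_left inf_le_left).congr' (hev.mono fun _ e => e.symm))
  refine ⟨v₀, hv, ?_⟩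
  -- The fundamental theorem on the left uses `𝓝[≤] s`, which differs from `𝓝[<] s` only by the null
  -- set `{s}`.
  have hle : 𝓝[≤] s ⊓ ae volume ≤ 𝓝[<] s ⊓ ae volume := by
    refine le_inf ?_ inf_le_right
    have hne : {s}ᶜ ∈ ae (volume : Measure ℝ) := by simp [mem_ae_iff]
    rw [← Iic_sdiff_right, sdiff_eq, nhdsWithin_inter']
    exact inf_le_inf_left _ (le_principal_iff.2 hne)
  have h1 : HasDerivWithinAt (fun u => ∫ r in a..u, deriv y r) v₀ (Iic s) s :=
    intervalIntegral.integral_hasDerivWithinAt_of_tendsto_ae_right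
      ((hy.mono hab hs.1.le le_rfl hs.2).intervalIntegrable hs.1.le)
      (IsH1On.stronglyMeasurableAtFilter_deriv _) (ht.mono_left hle)
  refine (h1.const_add (y a)).congr_of_eventuallyEq ?_
    (hy.eq_add_integral (Ioc_subset_Icc_self hs))
  filter_upwards [Ioc_mem_nhdsLE hs.1] with r hr
  exact hy.eq_add_integral ⟨hr.1.le, hr.2.trans hs.2⟩

/-- Either the multiplier `m` is constant near `s`, or `s` is a contact time: a local maximum along
`y` of a function whose differential is a positive multiple of `N s ≠ 0`. -/
def ContactAlternative (y : ℝ → V) (m : ℝ → ℝ) (N : ℝ → V →L[ℝ] ℝ) (s : ℝ) : Prop :=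
  (∀ᶠ r in 𝓝 s, m r = m s) ∨
    ∃ f : V → ℝ, ∃ c : ℝ, 0 < c ∧ N s ≠ 0 ∧ HasFDerivAt f (c • N s) (y s) ∧
      ∀ᶠ r in 𝓝 s, f (y r) ≤ f (y s)

theorem hasDerivWithinAt_Ici_nonpos {g : ℝ → ℝ} {g' s : ℝ} (hg : HasDerivWithinAt g g' (Ici s) s)
    (hle : ∀ᶠ r in 𝓝 s, g r ≤ g s) : g' ≤ 0 := by
  have h1 := hasDerivWithinAt_iff_tendsto_slope.1 hg
  rw [show Ici s \ {s} = Ioi s from Ici_sdiff_left] at h1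
  refine le_of_tendsto h1 ?_
  filter_upwards [self_mem_nhdsWithin, mem_nhdsWithin_of_mem_nhds hle] with r hr hr'
  rw [slope_def_field]
  exact div_nonpos_of_nonpos_of_nonneg (by linarith) (by linarith [mem_Ioi.1 hr])

theorem hasDerivWithinAt_Iic_nonneg {g : ℝ → ℝ} {g' s : ℝ} (hg : HasDerivWithinAt g g' (Iic s) s)
    (hle : ∀ᶠ r in 𝓝 s, g r ≤ g s) : 0 ≤ g' := by
  have h1 := hasDerivWithinAt_iff_tendsto_slope.1 hg
  rw [show Iic s \ {s} = Iio s from Iic_sdiff_right] at h1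
  refine ge_of_tendsto h1 ?_
  filter_upwards [self_mem_nhdsWithin, mem_nhdsWithin_of_mem_nhds hle] with r hr hr'
  rw [slope_def_field]
  exact div_nonneg_of_nonpos (by linarith) (by linarith [mem_Iio.1 hr])

/-- Both one-sided velocities exist because `m` is monotone. If `m` is locally constant they have
the same momentum; at a contact time the sign of the constraint and the sign of a jump of `m` are
incompatible with strict convexity. -/
theorem IsLagrangian.regularity (h : IsLagrangian U L) (hy : IsH1On y a b)
    (hyU : ∀ s ∈ Icc a b, y s ∈ U) {Q N : ℝ → V →L[ℝ] ℝ} {m : ℝ → ℝ}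
    (hQ : ContinuousOn Q (Icc a b)) (hN : ContinuousOn N (Icc a b)) (hm : Monotone m)
    (hP : ∀ᵐ r, r ∈ Ioo a b → momentum L (y r) (deriv y r) = Q r + m r • N r)
    (hc : ∀ s ∈ Ioo a b, ContactAlternative y m N s) :
    ∀ s ∈ Ioo a b, DifferentiableAt ℝ y s ∧ ContinuousAt (deriv y) s ∧ ContinuousAt m s ∧
      momentum L (y s) (deriv y s) = Q s + m s • N s := by
  have key : ∀ s ∈ Ioo a b, DifferentiableAt ℝ y s ∧ ContinuousAt m s ∧
      momentum L (y s) (deriv y s) = Q s + m s • N s := by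
    intro s hs
    have hI : Icc a b ∈ 𝓝 s := Icc_mem_nhds hs.1 hs.2
    have hQs : Tendsto Q (𝓝 s) (𝓝 (Q s)) := hQ.continuousAt hI
    have hNs : Tendsto N (𝓝 s) (𝓝 (N s)) := hN.continuousAt hI
    obtain ⟨v₁, e₁, d₁⟩ := h.exists_right_velocity hy hyU hP (Ioo_subset_Ico_self hs)
      ((hQs.mono_left nhdsWithin_le_nhds).add
        ((hm.tendsto_rightLim s).smul (hNs.mono_left nhdsWithin_le_nhds)))
    obtain ⟨v₂, e₂, d₂⟩ := h.exists_left_velocity hy hyU hP (Ioo_subset_Ioc_self hs)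
      ((hQs.mono_left nhdsWithin_le_nhds).add
        ((hm.tendsto_leftLim s).smul (hNs.mono_left nhdsWithin_le_nhds)))
    have hyUs := hyU s (Ioo_subset_Icc_self hs)
    have hcont : ContinuousAt m s ∧ v₁ = v₂ := by
      rcases hc s hs with hconst | ⟨f, c, hc0, hN0, hf, hle⟩
      · have hcm : ContinuousAt m s := by
          refine (continuousAt_const (y := m s)).congr ?_
          exact hconst.mono fun r hr => hr.symm
        refine ⟨hcm, h.momentum_injective hyUs ?_⟩
        rw [e₁, e₂, hm.continuousAt_iff_leftLim_eq_rightLim.1 hcm]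
      · have c₁ := hasDerivWithinAt_Ici_nonpos (hf.comp_hasDerivWithinAt s d₁) hle
        have c₂ := hasDerivWithinAt_Iic_nonneg (hf.comp_hasDerivWithinAt s d₂) hle
        rw [smul_apply, smul_eq_mul] at c₁ c₂
        have c₁' : N s v₁ ≤ 0 := nonpos_of_mul_nonpos_right c₁ hc0
        have c₂' : 0 ≤ N s v₂ := nonneg_of_mul_nonneg_right c₂ hc0
        -- Strict monotonicity would give `0 < (m₊ - m₋) (N v₁ - N v₂)` for the right velocity `v₁`
        -- and the left velocity `v₂`, whereas `m₊ ≥ m₋` and `N v₁ ≤ 0 ≤ N v₂`.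
        have hv : v₁ = v₂ := by
          by_contra hne
          have := h.strictMono _ hyUs v₂ v₁ (Ne.symm hne)
          rw [e₁, e₂, add_sub_add_left_eq_sub, sub_apply, smul_apply, smul_apply, smul_eq_mul,
            smul_eq_mul, ← sub_mul, map_sub] at this
          have h1 : 0 ≤ m.rightLim s - m.leftLim s :=
            sub_nonneg.2 (hm.leftLim_le_rightLim le_rfl)
          nlinarith
        refine ⟨hm.continuousAt_iff_leftLim_eq_rightLim.2 ?_, hv⟩
        rw [← hv, e₁, add_right_inj] at e₂
        exact (smul_left_injective ℝ hN0 e₂).symm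
    obtain ⟨hcm, rfl⟩ := hcont
    have hd : HasDerivAt y v₁ s := by
      have := d₂.union d₁
      rwa [Iic_union_Ici, hasDerivWithinAt_univ] at this
    refine ⟨hd.differentiableAt, hcm, ?_⟩
    rw [hd.deriv, e₁, hm.continuousAt_iff_leftLim_eq_rightLim.1 hcm |>.symm]
    congr 2
    exact tendsto_nhds_unique (hm.tendsto_leftLim s) (hcm.tendsto.mono_left nhdsWithin_le_nhds)
  intro s hs
  obtain ⟨h1, h2, h3⟩ := key s hs
  refine ⟨h1, ?_, h2, h3⟩
  have hI : Icc a b ∈ 𝓝 s := Icc_mem_nhds hs.1 hs.2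
  -- The formula for the momentum now holds at every interior time with `m` continuous there, so a
  -- second inversion of the Legendre transform gives continuity of `deriv y`.
  have hPs : Tendsto (fun r => momentum L (y r) (deriv y r)) (𝓝 s) (𝓝 (Q s + m s • N s)) := by
    refine ((hQ.continuousAt hI).tendsto.add (h2.tendsto.smul (hN.continuousAt hI).tendsto)).congr' ?_
    filter_upwards [Ioo_mem_nhds hs.1 hs.2] with r hr
    exact (key r hr).2.2.symm
  obtain ⟨v₀, e, ht⟩ := h.exists_tendsto_of_momentum (hyU s (Ioo_subset_Icc_self hs))
    h1.continuousAt.tendsto hPs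
  have : deriv y s = v₀ := h.momentum_injective (hyU s (Ioo_subset_Icc_self hs)) (h3.trans e.symm)
  rw [ContinuousAt, this]
  exact ht

theorem IsLagrangian.exists_tendsto_deriv (h : IsLagrangian U L) (hy : ContinuousOn y (Icc a b))
    (hyU : ∀ s ∈ Icc a b, y s ∈ U) {Q N : ℝ → V →L[ℝ] ℝ} {m : ℝ → ℝ}
    (hQ : ContinuousOn Q (Icc a b)) (hN : ContinuousOn N (Icc a b))
    (hP : ∀ r ∈ Ioo a b, momentum L (y r) (deriv y r) = Q r + m r • N r) {l : Filter ℝ} [l.NeBot]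
    {e : ℝ} (he : e ∈ Icc a b) (hl : l ≤ 𝓝[Ioo a b] e) {m₀ : ℝ} (hm : Tendsto m l (𝓝 m₀)) :
    ∃ v₀, momentum L (y e) v₀ = Q e + m₀ • N e ∧ Tendsto (deriv y) l (𝓝 v₀) := by
  have hl' : l ≤ 𝓝[Icc a b] e := hl.trans (nhdsWithin_mono _ Ioo_subset_Icc_self)
  refine h.exists_tendsto_of_momentum (hyU e he) ((hy e he).tendsto.mono_left hl') ?_
  refine (((hQ e he).tendsto.mono_left hl').add
    (hm.smul ((hN e he).tendsto.mono_left hl'))).congr' ?_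
  filter_upwards [hl self_mem_nhdsWithin] with r hr using (hP r hr).symm

/-- Continuous induction: increments dominated by those of `σ`. -/
theorem abs_sub_le_of_forall_eventually {E σ : ℝ → ℝ} {s t ε : ℝ} (hst : s ≤ t)
    (hE : ContinuousOn E (Icc s t)) (hσ : ContinuousOn σ (Icc s t))
    (H : ∀ r ∈ Ico s t, ∀ᶠ q in 𝓝[>] r, |E q - E r| ≤ ε * (σ q - σ r)) :
    |E t - E s| ≤ ε * (σ t - σ s) := by
  have hcl : IsClosed ({r | |E r - E s| ≤ ε * (σ r - σ s)} ∩ Icc s t) := by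
    have h1 : ContinuousOn (fun r => |E r - E s| - ε * (σ r - σ s)) (Icc s t) := by fun_prop
    have h2 := h1.preimage_isClosed_of_isClosed isClosed_Icc (isClosed_Iic (a := (0 : ℝ)))
    convert h2 using 1
    ext r
    simp only [mem_inter_iff, mem_ofPred_eq, mem_preimage, mem_Iic, sub_nonpos]
    exact and_comm
  refine hcl.Icc_subset_of_forall_exists_gt (by simp) ?_ (right_mem_Icc.2 hst)
  rintro r ⟨hr, hr'⟩ q hq
  have hev := (H r hr').and (Ioc_mem_nhdsGT hq)
  obtain ⟨q', h1, h2⟩ := hev.exists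
  refine ⟨q', ?_, h2⟩
  have : |E q' - E s| ≤ |E q' - E r| + |E r - E s| := abs_sub_le _ _ _
  have hr2 : |E r - E s| ≤ ε * (σ r - σ s) := hr
  show |E q' - E s| ≤ ε * (σ q' - σ s)
  linarith

/-- This estimates the right-hand side of `IsLagrangian.energy_sub_le`. To first order the increment
of `R` cancels the increment of `L` in the position, since `R' = force`; the remaining multiplier
term is small because `N` vanishes on the velocity wherever `m` is not locally constant. The
velocity `w` is left free because both `deriv y` and the frozen value `deriv y r` are needed. -/
theorem IsLagrangian.energy_increment (h : IsLagrangian U L) {r : ℝ} (hyU : y r ∈ U)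
    {R N : ℝ → V →L[ℝ] ℝ} {m : ℝ → ℝ} (hm : Monotone m)
    (hR : HasDerivAt R (force L (y r) (deriv y r)) r) (hN : ContinuousAt N r)
    (hyr : DifferentiableAt ℝ y r)
    (hc : (∀ᶠ q in 𝓝 r, m q = m r) ∨ N r (deriv y r) = 0) {w : ℝ → V}
    (hw : Tendsto w (𝓝[>] r) (𝓝 (deriv y r))) :
    (fun q => ((R q - R r) + (m q - m r) • N q) (w q) - (L (y q, w q) - L (y r, w q)))
      =o[𝓝[>] r] fun q => (q - r) + (m q - m r) := by
  set v := deriv y r with hv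
  set φ := force L (y r) v with hφ
  have hle : 𝓝[>] r ≤ 𝓝 r := nhdsWithin_le_nhds
  have hdom1 : (fun q => q - r) =O[𝓝[>] r] fun q => (q - r) + (m q - m r) := by
    refine Asymptotics.IsBigO.of_bound 1 ?_
    filter_upwards [self_mem_nhdsWithin] with q hq
    have h1 : 0 < q - r := sub_pos.2 hq
    have h2 : 0 ≤ m q - m r := sub_nonneg.2 (hm (le_of_lt hq))
    rw [Real.norm_of_nonneg h1.le, Real.norm_of_nonneg (by linarith)]
    linarith
  have hdom2 : (fun q => m q - m r) =O[𝓝[>] r] fun q => (q - r) + (m q - m r) := by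
    refine Asymptotics.IsBigO.of_bound 1 ?_
    filter_upwards [self_mem_nhdsWithin] with q hq
    have h1 : 0 < q - r := sub_pos.2 hq
    have h2 : 0 ≤ m q - m r := sub_nonneg.2 (hm (le_of_lt hq))
    rw [Real.norm_of_nonneg h2, Real.norm_of_nonneg (by linarith)]
    linarith
  have hwO : w =O[𝓝[>] r] fun _ => (1 : ℝ) := hw.isBigO_one ℝ
  -- the regular part of the momentum
  have t1 : (fun q => (R q - R r - (q - r) • φ) (w q)) =o[𝓝[>] r] fun q => q - r := by
    have hRo := (hasDerivAt_iff_isLittleO.1 hR).mono hle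
    have := (Asymptotics.IsLittleO.norm_left hRo).mul_isBigO hwO.norm_left
    simp only [mul_one] at this
    refine Asymptotics.IsBigO.trans_isLittleO (Asymptotics.IsBigO.of_bound 1 ?_) this
    refine Eventually.of_forall fun q => ?_
    rw [one_mul, norm_mul, norm_norm, norm_norm]
    exact ContinuousLinearMap.le_opNorm _ _
  -- the increment of the Lagrangian in the position
  have t2 : (fun q => L (y q, w q) - L (y r, w q) - φ (y q - y r)) =o[𝓝[>] r] fun q => q - r := by
    have hs := (h.hasStrictFDerivAt hyU v).isLittleO
    have hpair : Tendsto (fun q => ((y q, w q), (y r, w q))) (𝓝[>] r) (𝓝 ((y r, v), (y r, v))) :=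
      (((hyr.continuousAt.tendsto.mono_left hle).prodMk_nhds hw).prodMk_nhds
        (tendsto_const_nhds.prodMk_nhds hw))
    have h3 := hs.comp_tendsto hpair
    have h4 : (fun q => L (y q, w q) - L (y r, w q) - φ (y q - y r))
        =o[𝓝[>] r] fun q => y q - y r := by
      refine (Asymptotics.IsLittleO.congr h3 (fun q => ?_) (fun q => rfl)).trans_isBigO ?_
      · simp only [Function.comp, Prod.mk_sub_mk, sub_self]
        rfl
      · refine Asymptotics.IsBigO.of_bound 1 (Eventually.of_forall fun q => ?_)
        simp [Prod.norm_def]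
    exact h4.trans_isBigO (hyr.isBigO_sub.mono hle)
  have t3 : (fun q => φ (y q - y r - (q - r) • v)) =o[𝓝[>] r] fun q => q - r := by
    have h1 := (hasDerivAt_iff_isLittleO.1 hyr.hasDerivAt).mono hle
    exact (φ.isBigO_comp _ _).trans_isLittleO h1
  have t4 : (fun q => (q - r) * φ (w q - v)) =o[𝓝[>] r] fun q => q - r := by
    have h1 : (fun q => φ (w q - v)) =o[𝓝[>] r] fun _ => (1 : ℝ) := by
      rw [Asymptotics.isLittleO_one_iff]
      have := (φ.continuous.tendsto _).comp (hw.sub_const v)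
      rwa [sub_self, map_zero] at this
    simpa using (Asymptotics.isBigO_refl (fun q => q - r) (𝓝[>] r)).mul_isLittleO h1
  -- No rate is available for `m q - m r` in terms of `q - r`, which is why the increment of `m`
  -- appears in the gauge.
  have t5 : (fun q => (m q - m r) * N q (w q)) =o[𝓝[>] r] fun q => (q - r) + (m q - m r) := by
    rcases hc with hc | hc
    · refine (Asymptotics.isLittleO_zero _ _).congr' ?_ EventuallyEq.rfl
      filter_upwards [hle hc] with q hq
      have : m q = m r := hq
      rw [this, sub_self, zero_mul]
    · have h1 : (fun q => N q (w q)) =o[𝓝[>] r] fun _ => (1 : ℝ) := by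
        rw [Asymptotics.isLittleO_one_iff, ← hc]
        have h2 : ContinuousAt (fun p : (V →L[ℝ] ℝ) × V => p.1 p.2) (N r, v) :=
          (isBoundedBilinearMap_apply.continuous).continuousAt
        exact h2.tendsto.comp ((hN.tendsto.mono_left hle).prodMk_nhds hw)
      simpa using hdom2.mul_isLittleO h1
  refine (((((t1.sub t2).sub t3).add t4).trans_isBigO hdom1).add t5).congr_left fun q => ?_
  simp only [map_sub, add_apply, sub_apply, smul_apply, smul_eq_mul, map_smul]
  ring

/-- A continuous monotone `m` may grow on a null set, so the energy is controlled through increments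
measured against `s + m s`: each is eventually at most `ε` times the increment of that gauge,
continuous induction sums them, and `ε` tends to `0`. -/
theorem IsLagrangian.energy_constant (h : IsLagrangian U L) (hyU : ∀ s ∈ Icc a b, y s ∈ U)
    {Q N : ℝ → V →L[ℝ] ℝ} {Q' N' : ℝ → V →L[ℝ] ℝ} {m : ℝ → ℝ} (hm : Monotone m)
    (hreg : ∀ s ∈ Ioo a b, DifferentiableAt ℝ y s ∧ ContinuousAt (deriv y) s ∧ ContinuousAt m s ∧
      momentum L (y s) (deriv y s) = Q s + m s • N s)
    (hQ : ∀ s ∈ Ioo a b, HasDerivAt Q (Q' s) s) (hN : ∀ s ∈ Ioo a b, HasDerivAt N (N' s) s)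
    (hQN : ∀ s ∈ Ioo a b, Q' s + m s • N' s = force L (y s) (deriv y s))
    (hc : ∀ s ∈ Ioo a b, ContactAlternative y m N s) {s t : ℝ} (hs : s ∈ Ioo a b)
    (ht : t ∈ Ioo a b) : L (y s, deriv y s) = L (y t, deriv y t) := by
  wlog hst : s ≤ t generalizing s t
  · exact (this ht hs (le_of_not_ge hst)).symm
  set E : ℝ → ℝ := fun r => L (y r, deriv y r) with hE
  have hsub : Icc s t ⊆ Ioo a b := fun r hr => ⟨hs.1.trans_le hr.1, hr.2.trans_lt ht.2⟩
  have hEc : ContinuousOn E (Icc s t) := fun r hr => by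
    obtain ⟨h1, h2, -⟩ := hreg r (hsub hr)
    have h3 := (h.hasFDerivAt (hyU r (Ioo_subset_Icc_self (hsub hr))) (deriv y r)).continuousAt
    exact (ContinuousAt.comp (f := fun r => (y r, deriv y r)) h3
      (h1.continuousAt.prodMk h2)).continuousWithinAt
  have hσc : ContinuousOn (fun r => r + m r) (Icc s t) := fun r hr =>
    (continuousAt_id.add (hreg r (hsub hr)).2.2.1).continuousWithinAt
  have hloc : ∀ ε > 0, ∀ r ∈ Ico s t, ∀ᶠ q in 𝓝[>] r, |E q - E r| ≤ ε * ((q + m q) - (r + m r)) := by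
    intro ε hε r hr
    have hr' := hsub (Ico_subset_Icc_self hr)
    obtain ⟨h1, h2, h3, h4⟩ := hreg r hr'
    have hyr := hyU r (Ioo_subset_Icc_self hr')
    set R : ℝ → V →L[ℝ] ℝ := fun q => Q q + m r • N q with hRdef
    have hR : HasDerivAt R (force L (y r) (deriv y r)) r := by
      rw [← hQN r hr']
      exact (hQ r hr').add ((hN r hr').const_smul (m r))
    have hNc := (hN r hr').continuousAt
    have hcc : (∀ᶠ q in 𝓝 r, m q = m r) ∨ N r (deriv y r) = 0 := by
      rcases hc r hr' with hc | ⟨f, c, hc0, -, hf, hle⟩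
      · exact Or.inl hc
      · right
        have hd := hf.comp_hasDerivAt r h1.hasDerivAt
        have := IsLocalMax.hasDerivAt_eq_zero (f := f ∘ y) hle hd
        rw [smul_apply, smul_eq_mul] at this
        exact (mul_eq_zero.1 this).resolve_left hc0.ne'
    have b1 := (h.energy_increment hyr hm hR hNc h1 hcc
      (w := deriv y) (h2.tendsto.mono_left nhdsWithin_le_nhds)).bound hε
    have b2 := (h.energy_increment hyr hm hR hNc h1 hcc
      (w := fun _ => deriv y r) tendsto_const_nhds).bound hε
    filter_upwards [b1, b2, self_mem_nhdsWithin,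
      mem_nhdsWithin_of_mem_nhds (Ioo_mem_nhds hr'.1 hr'.2)] with q c1 c2 hq hqI
    have hg : 0 ≤ (q - r) + (m q - m r) :=
      add_nonneg (sub_pos.2 hq).le (sub_nonneg.2 (hm (le_of_lt hq)))
    rw [Real.norm_of_nonneg hg, Real.norm_eq_abs] at c1 c2
    have hyq := hyU q (Ioo_subset_Icc_self hqI)
    have hmom : (R q - R r) + (m q - m r) • N q
        = momentum L (y q) (deriv y q) - momentum L (y r) (deriv y r) := by
      rw [h4, (hreg q hqI).2.2.2, hRdef]
      ext w
      simp only [add_apply, sub_apply, smul_apply, smul_eq_mul]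
      ring
    rw [hmom] at c1 c2
    -- Fenchel's inequality in the two orders bounds the increment of the energy from above and from
    -- below; only the test velocity differs.
    have u1 := h.energy_sub_le hyr hyq (deriv y r) (deriv y q)
    have u2 := h.energy_sub_le hyq hyr (deriv y q) (deriv y r)
    rw [← neg_sub (momentum L (y q) (deriv y q)), neg_apply] at u2
    have d1 := (abs_le.1 c1).2
    have d2 := (abs_le.1 c2).1
    rw [abs_le]
    have e : ε * ((q + m q) - (r + m r)) = ε * ((q - r) + (m q - m r)) := by ring
    rw [e, hE]
    constructor <;> simp only <;> linarith
  have hall : ∀ ε > 0, |E t - E s| ≤ ε * ((t + m t) - (s + m s)) := fun ε hε =>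
    abs_sub_le_of_forall_eventually (σ := fun r => r + m r) hst hEc hσc (hloc ε hε)
  have hz : |E t - E s| ≤ 0 := by
    have hlim : Tendsto (fun ε : ℝ => ε * ((t + m t) - (s + m s))) (𝓝[>] 0) (𝓝 0) := by
      have : Tendsto (fun ε : ℝ => ε * ((t + m t) - (s + m s))) (𝓝 0)
          (𝓝 (0 * ((t + m t) - (s + m s)))) := tendsto_id.mul_const _
      rw [zero_mul] at this
      exact this.mono_left nhdsWithin_le_nhds
    exact ge_of_tendsto hlim (eventually_mem_nhdsWithin.mono fun ε hε => hall ε hε)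
  have := abs_nonpos_iff.1 hz
  exact (sub_eq_zero.1 this).symm

end Regularity

/-! ### Weak extremals of an obstacle problem -/

section WeakExtremal

variable {V : Type*} [NormedAddCommGroup V] [NormedSpace ℝ V]

/-- The part of the Euler-Lagrange expression that is tangential with respect to the splitting
`e = (e - ν(e) w) + ν(e) w`. -/
noncomputable def tangentialForce (L : V × V → ℝ) (ν : V → V →L[ℝ] ℝ) (w u v : V) : V →L[ℝ] ℝ :=
  force L u v - force L u v w • ν u - momentum L u v w • fderiv ℝ ν u v

/-- The part of the momentum that is tangential with respect to the same splitting. -/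
noncomputable def tangentialMomentum (L : V × V → ℝ) (ν : V → V →L[ℝ] ℝ) (w u v : V) :
    V →L[ℝ] ℝ :=
  momentum L u v - momentum L u v w • ν u

/-- `y` satisfies the first order conditions of the obstacle problem for the Lagrangian `L`, with
contact set `K` and with the constraint that variations `η` satisfy `ν(η) ≤ 0` on `K`. -/
structure WeakExtremal (U : Set V) (L : V × V → ℝ) (ν : V → V →L[ℝ] ℝ) (w : V) (y : ℝ → V)
    (a b : ℝ) (K : Set ℝ) : Prop where
  lag : IsLagrangian U L
  lt : a < b
  isH1On : IsH1On y a b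
  mem : ∀ s ∈ Icc a b, y s ∈ U
  smooth : ContDiffOn ℝ 1 ν U
  tangential : ∀ (e : V) (τ : ℝ → ℝ), (∃ C, LipschitzWith C τ) → (∀ r, r ∉ Ioo a b → τ r = 0) →
    weakPairing (fun s => tangentialForce L ν w (y s) (deriv y s) e)
      (fun s => tangentialMomentum L ν w (y s) (deriv y s) e) a b τ = 0
  normal : ∀ τ : ℝ → ℝ, (∃ C, LipschitzWith C τ) → (∀ r, r ∉ Ioo a b → τ r = 0) →
    (∀ r ∈ Ioo a b, r ∈ K → τ r ≤ 0) →
    0 ≤ weakPairing (fun s => force L (y s) (deriv y s) w)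
      (fun s => momentum L (y s) (deriv y s) w) a b τ
  contact : ∀ s ∈ Ioo a b, (∀ᶠ r in 𝓝 s, r ∉ K) ∨
    ∃ f : V → ℝ, ∃ c : ℝ, 0 < c ∧ ν (y s) ≠ 0 ∧ HasFDerivAt f (c • ν (y s)) (y s) ∧
      ∀ᶠ r in 𝓝 s, f (y r) ≤ f (y s)

theorem weakPairing_neg (A B : ℝ → ℝ) (a b : ℝ) (τ : ℝ → ℝ) :
    weakPairing A B a b (fun r => - τ r) = - weakPairing A B a b τ := by
  rw [weakPairing, weakPairing, ← intervalIntegral.integral_neg]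
  congr 1
  ext r
  rw [deriv.fun_neg]; ring

variable {U : Set V} {L : V × V → ℝ} {ν : V → V →L[ℝ] ℝ} {w : V} {y : ℝ → V}
  {a b : ℝ} {K : Set ℝ}

theorem continuousAt_comp_velocity {Z : Type*} [TopologicalSpace Z] {G : V × V → Z}
    (hU : IsOpen U) (hG : ContinuousOn G (U ×ˢ univ)) {s : ℝ} (hs : y s ∈ U)
    (h1 : DifferentiableAt ℝ y s) (h2 : ContinuousAt (deriv y) s) :
    ContinuousAt (fun r => G (y r, deriv y r)) s :=
  ContinuousAt.comp (f := fun r => (y r, deriv y r))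
    (hG.continuousAt ((hU.prod isOpen_univ).mem_nhds ⟨hs, mem_univ _⟩))
    (h1.continuousAt.prodMk h2)

theorem stronglyMeasurableAtFilter_of_mem_Ioo {Z : Type*} [NormedAddCommGroup Z] {f : ℝ → Z}
    {s : ℝ} (hf : IntervalIntegrable f volume a b) (hs : s ∈ Ioo a b) :
    StronglyMeasurableAtFilter f (𝓝 s) := by
  rw [intervalIntegrable_iff_integrableOn_Icc_of_le (hs.1.trans hs.2).le] at hf
  exact ⟨Icc a b, Icc_mem_nhds hs.1 hs.2, hf.aestronglyMeasurable⟩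

variable [FiniteDimensional ℝ V]

theorem IsH1On.aestronglyMeasurable_comp {Z : Type*} [NormedAddCommGroup Z]
    (hy : IsH1On y a b) (hab : a ≤ b) (hU : IsOpen U) (hyU : ∀ s ∈ Icc a b, y s ∈ U)
    {G : V × V → Z} (hG : ContinuousOn G (U ×ˢ univ)) :
    AEStronglyMeasurable (fun s => G (y s, deriv y s)) (volume.restrict (Icc a b)) := by
  have : ProperSpace V := FiniteDimensional.proper_real V
  have : CompleteSpace V := FiniteDimensional.complete ℝ V
  borelize V
  have h1 : AEMeasurable (fun s => (y s, deriv y s)) (volume.restrict (Icc a b)) :=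
    ((hy.continuousOn hab).aemeasurable measurableSet_Icc).prodMk (measurable_deriv y).aemeasurable
  have hS : MeasurableSet (U ×ˢ (univ : Set V)) := hU.measurableSet.prod MeasurableSet.univ
  have h2 : AEStronglyMeasurable G
      ((Measure.map (fun s => (y s, deriv y s)) (volume.restrict (Icc a b))).restrict
        (U ×ˢ univ)) := hG.aestronglyMeasurable hS
  rw [Measure.restrict_eq_self_of_ae_mem] at h2
  · exact h2.comp_aemeasurable h1
  · refine (ae_map_iff (p := fun q => q ∈ U ×ˢ (univ : Set V)) h1 hS).2 ?_
    filter_upwards [ae_restrict_mem measurableSet_Icc] with s hs using ⟨hyU s hs, mem_univ _⟩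

/-- At most quadratic growth in the velocity is exactly what a square integrable derivative can
absorb. -/
theorem IsH1On.intervalIntegrable_comp {Z : Type*} [NormedAddCommGroup Z]
    (hy : IsH1On y a b) (hab : a ≤ b) (hU : IsOpen U) (hyU : ∀ s ∈ Icc a b, y s ∈ U)
    {G : V × V → Z} (hG : ContinuousOn G (U ×ˢ univ)) {C : ℝ}
    (hC : ∀ s ∈ Icc a b, ∀ v, ‖G (y s, v)‖ ≤ C * (1 + ‖v‖ ^ 2)) :
    IntervalIntegrable (fun s => G (y s, deriv y s)) volume a b := by
  rw [intervalIntegrable_iff_integrableOn_Icc_of_le hab]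
  have h1 : Integrable (fun s => C * (1 + ‖deriv y s‖ ^ 2)) (volume.restrict (Icc a b)) :=
    ((integrable_const _).add hy.2.integrable_norm_pow').const_mul C
  refine h1.mono' (hy.aestronglyMeasurable_comp hab hU hyU hG) ?_
  filter_upwards [ae_restrict_mem measurableSet_Icc] with s hs using hC s hs _

/-! ### Momentum and multiplier of a weak extremal. -/

namespace WeakExtremal

theorem continuousOn_prod (h : WeakExtremal U L ν w y a b K) :
    ContinuousOn (fun q : V × V => force L q.1 q.2) (U ×ˢ univ) ∧
    ContinuousOn (fun q : V × V => momentum L q.1 q.2) (U ×ˢ univ) ∧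
    ContinuousOn (fun q : V × V => ν q.1) (U ×ˢ univ) ∧
    ContinuousOn (fun q : V × V => fderiv ℝ ν q.1 q.2) (U ×ˢ univ) := by
  refine ⟨fun q hq => (h.lag.continuousAt_force hq.1 q.2).continuousWithinAt,
    fun q hq => (h.lag.continuousAt_momentum hq.1 q.2).continuousWithinAt,
    h.smooth.continuousOn.comp continuousOn_fst fun q hq => hq.1, ?_⟩
  have h1 : ContinuousOn (fun q : V × V => fderiv ℝ ν q.1) (U ×ˢ univ) :=
    (h.smooth.continuousOn_fderiv_of_isOpen h.lag.isOpen le_rfl).comp continuousOn_fst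
      fun q hq => hq.1
  exact h1.clm_apply continuousOn_snd

theorem exists_bound (h : WeakExtremal U L ν w y a b K) :
    ∃ C, 0 ≤ C ∧ ∀ s ∈ Icc a b, ∀ v, ‖momentum L (y s) v‖ ≤ C * ‖v‖ ∧
      ‖force L (y s) v‖ ≤ C * ‖v‖ ^ 2 ∧ ‖ν (y s)‖ ≤ C ∧ ‖fderiv ℝ ν (y s) v‖ ≤ C * ‖v‖ := by
  have hcomp : IsCompact (y '' Icc a b) :=
    isCompact_Icc.image_of_continuousOn (h.isH1On.continuousOn h.lt.le)
  have hsub : y '' Icc a b ⊆ U := by rintro _ ⟨s, hs, rfl⟩; exact h.mem s hs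
  obtain ⟨C₁, h₁, H₁⟩ := h.lag.exists_growth hcomp hsub
  obtain ⟨C₂, H₂⟩ := hcomp.exists_bound_of_continuousOn (h.smooth.continuousOn.mono hsub)
  obtain ⟨C₃, H₃⟩ := hcomp.exists_bound_of_continuousOn
    ((h.smooth.continuousOn_fderiv_of_isOpen h.lag.isOpen le_rfl).mono hsub)
  refine ⟨max C₁ (max C₂ C₃), h₁.trans (le_max_left _ _), fun s hs v => ?_⟩
  have hm := mem_image_of_mem y hs
  refine ⟨(H₁ _ hm v).1.trans ?_, (H₁ _ hm v).2.trans ?_, (H₂ _ hm).trans ?_,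
    ((fderiv ℝ ν (y s)).le_opNorm v).trans ?_⟩
  · gcongr; exact le_max_left _ _
  · gcongr; exact le_max_left _ _
  · exact (le_max_left _ _).trans (le_max_right _ _)
  · gcongr; exact (H₃ _ hm).trans ((le_max_right _ _).trans (le_max_right _ _))

theorem integrable_force (h : WeakExtremal U L ν w y a b K) :
    IntervalIntegrable (fun s => force L (y s) (deriv y s) w) volume a b := by
  obtain ⟨C, hC, H⟩ := h.exists_bound
  refine h.isH1On.intervalIntegrable_comp (C := C * ‖w‖) h.lt.le h.lag.isOpen h.mem
    (G := fun q : V × V => force L q.1 q.2 w) (h.continuousOn_prod.1.clm_apply continuousOn_const)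
    fun s hs v => ?_
  refine ((force L (y s) v).le_opNorm w).trans ?_
  have := (H s hs v).2.1
  calc _ ≤ C * ‖v‖ ^ 2 * ‖w‖ := by gcongr
    _ = C * ‖w‖ * ‖v‖ ^ 2 := by ring
    _ ≤ _ := by gcongr; linarith

theorem norm_le_one_add_sq {W : Type*} [NormedAddCommGroup W] (v : W) : ‖v‖ ≤ 1 + ‖v‖ ^ 2 := by nlinarith [sq_nonneg (‖v‖ - 1)]

theorem integrable_momentum (h : WeakExtremal U L ν w y a b K) :
    IntervalIntegrable (fun s => momentum L (y s) (deriv y s) w) volume a b := by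
  obtain ⟨C, hC, H⟩ := h.exists_bound
  refine h.isH1On.intervalIntegrable_comp (C := C * ‖w‖) h.lt.le h.lag.isOpen h.mem
    (G := fun q : V × V => momentum L q.1 q.2 w)
    (h.continuousOn_prod.2.1.clm_apply continuousOn_const) fun s hs v => ?_
  refine ((momentum L (y s) v).le_opNorm w).trans ?_
  have := (H s hs v).1
  calc _ ≤ C * ‖v‖ * ‖w‖ := by gcongr
    _ = C * ‖w‖ * ‖v‖ := by ring
    _ ≤ _ := by gcongr; exact norm_le_one_add_sq v

theorem integrable_tangentialForce (h : WeakExtremal U L ν w y a b K) :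
    IntervalIntegrable (fun s => tangentialForce L ν w (y s) (deriv y s)) volume a b := by
  obtain ⟨C, hC, H⟩ := h.exists_bound
  obtain ⟨c1, c2, c3, c4⟩ := h.continuousOn_prod
  refine h.isH1On.intervalIntegrable_comp (C := C + C * ‖w‖ * C + C * ‖w‖ * C) h.lt.le
    h.lag.isOpen h.mem (G := fun q : V × V => tangentialForce L ν w q.1 q.2)
    ((c1.sub ((c1.clm_apply continuousOn_const).smul c3)).sub
      ((c2.clm_apply continuousOn_const).smul c4)) fun s hs v => ?_
  obtain ⟨b1, b2, b3, b4⟩ := H s hs v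
  have e1 : ‖force L (y s) v w • ν (y s)‖ ≤ C * ‖v‖ ^ 2 * ‖w‖ * C := by
    rw [norm_smul]
    gcongr
    exact ((force L (y s) v).le_opNorm w).trans (by gcongr)
  have e2 : ‖momentum L (y s) v w • fderiv ℝ ν (y s) v‖ ≤ C * ‖v‖ * ‖w‖ * (C * ‖v‖) := by
    rw [norm_smul]
    gcongr
    exact ((momentum L (y s) v).le_opNorm w).trans (by gcongr)
  calc _ ≤ C * ‖v‖ ^ 2 + C * ‖v‖ ^ 2 * ‖w‖ * C + C * ‖v‖ * ‖w‖ * (C * ‖v‖) :=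
        (norm_sub_le _ _).trans (add_le_add ((norm_sub_le _ _).trans (add_le_add b2 e1)) e2)
    _ = (C + C * ‖w‖ * C + C * ‖w‖ * C) * ‖v‖ ^ 2 := by ring
    _ ≤ _ := by gcongr; linarith

theorem integrable_tangentialMomentum (h : WeakExtremal U L ν w y a b K) :
    IntervalIntegrable (fun s => tangentialMomentum L ν w (y s) (deriv y s)) volume a b := by
  obtain ⟨C, hC, H⟩ := h.exists_bound
  obtain ⟨c1, c2, c3, c4⟩ := h.continuousOn_prod
  refine h.isH1On.intervalIntegrable_comp (C := C + C * ‖w‖ * C) h.lt.le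
    h.lag.isOpen h.mem (G := fun q : V × V => tangentialMomentum L ν w q.1 q.2)
    (c2.sub ((c2.clm_apply continuousOn_const).smul c3)) fun s hs v => ?_
  obtain ⟨b1, b2, b3, b4⟩ := H s hs v
  have e1 : ‖momentum L (y s) v w • ν (y s)‖ ≤ C * ‖v‖ * ‖w‖ * C := by
    rw [norm_smul]
    gcongr
    exact ((momentum L (y s) v).le_opNorm w).trans (by gcongr)
  calc _ ≤ C * ‖v‖ + C * ‖v‖ * ‖w‖ * C := (norm_sub_le _ _).trans (add_le_add b1 e1)
    _ = (C + C * ‖w‖ * C) * ‖v‖ := by ring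
    _ ≤ _ := by gcongr; exact norm_le_one_add_sq v

/-- The multiplier, defined almost everywhere. -/
noncomputable def multiplier (L : V × V → ℝ) (w : V) (y : ℝ → V) (a : ℝ) : ℝ → ℝ :=
  residual (fun s => force L (y s) (deriv y s) w) (fun s => momentum L (y s) (deriv y s) w) a

/-- The continuous part of the momentum along a weak extremal, with initial value `c`. -/
noncomputable def regularMomentum (L : V × V → ℝ) (ν : V → V →L[ℝ] ℝ) (w : V) (y : ℝ → V) (a : ℝ)
    (c : V →L[ℝ] ℝ) (s : ℝ) : V →L[ℝ] ℝ :=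
  c + (∫ r in a..s, tangentialForce L ν w (y r) (deriv y r))
    + (∫ r in a..s, force L (y r) (deriv y r) w) • ν (y s)

/-- The times at which the first order conditions can be read off pointwise. -/
def goodTimes (L : V × V → ℝ) (ν : V → V →L[ℝ] ℝ) (w : V) (y : ℝ → V) (a b : ℝ) : Set ℝ :=
  {s | s ∈ lebesguePoints (fun s => force L (y s) (deriv y s) w)
        (fun s => momentum L (y s) (deriv y s) w) a b ∧
      ∀ i, s ∈ lebesguePoints
        (fun s => tangentialForce L ν w (y s) (deriv y s) (Module.finBasis ℝ V i))
        (fun s => tangentialMomentum L ν w (y s) (deriv y s) (Module.finBasis ℝ V i)) a b}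

theorem integrable_apply {f : ℝ → V →L[ℝ] ℝ} (hf : IntervalIntegrable f volume a b) (e : V) :
    IntervalIntegrable (fun s => f s e) volume a b :=
  ⟨(ContinuousLinearMap.apply ℝ ℝ e).integrable_comp hf.1,
    (ContinuousLinearMap.apply ℝ ℝ e).integrable_comp hf.2⟩

theorem ae_mem_goodTimes (h : WeakExtremal U L ν w y a b K) :
    ∀ᵐ s, s ∈ Ioo a b → s ∈ goodTimes L ν w y a b := by
  have h1 := ae_mem_lebesguePoints h.lt.le h.integrable_force h.integrable_momentum
  have h2 : ∀ᵐ s, ∀ i, s ∈ Ioo a b → s ∈ lebesguePoints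
        (fun s => tangentialForce L ν w (y s) (deriv y s) (Module.finBasis ℝ V i))
        (fun s => tangentialMomentum L ν w (y s) (deriv y s) (Module.finBasis ℝ V i)) a b :=
    ae_all_iff.2 fun i => ae_mem_lebesguePoints h.lt.le
      (integrable_apply h.integrable_tangentialForce _)
      (integrable_apply h.integrable_tangentialMomentum _)
  filter_upwards [h1, h2] with s h1 h2 hs using ⟨h1 hs, fun i => h2 i hs⟩

theorem exists_goodTime (h : WeakExtremal U L ν w y a b K) {c d : ℝ} (hcd : c < d)
    (hac : a ≤ c) (hdb : d ≤ b) : ∃ s ∈ goodTimes L ν w y a b, s ∈ Ioo c d := by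
  by_contra! hne
  have h1 : volume (Ioo c d) = 0 := by
    refine measure_mono_null (fun s hs => ?_) h.ae_mem_goodTimes
    intro hs'
    exact hne s (hs' ⟨hac.trans_lt hs.1, hs.2.trans_le hdb⟩) hs
  rw [Real.volume_Ioo, ENNReal.ofReal_eq_zero] at h1
  linarith

theorem goodTimes_subset : goodTimes L ν w y a b ⊆ Ioo a b := fun _ hs => hs.1.1

/-- For `τ ≥ 0` the variation `-τ w` satisfies the constraint wherever contact occurs, so the
pairing with `τ` is nonpositive. -/
theorem monotoneOn_multiplier (h : WeakExtremal U L ν w y a b K) :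
    MonotoneOn (multiplier L w y a) (goodTimes L ν w y a b) := by
  have := monotoneOn_residual h.lt.le h.integrable_force h.integrable_momentum le_rfl le_rfl
    (fun τ ⟨C, hC⟩ hτ h0 => by
      have := h.normal (fun r => - τ r) ⟨_, hC.neg⟩ (fun r hr => by rw [h0 r hr, neg_zero])
        (fun r _ _ => by simpa using hτ r)
      rw [weakPairing_neg] at this
      linarith)
  exact this.mono fun s hs => ⟨hs.1, hs.1.1⟩

/-- Away from the contact set the constraint is void, so `τ` and `-τ` are both allowed. -/
theorem multiplier_eq (h : WeakExtremal U L ν w y a b K) {c d : ℝ} (hac : a ≤ c) (hdb : d ≤ b)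
    (hK : ∀ r ∈ Ioo c d, r ∉ K) {s t : ℝ} (hs : s ∈ goodTimes L ν w y a b) (hs' : s ∈ Ioo c d)
    (ht : t ∈ goodTimes L ν w y a b) (ht' : t ∈ Ioo c d) :
    multiplier L w y a s = multiplier L w y a t := by
  refine residual_eq h.lt.le h.integrable_force h.integrable_momentum hac hdb
    (fun τ ⟨C, hC⟩ hτ h0 => ?_) ⟨hs.1, hs'⟩ ⟨ht.1, ht'⟩
  have hz : ∀ r, r ∉ Ioo a b → τ r = 0 := fun r hr =>
    h0 r fun hr' => hr ⟨hac.trans_lt hr'.1, hr'.2.trans_le hdb⟩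
  have hzK : ∀ r ∈ K, τ r = 0 := fun r hr => h0 r fun hr' => hK r hr' hr
  have h1 := h.normal τ ⟨C, hC⟩ hz (fun r _ hr => (hzK r hr).le)
  have h2 := h.normal (fun r => - τ r) ⟨_, hC.neg⟩ (fun r hr => by rw [hz r hr, neg_zero])
    (fun r _ hr => by rw [hzK r hr, neg_zero])
  rw [weakPairing_neg] at h2
  linarith

theorem residual_tangential (h : WeakExtremal U L ν w y a b K) {s : ℝ}
    (hs : s ∈ Icc a b) (e : V) :
    residual (fun s => tangentialForce L ν w (y s) (deriv y s) e)
      (fun s => tangentialMomentum L ν w (y s) (deriv y s) e) a s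
    = (tangentialMomentum L ν w (y s) (deriv y s)
        - ∫ r in a..s, tangentialForce L ν w (y r) (deriv y r)) e := by
  rw [residual, sub_apply]
  congr 1
  have hi : IntervalIntegrable (fun s => tangentialForce L ν w (y s) (deriv y s)) volume a s :=
    h.integrable_tangentialForce.mono_set (by
      rw [uIcc_of_le hs.1, uIcc_of_le h.lt.le]; exact Icc_subset_Icc le_rfl hs.2)
  exact (ContinuousLinearMap.apply ℝ ℝ e).intervalIntegral_comp_comm hi

/-- The momentum is its tangential part plus `momentum(w) ν`. The values on a basis give the
tangential part as `c` plus an integral, and by definition of the multiplier `momentum(w)` is an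
integral plus the multiplier. -/
theorem momentum_eq_of_residual (h : WeakExtremal U L ν w y a b K) {s : ℝ}
    (hs : s ∈ goodTimes L ν w y a b) {c : V →L[ℝ] ℝ}
    (hc : ∀ i, residual
        (fun s => tangentialForce L ν w (y s) (deriv y s) (Module.finBasis ℝ V i))
        (fun s => tangentialMomentum L ν w (y s) (deriv y s) (Module.finBasis ℝ V i)) a s
      = c (Module.finBasis ℝ V i)) :
    momentum L (y s) (deriv y s) =
      regularMomentum L ν w y a c s + multiplier L w y a s • ν (y s) := by
  have hs' : s ∈ Icc a b := Ioo_subset_Icc_self (goodTimes_subset hs)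
  have h1 : tangentialMomentum L ν w (y s) (deriv y s)
      - (∫ r in a..s, tangentialForce L ν w (y r) (deriv y r)) = c := by
    refine ContinuousLinearMap.coe_injective ((Module.finBasis ℝ V).ext fun i => ?_)
    have := hc i
    rw [h.residual_tangential hs'] at this
    exact this
  rw [regularMomentum, multiplier, residual, ← h1, tangentialMomentum]
  ext e
  simp only [add_apply, sub_apply, smul_apply, smul_eq_mul]
  ring

/-- The tangential residual takes the same value at all good times, so `c` can be read off at any
one of them. -/
theorem exists_momentum_eq (h : WeakExtremal U L ν w y a b K) :
    ∃ c : V →L[ℝ] ℝ, ∀ s ∈ goodTimes L ν w y a b, momentum L (y s) (deriv y s) =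
      regularMomentum L ν w y a c s + multiplier L w y a s • ν (y s) := by
  obtain ⟨r, hr, -⟩ := h.exists_goodTime h.lt le_rfl le_rfl
  refine ⟨tangentialMomentum L ν w (y r) (deriv y r)
    - ∫ q in a..r, tangentialForce L ν w (y q) (deriv y q), fun s hs =>
      h.momentum_eq_of_residual hs fun i => ?_⟩
  rw [← h.residual_tangential (Ioo_subset_Icc_self (goodTimes_subset hr))]
  refine residual_eq h.lt.le (integrable_apply h.integrable_tangentialForce _)
    (integrable_apply h.integrable_tangentialMomentum _) le_rfl le_rfl
    (fun τ hτ _ h0 => h.tangential _ τ hτ h0) ⟨hs.2 i, (hs.2 i).1⟩ ⟨hr.2 i, (hr.2 i).1⟩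

theorem momentum_eq_of_left_free (h : WeakExtremal U L ν w y a b K)
    (H : ∀ (e : V) (τ : ℝ → ℝ), (∃ C, LipschitzWith C τ) → (∀ r, b ≤ r → τ r = 0) →
      weakPairing (fun s => tangentialForce L ν w (y s) (deriv y s) e)
        (fun s => tangentialMomentum L ν w (y s) (deriv y s) e) a b τ = 0) :
    ∀ s ∈ goodTimes L ν w y a b, momentum L (y s) (deriv y s) =
      regularMomentum L ν w y a 0 s + multiplier L w y a s • ν (y s) := fun s hs =>
  h.momentum_eq_of_residual hs fun i =>
    residual_eq_of_left_free h.lt.le (integrable_apply h.integrable_tangentialForce _)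
      (integrable_apply h.integrable_tangentialMomentum _) (fun τ hτ _ h0 => H _ τ hτ h0) (hs.2 i)

/-- This value of `c` makes the integral of the tangential force cancel at `b`, leaving only a
multiple of `ν` there. -/
theorem momentum_eq_of_right_free (h : WeakExtremal U L ν w y a b K)
    (H : ∀ (e : V) (τ : ℝ → ℝ), (∃ C, LipschitzWith C τ) → (∀ r, r ≤ a → τ r = 0) →
      weakPairing (fun s => tangentialForce L ν w (y s) (deriv y s) e)
        (fun s => tangentialMomentum L ν w (y s) (deriv y s) e) a b τ = 0) :
    ∀ s ∈ goodTimes L ν w y a b, momentum L (y s) (deriv y s) =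
      regularMomentum L ν w y a
        (- ∫ r in a..b, tangentialForce L ν w (y r) (deriv y r)) s
        + multiplier L w y a s • ν (y s) := fun s hs =>
  h.momentum_eq_of_residual hs fun i => by
    rw [residual_eq_of_right_free h.lt.le (integrable_apply h.integrable_tangentialForce _)
      (integrable_apply h.integrable_tangentialMomentum _) (fun τ hτ _ h0 => H _ τ hτ h0) (hs.2 i),
      neg_apply]
    congr 1
    exact (ContinuousLinearMap.apply ℝ ℝ _).intervalIntegral_comp_comm h.integrable_tangentialForce

theorem continuousOn_curve (h : WeakExtremal U L ν w y a b K) : ContinuousOn y (Icc a b) :=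
  h.isH1On.continuousOn h.lt.le

theorem continuousOn_normal (h : WeakExtremal U L ν w y a b K) :
    ContinuousOn (fun s => ν (y s)) (Icc a b) :=
  h.smooth.continuousOn.comp h.continuousOn_curve h.mem

theorem continuousOn_regularMomentum (h : WeakExtremal U L ν w y a b K) (c : V →L[ℝ] ℝ) :
    ContinuousOn (regularMomentum L ν w y a c) (Icc a b) := by
  have h1 := intervalIntegral.continuousOn_primitive_interval' h.integrable_tangentialForce
    left_mem_uIcc
  have h2 := intervalIntegral.continuousOn_primitive_interval' h.integrable_force
    left_mem_uIcc
  rw [uIcc_of_le h.lt.le] at h1 h2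
  exact (continuousOn_const.add h1).add (h2.smul h.continuousOn_normal)

/-- Transfers regularity and constancy of the energy to a weak extremal. The bound on the multiplier
serves only to extend it from the good times to a monotone function on the whole line. -/
theorem regularity (h : WeakExtremal U L ν w y a b K) {c : V →L[ℝ] ℝ}
    (hc : ∀ s ∈ goodTimes L ν w y a b, momentum L (y s) (deriv y s) =
      regularMomentum L ν w y a c s + multiplier L w y a s • ν (y s))
    {a' b' : ℝ} (haa : a ≤ a') (hbb : b' ≤ b) (hab' : a' < b') {C : ℝ}
    (hC : ∀ s ∈ goodTimes L ν w y a b, s ∈ Ioo a' b' → |multiplier L w y a s| ≤ C) :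
    ∃ m : ℝ → ℝ, Monotone m ∧ (∀ s ∈ Ioo a' b', DifferentiableAt ℝ y s ∧
      ContinuousAt (deriv y) s ∧ ContinuousAt m s ∧
      momentum L (y s) (deriv y s) = regularMomentum L ν w y a c s + m s • ν (y s)) ∧
      ∀ s ∈ Ioo a' b', ∀ t ∈ Ioo a' b', L (y s, deriv y s) = L (y t, deriv y t) := by
  set S := goodTimes L ν w y a b with hS
  have hsub : Icc a' b' ⊆ Icc a b := Icc_subset_Icc haa hbb
  have hsub' : Ioo a' b' ⊆ Ioo a b := Ioo_subset_Ioo haa hbb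
  obtain ⟨m, hm, hmS⟩ := (h.monotoneOn_multiplier.mono
    (inter_subset_left (t := Ioo a' b'))).exists_monotone_extension
      ⟨-C, by rintro _ ⟨s, hs, rfl⟩; exact (abs_le.1 (hC s hs.1 hs.2)).1⟩
      ⟨C, by rintro _ ⟨s, hs, rfl⟩; exact (abs_le.1 (hC s hs.1 hs.2)).2⟩
  set Q := regularMomentum L ν w y a c with hQ
  set N : ℝ → V →L[ℝ] ℝ := fun s => ν (y s) with hN
  have hP : ∀ᵐ r, r ∈ Ioo a' b' → momentum L (y r) (deriv y r) = Q r + m r • N r := by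
    filter_upwards [h.ae_mem_goodTimes] with r hr hr'
    have hrS := hr (hsub' hr')
    rw [← hmS ⟨hrS, hr'⟩, hc r hrS]
  have halt : ∀ s ∈ Ioo a' b', ContactAlternative y m N s := by
    intro s hs
    rcases h.contact s (hsub' hs) with hK | hK
    · left
      obtain ⟨l, u, hlu, hsubK⟩ := mem_nhds_iff_exists_Ioo_subset.1
        (inter_mem hK (Ioo_mem_nhds hs.1 hs.2))
      have hla : a ≤ l ∧ u ≤ b ∧ Ioo l u ⊆ Ioo a' b' := by
        have h3 : Ioo l u ⊆ Ioo a' b' := fun r hr => (hsubK hr).2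
        have h4 := (Ioo_subset_Ioo_iff (hlu.1.trans hlu.2)).1 h3
        exact ⟨haa.trans h4.1, h4.2.trans hbb, h3⟩
      -- The extension agrees with the multiplier only at good times, so a good time to the right of
      -- `r` and one to the left of `q` are inserted.
      have hconst : ∀ r ∈ Ioo l u, ∀ q ∈ Ioo l u, m r ≤ m q := by
        intro r hr q hq
        obtain ⟨r₁, hr₁, hr₁'⟩ := h.exists_goodTime hr.2 (hla.1.trans hr.1.le) hla.2.1
        obtain ⟨q₁, hq₁, hq₁'⟩ := h.exists_goodTime hq.1 hla.1 (hq.2.le.trans hla.2.1)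
        have hr₂ : r₁ ∈ Ioo l u := ⟨hr.1.trans hr₁'.1, hr₁'.2⟩
        have hq₂ : q₁ ∈ Ioo l u := ⟨hq₁'.1, hq₁'.2.trans hq.2⟩
        have e := h.multiplier_eq hla.1 hla.2.1 (fun r hr => (hsubK hr).1) hr₁ hr₂ hq₁ hq₂
        calc m r ≤ m r₁ := hm hr₁'.1.le
          _ = m q₁ := by rw [← hmS ⟨hr₁, hla.2.2 hr₂⟩, ← hmS ⟨hq₁, hla.2.2 hq₂⟩, e]
          _ ≤ m q := hm hq₁'.2.le
      filter_upwards [Ioo_mem_nhds hlu.1 hlu.2] with r hr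
      exact le_antisymm (hconst r hr s hlu) (hconst s hlu r hr)
    · exact Or.inr hK
  have hreg := h.lag.regularity (h.isH1On.mono h.lt.le hab'.le haa hbb) (fun s hs => h.mem s (hsub hs))
    ((h.continuousOn_regularMomentum c).mono hsub) (h.continuousOn_normal.mono hsub) hm hP halt
  refine ⟨m, hm, hreg, fun s hs t ht => ?_⟩
  have hU : ∀ s ∈ Ioo a' b', y s ∈ U := fun s hs => h.mem s (hsub (Ioo_subset_Icc_self hs))
  obtain ⟨c1, c2, c3, c4⟩ := h.continuousOn_prod
  have hsubset : ∀ s ∈ Ioo a' b', uIcc a s ⊆ uIcc a b := fun s hs => by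
    rw [uIcc_of_le (haa.trans hs.1.le), uIcc_of_le h.lt.le]
    exact Icc_subset_Icc le_rfl (hs.2.le.trans hbb)
  have hBd : ∀ s ∈ Ioo a' b', HasDerivAt (fun s => ∫ r in a..s, force L (y r) (deriv y r) w)
      (force L (y s) (deriv y s) w) s := fun s hs =>
    intervalIntegral.integral_hasDerivAt_right (h.integrable_force.mono_set (hsubset s hs))
      (stronglyMeasurableAtFilter_of_mem_Ioo h.integrable_force (hsub' hs))
      (continuousAt_comp_velocity h.lag.isOpen (G := fun q : V × V => force L q.1 q.2 w)
        (c1.clm_apply continuousOn_const) (hU s hs) (hreg s hs).1 (hreg s hs).2.1)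
  have hCd : ∀ s ∈ Ioo a' b',
      HasDerivAt (fun s => ∫ r in a..s, tangentialForce L ν w (y r) (deriv y r))
      (tangentialForce L ν w (y s) (deriv y s)) s := fun s hs =>
    intervalIntegral.integral_hasDerivAt_right
      (h.integrable_tangentialForce.mono_set (hsubset s hs))
      (stronglyMeasurableAtFilter_of_mem_Ioo h.integrable_tangentialForce (hsub' hs))
      (continuousAt_comp_velocity h.lag.isOpen (G := fun q : V × V => tangentialForce L ν w q.1 q.2)
        ((c1.sub ((c1.clm_apply continuousOn_const).smul c3)).sub
        ((c2.clm_apply continuousOn_const).smul c4)) (hU s hs) (hreg s hs).1 (hreg s hs).2.1)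
  have hNd : ∀ s ∈ Ioo a' b', HasDerivAt N (fderiv ℝ ν (y s) (deriv y s)) s := fun s hs =>
    ((h.smooth.differentiableOn (by norm_num)).differentiableAt
      (h.lag.isOpen.mem_nhds (hU s hs))).hasFDerivAt.comp_hasDerivAt s (hreg s hs).1.hasDerivAt
  -- This holds at good times by definition of the multiplier. Both sides are continuous and good
  -- times are dense, so it holds everywhere; it is what makes `Q' + m N'` equal to the force.
  have hmw : ∀ s ∈ Ioo a' b', momentum L (y s) (deriv y s) w
      = (∫ r in a..s, force L (y r) (deriv y r) w) + m s := by
    intro s hs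
    set D : ℝ → ℝ := fun s => momentum L (y s) (deriv y s) w
      - (∫ r in a..s, force L (y r) (deriv y r) w) - m s with hD
    have hDc : ContinuousAt D s := ((continuousAt_comp_velocity h.lag.isOpen
      (G := fun q : V × V => momentum L q.1 q.2 w)
      (c2.clm_apply continuousOn_const) (hU s hs) (hreg s hs).1 (hreg s hs).2.1).sub (hBd s hs).continuousAt).sub (hreg s hs).2.2.1
    suffices D s = 0 by rw [hD] at this; simp only at this; linarith
    by_contra hne
    obtain ⟨l, u, hlu, hsubK⟩ := mem_nhds_iff_exists_Ioo_subset.1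
        (inter_mem (hDc.eventually_ne hne) (Ioo_mem_nhds hs.1 hs.2))
    have h4 := (Ioo_subset_Ioo_iff (hlu.1.trans hlu.2)).1 fun r hr => (hsubK hr).2
    obtain ⟨q, hq, hq'⟩ := h.exists_goodTime (hlu.1.trans hlu.2) (haa.trans h4.1) (h4.2.trans hbb)
    refine (hsubK hq').1 ?_
    have := hmS ⟨hq, (hsubK hq').2⟩
    rw [hD]
    simp only
    rw [← this, multiplier, residual]
    ring
  refine h.lag.energy_constant (fun s hs => h.mem s (hsub hs)) hm hreg
    (Q' := fun s => tangentialForce L ν w (y s) (deriv y s)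
      + ((∫ r in a..s, force L (y r) (deriv y r) w) • fderiv ℝ ν (y s) (deriv y s)
        + force L (y s) (deriv y s) w • N s))
    (fun s hs => ((hCd s hs).const_add c).add ((hBd s hs).smul (hNd s hs))) hNd
    (fun s hs => ?_) halt hs ht
  rw [tangentialForce, hmw s hs]
  ext e
  simp only [add_apply, sub_apply, smul_apply, smul_eq_mul, hN]
  ring

end WeakExtremal

end WeakExtremal

/-! ### Homogeneous functions that are regular off the zero section -/

section Homogeneous

variable {V : Type*} [NormedAddCommGroup V] [NormedSpace ℝ V] {U : Set V} {L : V × V → ℝ}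

theorem fderiv_homogeneous (hU : IsOpen U)
    (homog : ∀ u ∈ U, ∀ v : V, ∀ c : ℝ, 0 < c → L (u, c • v) = c ^ 2 * L (u, v))
    {u v : V} (hu : u ∈ U) {c : ℝ} (hc : 0 < c) (h1 : DifferentiableAt ℝ L (u, c • v))
    (h2 : DifferentiableAt ℝ L (u, v)) (η η' : V) :
    fderiv ℝ L (u, c • v) (η, c • η') = c ^ 2 * fderiv ℝ L (u, v) (η, η') := by
  have h3 : HasFDerivAt (fun q : V × V => (q.1, c • q.2))
      ((ContinuousLinearMap.fst ℝ V V).prod (c • ContinuousLinearMap.snd ℝ V V)) (u, v) :=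
    (hasFDerivAt_fst).prodMk (hasFDerivAt_snd.const_smul c)
  have h4 := HasFDerivAt.comp (g := L) (u, v) h1.hasFDerivAt h3
  have h5 := (h2.hasFDerivAt.const_mul (c ^ 2)).congr_of_eventuallyEq
    (f₁ := L ∘ fun q : V × V => (q.1, c • q.2)) (by
      filter_upwards [(hU.prod isOpen_univ).mem_nhds (show (u, v) ∈ U ×ˢ univ from ⟨hu, mem_univ _⟩)]
        with q hq using homog q.1 hq.1 q.2 c hc)
  have := congrArg (fun l : V × V →L[ℝ] ℝ => l (η, η')) (h4.unique h5)
  simpa using this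

/-- Scaling carries the bounds from the compact set `K × sphere` to small vectors: the function
scales quadratically and its differential at least linearly. -/
theorem exists_fderiv_bound [FiniteDimensional ℝ V] (hU : IsOpen U)
    (h2 : ∀ u ∈ U, ∀ v : V, v ≠ 0 → ContDiffAt ℝ 1 L (u, v))
    (homog : ∀ u ∈ U, ∀ v : V, ∀ c : ℝ, 0 < c → L (u, c • v) = c ^ 2 * L (u, v))
    {K : Set V} (hK : IsCompact K) (hKU : K ⊆ U) :
    ∃ C, 0 ≤ C ∧ ∀ u ∈ K, ∀ v : V, v ≠ 0 → ‖v‖ ≤ 1 →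
      ‖fderiv ℝ L (u, v)‖ ≤ C * ‖v‖ ∧ |L (u, v)| ≤ C * ‖v‖ ^ 2 := by
  have : ProperSpace V := FiniteDimensional.proper_real V
  have hc : IsCompact (K ×ˢ Metric.sphere (0 : V) 1) := hK.prod (isCompact_sphere _ _)
  have hne : ∀ q ∈ K ×ˢ Metric.sphere (0 : V) 1, q.2 ≠ 0 := by
    intro q hq e
    have := hq.2
    rw [e] at this
    simp at this
  obtain ⟨C₁, H₁⟩ := hc.exists_bound_of_continuousOn (f := fderiv ℝ L) fun q hq =>
    (((h2 q.1 (hKU hq.1) q.2 (hne q hq)).fderiv_right (m := 0)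
      (by norm_num)).continuousAt).continuousWithinAt
  obtain ⟨C₂, H₂⟩ := hc.exists_bound_of_continuousOn (f := L) fun q hq =>
    (h2 q.1 (hKU hq.1) q.2 (hne q hq)).continuousAt.continuousWithinAt
  refine ⟨max 0 (max C₁ C₂), le_max_left _ _, fun u hu v hv hv1 => ?_⟩
  have hn : 0 < ‖v‖ := norm_pos_iff.2 hv
  have e : v = ‖v‖ • (‖v‖⁻¹ • v) := by rw [smul_smul, mul_inv_cancel₀ hn.ne', one_smul]
  have hmem : (u, ‖v‖⁻¹ • v) ∈ K ×ˢ Metric.sphere (0 : V) 1 := ⟨hu, by simp [norm_smul, hn.ne']⟩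
  have hC0 : 0 ≤ max 0 (max C₁ C₂) := le_max_left _ _
  have b1 := (H₁ _ hmem).trans ((le_max_left C₁ C₂).trans (le_max_right 0 _))
  have b2 := (H₂ _ hmem).trans ((le_max_right C₁ C₂).trans (le_max_right 0 _))
  constructor
  · refine ContinuousLinearMap.opNorm_le_bound _ (by positivity) fun X => ?_
    have e2 : X = (X.1, ‖v‖ • (‖v‖⁻¹ • X.2)) := by
      rw [smul_smul, mul_inv_cancel₀ hn.ne', one_smul]
    have d1 : DifferentiableAt ℝ L (u, ‖v‖ • (‖v‖⁻¹ • v)) := by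
      rw [← e]; exact (h2 u (hKU hu) v hv).differentiableAt (by norm_num)
    have d2 : DifferentiableAt ℝ L (u, ‖v‖⁻¹ • v) :=
      (h2 u (hKU hu) _ (hne _ hmem)).differentiableAt (by norm_num)
    have key := fderiv_homogeneous hU homog (hKU hu) hn d1 d2 X.1 (‖v‖⁻¹ • X.2)
    rw [← e, ← e2] at key
    rw [key, norm_mul, norm_pow, norm_norm]
    have b3 : ‖fderiv ℝ L (u, ‖v‖⁻¹ • v) (X.1, ‖v‖⁻¹ • X.2)‖ ≤
        max 0 (max C₁ C₂) * (‖v‖⁻¹ * ‖X‖) := by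
      refine (ContinuousLinearMap.le_opNorm _ _).trans (mul_le_mul b1 ?_ (norm_nonneg _) hC0)
      refine max_le ?_ ?_
      -- The position component is not rescaled, and this is where `‖v‖ ≤ 1` is needed.
      · have : 1 ≤ ‖v‖⁻¹ := (one_le_inv₀ hn).2 hv1
        calc ‖X.1‖ ≤ 1 * ‖X‖ := by rw [one_mul]; exact norm_fst_le X
          _ ≤ _ := by gcongr
      · rw [norm_smul, norm_inv, norm_norm]
        gcongr
        exact norm_snd_le X
    calc _ ≤ ‖v‖ ^ 2 * (max 0 (max C₁ C₂) * (‖v‖⁻¹ * ‖X‖)) := by gcongr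
      _ = _ := by field_simp
  · rw [e, homog u (hKU hu) _ _ hn, ← e, abs_mul, abs_of_nonneg (by positivity), mul_comm]
    gcongr
    exact b2

/-- The function is `O(‖v‖ ^ 2)` and its differential `O(‖v‖)`, so the differential extends
continuously by `0` to the zero section. -/
theorem contDiffOn_of_homogeneous [FiniteDimensional ℝ V] (hU : IsOpen U)
    (h2 : ∀ u ∈ U, ∀ v : V, v ≠ 0 → ContDiffAt ℝ 1 L (u, v))
    (homog : ∀ u ∈ U, ∀ v : V, ∀ c : ℝ, 0 < c → L (u, c • v) = c ^ 2 * L (u, v)) :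
    ContDiffOn ℝ 1 L (U ×ˢ univ) := by
  have hzero : ∀ u ∈ U, L (u, 0) = 0 := fun u hu => by
    have := homog u hu 0 2 (by norm_num)
    rw [smul_zero] at this
    linarith
  have hloc : ∀ u ∈ U, ∃ C, 0 ≤ C ∧ ∀ᶠ q : V × V in 𝓝 (u, 0), q.1 ∈ U ∧ (q.2 ≠ 0 →
      ‖fderiv ℝ L q‖ ≤ C * ‖q.2‖) ∧ |L q| ≤ C * ‖q.2‖ ^ 2 := by
    intro u hu
    obtain ⟨K, hK, huK, hKU⟩ := exists_compact_subset hU hu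
    obtain ⟨C, hC, H⟩ := exists_fderiv_bound hU h2 homog hK hKU
    refine ⟨C, hC, ?_⟩
    have := prod_mem_nhds (mem_interior_iff_mem_nhds.1 huK)
      (Metric.closedBall_mem_nhds (0 : V) one_pos)
    filter_upwards [this] with q hq
    have hq2 : ‖q.2‖ ≤ 1 := by simpa using hq.2
    refine ⟨hKU hq.1, fun hne => (H q.1 hq.1 q.2 hne hq2).1, ?_⟩
    rcases eq_or_ne q.2 0 with h0 | h0
    · have : q = (q.1, 0) := Prod.ext rfl h0
      rw [this, hzero q.1 (hKU hq.1)]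
      simp
    · exact (H q.1 hq.1 q.2 h0 hq2).2
  have hderiv0 : ∀ u ∈ U, HasFDerivAt L (0 : V × V →L[ℝ] ℝ) (u, 0) := by
    intro u hu
    obtain ⟨C, hC, H⟩ := hloc u hu
    rw [hasFDerivAt_iff_isLittleO]
    have h1 : (fun q : V × V => L q - L (u, 0) - (0 : V × V →L[ℝ] ℝ) (q - (u, 0)))
        =O[𝓝 (u, 0)] fun q => ‖q.2‖ * ‖q - (u, 0)‖ := by
      refine Asymptotics.IsBigO.of_bound C ?_
      filter_upwards [H] with q hq
      rw [hzero u hu, sub_zero, zero_apply, sub_zero, Real.norm_eq_abs, norm_mul, norm_norm,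
        norm_norm]
      have : ‖q.2‖ ≤ ‖q - (u, 0)‖ := by
        have := norm_snd_le (q - (u, (0 : V)))
        rwa [Prod.snd_sub, sub_zero] at this
      calc _ ≤ C * ‖q.2‖ ^ 2 := hq.2.2
        _ = C * (‖q.2‖ * ‖q.2‖) := by ring
        _ ≤ _ := by gcongr
    refine h1.trans_isLittleO ?_
    have h3 : (fun q : V × V => ‖q.2‖) =o[𝓝 (u, 0)] fun _ => (1 : ℝ) := by
      rw [Asymptotics.isLittleO_one_iff]
      have : Continuous fun q : V × V => ‖q.2‖ := by fun_prop
      simpa using this.tendsto (u, 0)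
    have h4 := h3.mul_isBigO
      (Asymptotics.isBigO_refl (fun q : V × V => ‖q - (u, (0 : V))‖) (𝓝 (u, 0)))
    simp only [one_mul] at h4
    exact h4.of_norm_right
  have hfd : ∀ q ∈ U ×ˢ (univ : Set V), DifferentiableAt ℝ L q := by
    rintro ⟨u, v⟩ ⟨hu, -⟩
    rcases eq_or_ne v 0 with rfl | hv
    · exact (hderiv0 u hu).differentiableAt
    · exact (h2 u hu v hv).differentiableAt (by norm_num)
  have hopen : IsOpen (U ×ˢ (univ : Set V)) := hU.prod isOpen_univ
  rw [show (1 : WithTop ℕ∞) = 0 + 1 by norm_num, contDiffOn_succ_iff_fderiv_of_isOpen hopen]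
  refine ⟨fun q hq => (hfd q hq).differentiableWithinAt, by simp, ?_⟩
  rw [contDiffOn_zero]
  rintro ⟨u, v⟩ ⟨hu, -⟩
  rcases eq_or_ne v 0 with rfl | hv
  · obtain ⟨C, hC, H⟩ := hloc u hu
    refine ContinuousAt.continuousWithinAt ?_
    rw [ContinuousAt, (hderiv0 u hu).fderiv]
    refine squeeze_zero_norm' (a := fun q : V × V => C * ‖q.2‖) ?_ ?_
    · filter_upwards [H] with q hq
      rcases eq_or_ne q.2 0 with h0 | h0
      · have : q = (q.1, 0) := Prod.ext rfl h0
        rw [this, (hderiv0 q.1 hq.1).fderiv]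
        simp
      · exact hq.2.1 h0
    · have : Continuous fun q : V × V => C * ‖q.2‖ := by fun_prop
      simpa using this.tendsto (u, 0)
  · exact ((h2 u hu v hv).fderiv_right (m := 0) (by norm_num)).continuousAt.continuousWithinAt

/-- Strict monotonicity of the gradient follows from the mean value theorem and the positive
definite Hessian when the segment avoids `0`. A segment through `0`, where no Hessian is assumed, is
treated by homogeneity. -/
theorem IsLagrangian.of_homogeneous [FiniteDimensional ℝ V] (hU : IsOpen U)
    (h2 : ∀ u ∈ U, ∀ v : V, v ≠ 0 → ContDiffAt ℝ 2 L (u, v))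
    (homog : ∀ u ∈ U, ∀ v : V, ∀ c : ℝ, 0 < c → L (u, c • v) = c ^ 2 * L (u, v))
    (pos : ∀ u ∈ U, ∀ v : V, v ≠ 0 → 0 < L (u, v))
    (posDef : ∀ u ∈ U, ∀ v : V, v ≠ 0 → ∀ w : V, w ≠ 0 →
      0 < fderiv ℝ (fun v' => momentum L u v') v w w) : IsLagrangian U L := by
  have hC1 : ContDiffOn ℝ 1 L (U ×ˢ univ) := contDiffOn_of_homogeneous hU
    (fun u hu v hv => (h2 u hu v hv).of_le (by norm_num)) homog
  have hd : ∀ u ∈ U, ∀ v, DifferentiableAt ℝ L (u, v) := fun u hu v =>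
    (hC1.contDiffAt ((hU.prod isOpen_univ).mem_nhds ⟨hu, mem_univ _⟩)).differentiableAt (by norm_num)
  have hself : ∀ u ∈ U, ∀ v, momentum L u v v = 2 * L (u, v) := by
    intro u hu v
    have h1 : HasDerivAt (fun c : ℝ => L (u, c • v)) (momentum L u v v) 1 := by
      have e : HasDerivAt (fun c : ℝ => c • v) v 1 := by
        simpa using (hasDerivAt_id (1 : ℝ)).smul_const v
      have h3 : HasFDerivAt (fun w => L (u, w)) (momentum L u ((1 : ℝ) • v)) ((1 : ℝ) • v) :=
        (hd u hu _).hasFDerivAt.comp _ (hasFDerivAt_prodMk_right u _)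
      have := h3.comp_hasDerivAt (1 : ℝ) e
      rwa [one_smul] at this
    have h3 : HasDerivAt (fun c : ℝ => c ^ 2 * L (u, v)) (2 * L (u, v)) 1 := by
      simpa using (hasDerivAt_pow 2 (1 : ℝ)).mul_const (L (u, v))
    refine (h1.congr_of_eventuallyEq ?_).unique h3
    filter_upwards [Ioi_mem_nhds (zero_lt_one : (0 : ℝ) < 1)] with c hc
    exact (homog u hu v c hc).symm
  have hmz : ∀ u ∈ U, momentum L u 0 = 0 := by
    intro u hu
    ext w
    have := fderiv_homogeneous hU homog hu (two_pos) (v := 0) (by simpa using hd u hu 0)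
      (hd u hu 0) 0 w
    rw [smul_zero, ← momentum_apply, ← momentum_apply, map_smul, smul_eq_mul] at this
    rw [zero_apply]
    linarith
  refine ⟨hU, hC1, homog, pos, fun u hu v v' hne => ?_⟩
  by_cases hseg : ∃ t ∈ Icc (0 : ℝ) 1, v + t • (v' - v) = 0
  · obtain ⟨t, ht, e⟩ := hseg
    rcases eq_or_ne v 0 with rfl | hv
    · rw [hmz u hu, sub_zero, sub_zero, hself u hu]
      linarith [pos u hu v' hne.symm]
    rcases eq_or_ne v' 0 with rfl | hv'
    · rw [hmz u hu, zero_sub, zero_sub, neg_apply, map_neg, neg_neg, hself u hu]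
      linarith [pos u hu v hne]
    -- The two velocities lie on opposite rays, so `v' - v` is a positive multiple of `v'` and of
    -- `-v`, and Euler's identity gives both signs.
    have e' : (1 - t) • v + t • v' = 0 := by rw [← e]; module
    have ht0 : 0 < t := by
      refine lt_of_le_of_ne ht.1 fun h0 => hv ?_
      rw [← h0] at e'; simpa using e'
    have ht1 : 0 < 1 - t := by
      refine lt_of_le_of_ne (by linarith [ht.2]) fun h0 => hv' ?_
      have : t = 1 := by linarith
      rw [this] at e'; simpa using e'
    have m1 : (1 - t) * momentum L u v' (v' - v) = momentum L u v' v' := by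
      rw [← smul_eq_mul, ← map_smul]
      congr 1
      have : (1 - t) • (v' - v) = v' - ((1 - t) • v + t • v') := by module
      rw [this, e', sub_zero]
    have m2 : t * momentum L u v (v' - v) = - momentum L u v v := by
      rw [← smul_eq_mul, ← map_smul, ← map_neg]
      congr 1
      exact eq_neg_of_add_eq_zero_right e
    have p1 := pos u hu v' hv'
    have p2 := pos u hu v hv
    rw [hself u hu] at m1 m2
    have q1 : 0 < momentum L u v' (v' - v) := (pos_iff_pos_of_mul_pos (a := 1 - t) (by linarith)).1 ht1
    have q2 : 0 < - momentum L u v (v' - v) :=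
      (pos_iff_pos_of_mul_pos (a := t) (by linarith)).1 ht0
    rw [sub_apply]
    linarith
  · push Not at hseg
    set g : ℝ → ℝ := fun t => momentum L u (v + t • (v' - v)) (v' - v) with hg
    have hd2 : ∀ t ∈ Icc (0 : ℝ) 1, HasDerivAt g
        (fderiv ℝ (fun w => momentum L u w) (v + t • (v' - v)) (v' - v) (v' - v)) t := by
      intro t ht
      have e : HasDerivAt (fun c : ℝ => v + c • (v' - v)) (v' - v) t := by
        simpa using ((hasDerivAt_id t).smul_const (v' - v)).const_add v
      have h3 : DifferentiableAt ℝ (fun w => momentum L u w) (v + t • (v' - v)) := by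
        have h4 : DifferentiableAt ℝ (fderiv ℝ L) (u, v + t • (v' - v)) :=
          ((h2 u hu _ (hseg t ht)).fderiv_right (m := 1) (by norm_num)).differentiableAt
            (by norm_num)
        have h5 : DifferentiableAt ℝ (fun w => fderiv ℝ L (u, w)) (v + t • (v' - v)) :=
          h4.comp _ (hasFDerivAt_prodMk_right u _).differentiableAt
        exact h5.clm_comp (differentiableAt_const _)
      have h4 := h3.hasFDerivAt.comp_hasDerivAt t e
      exact h4.clm_apply (hasDerivAt_const t (v' - v)) |>.congr_deriv (by simp)
    obtain ⟨t, ht, e⟩ := exists_hasDerivAt_eq_slope g _ zero_lt_one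
      (fun t ht => (hd2 t ht).continuousAt.continuousWithinAt)
      (fun t ht => hd2 t (Ioo_subset_Icc_self ht))
    have := posDef u hu _ (hseg t (Ioo_subset_Icc_self ht)) (v' - v) (sub_ne_zero.2 hne.symm)
    rw [e] at this
    simpa [hg] using this

end Homogeneous

/-! ### Slice charts -/

section Charts

variable {E : Type*} [NormedAddCommGroup E] [NormedSpace ℝ E] {N k : ℕ} {M : Set E}
  {F : E × E → ℝ} {Φ : E → ℝ}
  {φ : OpenPartialHomeomorph E (EuclideanSpace ℝ (Fin N) × EuclideanSpace ℝ (Fin k))}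

/-- The domain of the local parametrization of `M` induced by `φ`. -/
def chartDomain (φ : OpenPartialHomeomorph E (EuclideanSpace ℝ (Fin N) × EuclideanSpace ℝ (Fin k))) :
    Set (EuclideanSpace ℝ (Fin N)) := {u | (u, 0) ∈ φ.target}

/-- The local parametrization of `M` induced by `φ`. -/
noncomputable def param
    (φ : OpenPartialHomeomorph E (EuclideanSpace ℝ (Fin N) × EuclideanSpace ℝ (Fin k))) :
    EuclideanSpace ℝ (Fin N) → E := fun u => φ.symm (u, 0)

/-- The local parametrization of `TM` induced by `φ`. -/
noncomputable def tangentParam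
    (φ : OpenPartialHomeomorph E (EuclideanSpace ℝ (Fin N) × EuclideanSpace ℝ (Fin k)))
    (p : EuclideanSpace ℝ (Fin N) × EuclideanSpace ℝ (Fin N)) : E × E :=
  (param φ p.1, fderiv ℝ (param φ) p.1 p.2)

theorem localG_eq (p : EuclideanSpace ℝ (Fin N) × EuclideanSpace ℝ (Fin N)) :
    localG F φ p = sqMetric F (tangentParam φ p) := rfl

theorem isOpen_chartDomain : IsOpen (chartDomain φ) :=
  φ.open_target.preimage (by fun_prop : Continuous fun u : EuclideanSpace ℝ (Fin N) =>
    (u, (0 : EuclideanSpace ℝ (Fin k))))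

theorem param_mem_source {u : EuclideanSpace ℝ (Fin N)} (hu : u ∈ chartDomain φ) :
    param φ u ∈ φ.source := φ.map_target hu

theorem chart_param {u : EuclideanSpace ℝ (Fin N)} (hu : u ∈ chartDomain φ) :
    φ (param φ u) = (u, 0) := φ.right_inv hu

namespace IsSliceChart

theorem contDiffOn_param (hφ : IsSliceChart M φ) : ContDiffOn ℝ 3 (param φ) (chartDomain φ) :=
  hφ.contDiffOn_symm.comp (f := fun u : EuclideanSpace ℝ (Fin N) =>
    (u, (0 : EuclideanSpace ℝ (Fin k)))) (by fun_prop) fun _ hu => hu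

theorem contDiffAt_param (hφ : IsSliceChart M φ) {u : EuclideanSpace ℝ (Fin N)}
    (hu : u ∈ chartDomain φ) : ContDiffAt ℝ 3 (param φ) u :=
  hφ.contDiffOn_param.contDiffAt (isOpen_chartDomain.mem_nhds hu)

theorem hasFDerivAt_param (hφ : IsSliceChart M φ) {u : EuclideanSpace ℝ (Fin N)}
    (hu : u ∈ chartDomain φ) : HasFDerivAt (param φ) (fderiv ℝ (param φ) u) u :=
  ((hφ.contDiffAt_param hu).differentiableAt (by norm_num)).hasFDerivAt

theorem contDiffAt_chart (hφ : IsSliceChart M φ) {q : E} (hq : q ∈ φ.source) :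
    ContDiffAt ℝ 3 φ q :=
  hφ.contDiffOn.contDiffAt (φ.open_source.mem_nhds hq)

theorem contDiffAt_coord (hφ : IsSliceChart M φ) {q : E} (hq : q ∈ φ.source) :
    ContDiffAt ℝ 3 (fun p => (φ p).1) q :=
  (hφ.contDiffAt_chart hq).fst

theorem param_mem (hφ : IsSliceChart M φ) {u : EuclideanSpace ℝ (Fin N)}
    (hu : u ∈ chartDomain φ) : param φ u ∈ M := by
  rw [hφ.mem_iff _ (param_mem_source hu), chart_param hu]

theorem chart_eq (hφ : IsSliceChart M φ) {q : E} (hq : q ∈ φ.source) (hqM : q ∈ M) :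
    φ q = ((φ q).1, 0) := Prod.ext rfl ((hφ.mem_iff q hq).1 hqM)

theorem coord_mem (hφ : IsSliceChart M φ) {q : E} (hq : q ∈ φ.source) (hqM : q ∈ M) :
    (φ q).1 ∈ chartDomain φ := by
  have := φ.map_source hq
  rwa [hφ.chart_eq hq hqM] at this

theorem param_coord (hφ : IsSliceChart M φ) {q : E} (hq : q ∈ φ.source) (hqM : q ∈ M) :
    param φ (φ q).1 = q := by
  rw [param, ← hφ.chart_eq hq hqM, φ.left_inv hq]

theorem fderiv_coord_param (hφ : IsSliceChart M φ) {u : EuclideanSpace ℝ (Fin N)}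
    (hu : u ∈ chartDomain φ) (v : EuclideanSpace ℝ (Fin N)) :
    fderiv ℝ (fun p => (φ p).1) (param φ u) (fderiv ℝ (param φ) u v) = v := by
  have h1 := ((hφ.contDiffAt_coord (param_mem_source hu)).differentiableAt
    (by norm_num)).hasFDerivAt.comp u (hφ.hasFDerivAt_param hu)
  have h2 : HasFDerivAt (fun w => (φ (param φ w)).1)
      (ContinuousLinearMap.id ℝ (EuclideanSpace ℝ (Fin N))) u := by
    refine (hasFDerivAt_id u).congr_of_eventuallyEq ?_
    filter_upwards [isOpen_chartDomain.mem_nhds hu] with w hw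
    rw [chart_param hw]; rfl
  exact congrArg (fun l : EuclideanSpace ℝ (Fin N) →L[ℝ] EuclideanSpace ℝ (Fin N) => l v)
    (h1.unique h2)

theorem fderiv_param_injective (hφ : IsSliceChart M φ) {u : EuclideanSpace ℝ (Fin N)}
    (hu : u ∈ chartDomain φ) : Function.Injective (fderiv ℝ (param φ) u) := fun v w e => by
  rw [← hφ.fderiv_coord_param hu v, e, hφ.fderiv_coord_param hu w]

theorem fderiv_param_ne_zero (hφ : IsSliceChart M φ) {u : EuclideanSpace ℝ (Fin N)}
    (hu : u ∈ chartDomain φ) {v : EuclideanSpace ℝ (Fin N)} (hv : v ≠ 0) :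
    fderiv ℝ (param φ) u v ≠ 0 := fun e =>
  hv (hφ.fderiv_param_injective hu (by rw [e, map_zero]))

theorem hasDerivAt_line {u v : EuclideanSpace ℝ (Fin N)} (t : ℝ) :
    HasDerivAt (fun t : ℝ => u + t • v) v t := by
  simpa using ((hasDerivAt_id t).smul_const v).const_add u

theorem fderiv_param_mem (hφ : IsSliceChart M φ) {u : EuclideanSpace ℝ (Fin N)}
    (hu : u ∈ chartDomain φ) (v : EuclideanSpace ℝ (Fin N)) :
    fderiv ℝ (param φ) u v ∈ tangentVectors M (param φ u) := by
  have h1 : HasDerivAt (fun t : ℝ => u + t • v) v 0 := hasDerivAt_line 0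
  refine ⟨fun t => param φ (u + t • v), by simp, ?_, ?_⟩
  · have h2 : Tendsto (fun t : ℝ => u + t • v) (𝓝 0) (𝓝 u) := by
      simpa using h1.continuousAt.tendsto
    filter_upwards [h2 (isOpen_chartDomain.mem_nhds hu)] with t ht using hφ.param_mem ht
  · exact (hφ.hasFDerivAt_param hu).comp_hasDerivAt_of_eq 0 h1 (by simp)

/-- A curve in `M` equals the parametrization applied to its coordinates; the required vector is the
velocity of the coordinate curve. -/
theorem exists_fderiv_param_eq (hφ : IsSliceChart M φ) {u : EuclideanSpace ℝ (Fin N)}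
    (hu : u ∈ chartDomain φ) {v : E} (hv : v ∈ tangentVectors M (param φ u)) :
    ∃ w, fderiv ℝ (param φ) u w = v := by
  obtain ⟨γ, h0, hM, hd⟩ := hv
  have hsrc : ∀ᶠ t in 𝓝 (0 : ℝ), γ t ∈ φ.source :=
    hd.continuousAt (φ.open_source.mem_nhds (by rw [h0]; exact param_mem_source hu))
  have hs0 : γ 0 ∈ φ.source := hsrc.self_of_nhds
  have h1 := ((hφ.contDiffAt_coord hs0).differentiableAt (by norm_num)).hasFDerivAt.comp_hasDerivAt
    (0 : ℝ) hd
  refine ⟨fderiv ℝ (fun p => (φ p).1) (γ 0) v, HasDerivAt.unique (f := γ) (x := 0) ?_ hd⟩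
  have e0 : (φ (γ 0)).1 = u := by rw [h0, chart_param hu]
  have h2 := (hφ.hasFDerivAt_param hu).comp_hasDerivAt_of_eq (0 : ℝ) h1 e0.symm
  refine h2.congr_of_eventuallyEq ?_
  filter_upwards [hsrc, hM] with t ht ht'
  exact (hφ.param_coord ht ht').symm

theorem tangentParam_mem (hφ : IsSliceChart M φ)
    {p : EuclideanSpace ℝ (Fin N) × EuclideanSpace ℝ (Fin N)} (hp : p.1 ∈ chartDomain φ) :
    tangentParam φ p ∈ tangentBundle M :=
  ⟨hφ.param_mem hp, hφ.fderiv_param_mem hp p.2⟩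

theorem contDiffAt_fderiv_param (hφ : IsSliceChart M φ) {u : EuclideanSpace ℝ (Fin N)}
    (hu : u ∈ chartDomain φ) : ContDiffAt ℝ 2 (fderiv ℝ (param φ)) u :=
  (hφ.contDiffAt_param hu).fderiv_right (by norm_num)

theorem contDiffAt_tangentParam (hφ : IsSliceChart M φ)
    {p : EuclideanSpace ℝ (Fin N) × EuclideanSpace ℝ (Fin N)} (hp : p.1 ∈ chartDomain φ) :
    ContDiffAt ℝ 2 (tangentParam φ) p := by
  have h1 : ContDiffAt ℝ 2 (fun p : EuclideanSpace ℝ (Fin N) × EuclideanSpace ℝ (Fin N) =>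
      param φ p.1) p := ((hφ.contDiffAt_param hp).of_le (by norm_num)).comp p contDiffAt_fst
  have h2 : ContDiffAt ℝ 2 (fun p : EuclideanSpace ℝ (Fin N) × EuclideanSpace ℝ (Fin N) =>
      fderiv ℝ (param φ) p.1) p := (hφ.contDiffAt_fderiv_param hp).comp p contDiffAt_fst
  exact h1.prodMk (h2.clm_apply contDiffAt_snd)

theorem fderiv_tangentParam (hφ : IsSliceChart M φ)
    {p : EuclideanSpace ℝ (Fin N) × EuclideanSpace ℝ (Fin N)} (hp : p.1 ∈ chartDomain φ)
    (X : EuclideanSpace ℝ (Fin N) × EuclideanSpace ℝ (Fin N)) :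
    fderiv ℝ (tangentParam φ) p X = (fderiv ℝ (param φ) p.1 X.1,
      fderiv ℝ (fderiv ℝ (param φ)) p.1 X.1 p.2 + fderiv ℝ (param φ) p.1 X.2) := by
  have h1 : HasFDerivAt (fun p : EuclideanSpace ℝ (Fin N) × EuclideanSpace ℝ (Fin N) =>
      param φ p.1) ((fderiv ℝ (param φ) p.1).comp (ContinuousLinearMap.fst ℝ _ _)) p :=
    (hφ.hasFDerivAt_param hp).comp p hasFDerivAt_fst
  have h2 : HasFDerivAt (fun p : EuclideanSpace ℝ (Fin N) × EuclideanSpace ℝ (Fin N) =>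
      fderiv ℝ (param φ) p.1)
      ((fderiv ℝ (fderiv ℝ (param φ)) p.1).comp (ContinuousLinearMap.fst ℝ _ _)) p :=
    (((hφ.contDiffAt_fderiv_param hp).differentiableAt (by norm_num)).hasFDerivAt).comp p
      hasFDerivAt_fst
  have h3 := h1.prodMk (h2.clm_apply hasFDerivAt_snd)
  rw [show tangentParam φ = fun p => (param φ p.1, fderiv ℝ (param φ) p.1 p.2) from rfl, h3.fderiv]
  refine Prod.ext (by simp) ?_
  simp [add_comm]

/-- `fderivWithin` along `M` need not be the only derivative within `M`, but the chain rule
determines it on tangent vectors. -/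
theorem hasFDerivAt_defining (hφ : IsSliceChart M φ) (hΦ : ContDiffOn ℝ 2 Φ M)
    {u : EuclideanSpace ℝ (Fin N)} (hu : u ∈ chartDomain φ) :
    HasFDerivAt (fun w => Φ (param φ w))
      ((fderivWithin ℝ Φ M (param φ u)).comp (fderiv ℝ (param φ) u)) u := by
  have h1 := ((hΦ _ (hφ.param_mem hu)).differentiableWithinAt (by norm_num)).hasFDerivWithinAt
  refine HasFDerivWithinAt.comp_hasFDerivAt (g := Φ) u h1 (hφ.hasFDerivAt_param hu) ?_
  filter_upwards [isOpen_chartDomain.mem_nhds hu] with w hw using hφ.param_mem hw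

theorem contDiffOn_defining (hφ : IsSliceChart M φ) (hΦ : ContDiffOn ℝ 2 Φ M) :
    ContDiffOn ℝ 2 (fun w => Φ (param φ w)) (chartDomain φ) :=
  hΦ.comp (hφ.contDiffOn_param.of_le (by norm_num)) fun _ hw => hφ.param_mem hw

theorem dPhi_param (hφ : IsSliceChart M φ) (hΦ : ContDiffOn ℝ 2 Φ M)
    {u : EuclideanSpace ℝ (Fin N)} (hu : u ∈ chartDomain φ) (v : EuclideanSpace ℝ (Fin N)) :
    dPhi M Φ (param φ u) (fderiv ℝ (param φ) u v) = fderiv ℝ (fun w => Φ (param φ w)) u v := by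
  rw [(hφ.hasFDerivAt_defining hΦ hu).fderiv]; rfl

/-! ### The metric in local coordinates -/

theorem contDiffOn_sqMetric (hF : IsFinslerMetric M F) :
    ContDiffOn ℝ 3 (sqMetric F) {p | p ∈ tangentBundle M ∧ p.2 ≠ 0} :=
  hF.contDiffOn.pow 2

theorem tangentParam_mem_slit (hφ : IsSliceChart M φ)
    {p : EuclideanSpace ℝ (Fin N) × EuclideanSpace ℝ (Fin N)} (hp : p.1 ∈ chartDomain φ)
    (hp2 : p.2 ≠ 0) : tangentParam φ p ∈ {p : E × E | p ∈ tangentBundle M ∧ p.2 ≠ 0} :=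
  ⟨hφ.tangentParam_mem hp, hφ.fderiv_param_ne_zero hp hp2⟩

theorem eventually_slit {p : EuclideanSpace ℝ (Fin N) × EuclideanSpace ℝ (Fin N)}
    (hp : p.1 ∈ chartDomain φ) (hp2 : p.2 ≠ 0) :
    ∀ᶠ q : EuclideanSpace ℝ (Fin N) × EuclideanSpace ℝ (Fin N) in 𝓝 p,
      q.1 ∈ chartDomain φ ∧ q.2 ≠ 0 := by
  filter_upwards [continuousAt_fst (isOpen_chartDomain.mem_nhds hp),
    continuousAt_snd.eventually_ne hp2] with q h1 h2 using ⟨h1, h2⟩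

theorem contDiffAt_localG (hφ : IsSliceChart M φ) (hF : IsFinslerMetric M F)
    {p : EuclideanSpace ℝ (Fin N) × EuclideanSpace ℝ (Fin N)} (hp : p.1 ∈ chartDomain φ)
    (hp2 : p.2 ≠ 0) : ContDiffAt ℝ 2 (localG F φ) p := by
  have h1 := ((contDiffOn_sqMetric hF).of_le (n := 3) (m := 2) (by norm_num)) _
    (hφ.tangentParam_mem_slit hp hp2)
  rw [← contDiffWithinAt_univ]
  have h2 := h1.comp_of_preimage_mem_nhdsWithin (s := univ) p
    (hφ.contDiffAt_tangentParam hp).contDiffWithinAt (by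
      rw [nhdsWithin_univ]
      filter_upwards [eventually_slit hp hp2] with q hq using hφ.tangentParam_mem_slit hq.1 hq.2)
  exact h2

/-- In coordinates `G` is only seen to be `C²`, since `TM` is parametrized by a `C²` map. The
derivative in the velocity loses nothing: it involves the differential of `G` and the first
derivative of the parametrization, both `C²`, and no second derivative of the parametrization. -/
theorem contDiffAt_momentum_localG (hφ : IsSliceChart M φ) (hF : IsFinslerMetric M F)
    {p : EuclideanSpace ℝ (Fin N) × EuclideanSpace ℝ (Fin N)} (hp : p.1 ∈ chartDomain φ)
    (hp2 : p.2 ≠ 0) :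
    ContDiffAt ℝ 2 (fun q : EuclideanSpace ℝ (Fin N) × EuclideanSpace ℝ (Fin N) =>
      momentum (localG F φ) q.1 q.2) p := by
  set S := {p : E × E | p ∈ tangentBundle M ∧ p.2 ≠ 0} with hS
  have hmem := hφ.tangentParam_mem_slit hp hp2
  have h1 : ContDiffWithinAt ℝ (2 + 1) (sqMetric F) S (tangentParam φ p) := by
    have := contDiffOn_sqMetric hF _ hmem
    rwa [show (3 : WithTop ℕ∞) = 2 + 1 by norm_num] at this
  -- The slit bundle need not have unique derivatives in `E × E`, so a `C²` derivative `f'` is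
  -- chosen near the point instead of `fderivWithin`.
  obtain ⟨u, hu, -, -, f', hf', hf'2⟩ :=
    (contDiffWithinAt_succ_iff_hasFDerivWithinAt' (by simp)).1 h1
  rw [insert_eq_of_mem hmem] at hu
  have hev := eventually_slit (φ := φ) hp hp2
  have htend : Tendsto (tangentParam φ) (𝓝 p) (𝓝[S] (tangentParam φ p)) :=
    tendsto_nhdsWithin_iff.2 ⟨(hφ.contDiffAt_tangentParam hp).continuousAt,
      hev.mono fun q hq => hφ.tangentParam_mem_slit hq.1 hq.2⟩
  have h2 : ContDiffAt ℝ 2 (fun q => f' (tangentParam φ q)) p := by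
    rw [← contDiffWithinAt_univ]
    refine hf'2.comp_of_preimage_mem_nhdsWithin (s := univ) p
      (hφ.contDiffAt_tangentParam hp).contDiffWithinAt ?_
    rw [nhdsWithin_univ]
    exact hev.mono fun q hq => hφ.tangentParam_mem_slit hq.1 hq.2
  have h3 : ContDiffAt ℝ 2 (fun q : EuclideanSpace ℝ (Fin N) × EuclideanSpace ℝ (Fin N) =>
      (f' (tangentParam φ q)).comp ((ContinuousLinearMap.inr ℝ E E).comp
        (fderiv ℝ (param φ) q.1))) p := by
    have h4 : ContDiffAt ℝ 2 (fun q : EuclideanSpace ℝ (Fin N) × EuclideanSpace ℝ (Fin N) =>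
        fderiv ℝ (param φ) q.1) p := (hφ.contDiffAt_fderiv_param hp).comp p contDiffAt_fst
    exact h2.clm_comp (contDiffAt_const.clm_comp h4)
  refine h3.congr_of_eventuallyEq ?_
  filter_upwards [htend hu, hev, hev.eventually_nhds] with q hqu hq hq'
  have h5 : HasFDerivAt (sqMetric F ∘ tangentParam φ)
      ((f' (tangentParam φ q)).comp (fderiv ℝ (tangentParam φ) q)) q :=
    (hf' _ hqu).comp_hasFDerivAt q
      ((hφ.contDiffAt_tangentParam hq.1).differentiableAt (by norm_num)).hasFDerivAt
      (hq'.mono fun r hr => hφ.tangentParam_mem_slit hr.1 hr.2)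
  ext w
  rw [momentum_apply]
  have h6 : fderiv ℝ (localG F φ) (q.1, q.2) = _ := h5.fderiv
  rw [h6, ContinuousLinearMap.comp_apply, hφ.fderiv_tangentParam hq.1]
  simp

theorem localG_homog (hφ : IsSliceChart M φ) (hF : IsFinslerMetric M F)
    (u : EuclideanSpace ℝ (Fin N)) (hu : u ∈ chartDomain φ) (v : EuclideanSpace ℝ (Fin N)) (c : ℝ)
    (hc : 0 < c) : localG F φ (u, c • v) = c ^ 2 * localG F φ (u, v) := by
  rw [localG_eq, localG_eq, tangentParam, tangentParam, sqMetric, sqMetric, map_smul,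
    hF.homogeneous _ (hφ.param_mem hu) _ (hφ.fderiv_param_mem hu v) c hc, mul_pow]

theorem localG_pos (hφ : IsSliceChart M φ) (hF : IsFinslerMetric M F)
    (u : EuclideanSpace ℝ (Fin N)) (hu : u ∈ chartDomain φ) (v : EuclideanSpace ℝ (Fin N))
    (hv : v ≠ 0) : 0 < localG F φ (u, v) :=
  pow_pos (hF.pos _ (hφ.param_mem hu) _ (hφ.fderiv_param_mem hu v)
    (hφ.fderiv_param_ne_zero hu hv)) 2

theorem differentiableAt_momentum_localG (hφ : IsSliceChart M φ) (hF : IsFinslerMetric M F)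
    {u v : EuclideanSpace ℝ (Fin N)} (hu : u ∈ chartDomain φ) (hv : v ≠ 0) :
    DifferentiableAt ℝ (fun v' => momentum (localG F φ) u v') v :=
  ((hφ.contDiffAt_momentum_localG hF (p := (u, v)) hu hv).differentiableAt (by norm_num)).comp v
    (hasFDerivAt_prodMk_right u v).differentiableAt

theorem fundamentalTensor_param (hφ : IsSliceChart M φ) (hF : IsFinslerMetric M F)
    {u v : EuclideanSpace ℝ (Fin N)} (hu : u ∈ chartDomain φ) (hv : v ≠ 0)
    (ξ η : EuclideanSpace ℝ (Fin N)) :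
    fundamentalTensor F (param φ u) (fderiv ℝ (param φ) u v) (fderiv ℝ (param φ) u ξ)
      (fderiv ℝ (param φ) u η)
      = 1 / 2 * fderiv ℝ (fun v' => momentum (localG F φ) u v') v ξ η := by
  rw [fundamentalTensor]
  congr 1
  have hline : Tendsto (fun s : ℝ => v + s • ξ) (𝓝 0) (𝓝 v) := by
    have := (hasDerivAt_line (u := v) (v := ξ) (0 : ℝ)).continuousAt.tendsto
    simpa using this
  have h1 : (fun s : ℝ => deriv (fun t : ℝ => sqMetric F (param φ u, fderiv ℝ (param φ) u v
      + s • fderiv ℝ (param φ) u ξ + t • fderiv ℝ (param φ) u η)) 0)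
      =ᶠ[𝓝 0] fun s => momentum (localG F φ) u (v + s • ξ) η := by
    filter_upwards [hline.eventually_ne hv] with s hs
    have h2 : HasFDerivAt (fun w => localG F φ (u, w)) (momentum (localG F φ) u (v + s • ξ))
        (v + s • ξ) :=
      (((hφ.contDiffAt_localG hF (p := (u, v + s • ξ)) hu hs).differentiableAt
        (by norm_num)).hasFDerivAt).comp _ (hasFDerivAt_prodMk_right u _)
    have h3 := h2.comp_hasDerivAt_of_eq (0 : ℝ)
      (hasDerivAt_line (u := v + s • ξ) (v := η) (0 : ℝ)) (by simp)
    have h4 : (fun t : ℝ => sqMetric F (param φ u, fderiv ℝ (param φ) u v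
      + s • fderiv ℝ (param φ) u ξ + t • fderiv ℝ (param φ) u η))
      = (fun w => localG F φ (u, w)) ∘ fun t : ℝ => v + s • ξ + t • η := by
      ext t
      simp only [Function.comp, localG_eq, tangentParam, map_add, map_smul]
    rw [h4, h3.deriv]
  rw [h1.deriv_eq]
  have h5 := (hφ.differentiableAt_momentum_localG hF hu hv).hasFDerivAt.comp_hasDerivAt_of_eq (0 : ℝ)
    (hasDerivAt_line (u := v) (v := ξ) (0 : ℝ)) (by simp)
  have h6 := h5.clm_apply (hasDerivAt_const (0 : ℝ) η)
  refine (h6.deriv.trans ?_)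
  simp

theorem isLagrangian (hφ : IsSliceChart M φ) (hF : IsFinslerMetric M F) :
    IsLagrangian (chartDomain φ) (localG F φ) := by
  refine IsLagrangian.of_homogeneous isOpen_chartDomain
    (fun u hu v hv => hφ.contDiffAt_localG hF hu hv) (hφ.localG_homog hF) (hφ.localG_pos hF)
    fun u hu v hv w hw => ?_
  have := hF.posDef _ (hφ.param_mem hu) _ (hφ.fderiv_param_mem hu v)
    (hφ.fderiv_param_ne_zero hu hv) _ (hφ.fderiv_param_mem hu w) (hφ.fderiv_param_ne_zero hu hw)
  rw [hφ.fundamentalTensor_param hF hu hv] at this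
  linarith

/-- On vectors tangent to `TM` the chain rule determines the derivative within `TM`, whichever
derivative `fderivWithin` selects. -/
theorem fderivWithin_sqMetric (hφ : IsSliceChart M φ) (hF : IsFinslerMetric M F)
    {p : EuclideanSpace ℝ (Fin N) × EuclideanSpace ℝ (Fin N)} (hp : p.1 ∈ chartDomain φ)
    (X : EuclideanSpace ℝ (Fin N) × EuclideanSpace ℝ (Fin N)) :
    fderivWithin ℝ (sqMetric F) (tangentBundle M) (tangentParam φ p)
      (fderiv ℝ (tangentParam φ) p X) = fderiv ℝ (localG F φ) p X := by
  have hchain : DifferentiableWithinAt ℝ (sqMetric F) (tangentBundle M) (tangentParam φ p) →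
      fderivWithin ℝ (sqMetric F) (tangentBundle M) (tangentParam φ p)
      (fderiv ℝ (tangentParam φ) p X) = fderiv ℝ (localG F φ) p X := by
    intro hd
    have h1 : HasFDerivAt (localG F φ) _ p := hd.hasFDerivWithinAt.comp_hasFDerivAt p
      ((hφ.contDiffAt_tangentParam hp).differentiableAt (by norm_num)).hasFDerivAt (by
        filter_upwards [continuousAt_fst (isOpen_chartDomain.mem_nhds hp)] with q hq
          using hφ.tangentParam_mem hq)
    rw [h1.fderiv]; rfl
  rcases eq_or_ne p.2 0 with h0 | h0
  · by_cases hd : DifferentiableWithinAt ℝ (sqMetric F) (tangentBundle M) (tangentParam φ p)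
    · exact hchain hd
    -- On the zero section the default value `0` of `fderivWithin` is harmless: force and momentum
    -- vanish there by homogeneity.
    · rw [fderivWithin_zero_of_not_differentiableWithinAt hd, zero_apply]
      have hL := hφ.isLagrangian hF
      rw [show p = (p.1, 0) from Prod.ext rfl h0, show X = (X.1, X.2) from rfl, fderiv_apply_eq,
        hL.force_zero hp, hL.momentum_zero hp]
      simp
  · refine hchain ?_
    have h1 := ((contDiffOn_sqMetric hF) _ (hφ.tangentParam_mem_slit hp h0)).differentiableWithinAt
      (by norm_num)
    refine h1.mono_of_mem_nhdsWithin ?_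
    have h2 : ∀ᶠ q : E × E in 𝓝 (tangentParam φ p), q.2 ≠ 0 :=
      continuousAt_snd.eventually_ne (hφ.fderiv_param_ne_zero hp h0)
    filter_upwards [self_mem_nhdsWithin, mem_nhdsWithin_of_mem_nhds h2] with q hq hq' using ⟨hq, hq'⟩

theorem orthogonalToBdry (hφ : IsSliceChart M φ) (hF : IsFinslerMetric M F)
    (hΦ : ContDiffOn ℝ 2 Φ M) {u : EuclideanSpace ℝ (Fin N)} (hu : u ∈ chartDomain φ)
    {v : EuclideanSpace ℝ (Fin N)}
    (H : ∀ ξ, fderiv ℝ (fun w => Φ (param φ w)) u ξ = 0 → momentum (localG F φ) u v ξ = 0) :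
    OrthogonalToBdry M F Φ (param φ u) (fderiv ℝ (param φ) u v) := by
  rintro ζ ⟨hζ, hζ0⟩
  obtain ⟨ξ, rfl⟩ := hφ.exists_fderiv_param_eq hu hζ
  rw [hφ.dPhi_param hΦ hu] at hζ0
  have h1 := ((hφ.isLagrangian hF).hasFDerivAt_momentum hu v).comp_hasDerivAt_of_eq (0 : ℝ)
      (hasDerivAt_line (u := v) (v := ξ) (0 : ℝ)) (by simp)
  rw [H ξ hζ0] at h1
  have h4 : (fun t : ℝ => sqMetric F (param φ u, fderiv ℝ (param φ) u v
      + t • fderiv ℝ (param φ) u ξ))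
      = (fun w => localG F φ (u, w)) ∘ fun t : ℝ => v + t • ξ := by
    ext t
    simp only [Function.comp, localG_eq, tangentParam, map_add, map_smul]
  rw [HasLineDerivAt, h4]
  exact h1

end IsSliceChart

end Charts

/-! ### Variations in local coordinates -/

theorem _root_.IsCompact.exists_lipschitzOnWith_of_contDiffOn {X Y : Type*} [NormedAddCommGroup X]
    [NormedSpace ℝ X] [NormedAddCommGroup Y] [NormedSpace ℝ Y] {f : X → Y} {K U : Set X}
    (hK : IsCompact K) (hU : IsOpen U) (hKU : K ⊆ U) (hf : ContDiffOn ℝ 1 f U) :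
    ∃ C, LipschitzOnWith C f K := by
  refine LocallyLipschitzOn.exists_lipschitzOnWith_of_compact hK fun p hp => ?_
  obtain ⟨C, t, ht, hC⟩ := (hf.contDiffAt (hU.mem_nhds (hKU hp))).exists_lipschitzOnWith
  exact ⟨C, t, mem_nhdsWithin_of_mem_nhds ht, hC⟩

theorem IsH1On.comp {X Y : Type*} [NormedAddCommGroup X] [NormedSpace ℝ X] [NormedAddCommGroup Y]
    [NormedSpace ℝ Y] [FiniteDimensional ℝ X] [FiniteDimensional ℝ Y] {x : ℝ → X} {a b : ℝ}
    (hx : IsH1On x a b) (hab : a ≤ b) {f : X → Y} {U : Set X} (hU : IsOpen U)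
    (hxU : ∀ s ∈ Icc a b, x s ∈ U) (hf : ContDiffOn ℝ 1 f U) : IsH1On (fun s => f (x s)) a b := by
  obtain ⟨C, hC⟩ := (isCompact_Icc.image_of_continuousOn
    (hx.continuousOn hab)).exists_lipschitzOnWith_of_contDiffOn hU
    (by rintro _ ⟨s, hs, rfl⟩; exact hxU s hs) hf
  refine hx.of_dist_le hab C.2 fun s hs t ht => ?_
  refine (hC.dist_le_mul _ (mem_image_of_mem x hs) _ (mem_image_of_mem x ht)).trans ?_
  exact mul_le_mul_of_nonneg_left (le_add_of_nonneg_left dist_nonneg) C.2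

/-- A vector field along `x`, cut off by `τ`, is of class `H^{1,2}`. -/
theorem IsH1On.smul_comp {X V Y : Type*} [NormedAddCommGroup X] [NormedSpace ℝ X]
    [FiniteDimensional ℝ X] [NormedAddCommGroup V] [NormedSpace ℝ V] [NormedAddCommGroup Y]
    [NormedSpace ℝ Y] [FiniteDimensional ℝ Y] {x : ℝ → X} {y : ℝ → V} {Z : V → Y} {a b c d : ℝ}
    (hx : IsH1On x c d) (hcd : c ≤ d) (hab : a ≤ b) (hac : c ≤ a) (hbd : b ≤ d) {C : NNReal}
    (hy : ∀ s ∈ Icc a b, ∀ t ∈ Icc a b, dist (y s) (y t) ≤ C * dist (x s) (x t))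
    {U : Set V} (hU : IsOpen U) (hyU : ∀ s ∈ Icc a b, y s ∈ U) (hZ : ContDiffOn ℝ 1 Z U)
    {τ : ℝ → ℝ} {D : NNReal} (hτ : LipschitzWith D τ) (h0 : ∀ r ∈ Icc c d, r ∉ Icc a b → τ r = 0) :
    IsH1On (fun s => τ s • Z (y s)) c d := by
  have hxc : ContinuousOn x (Icc a b) := (hx.continuousOn hcd).mono (Icc_subset_Icc hac hbd)
  have hyc : ContinuousOn y (Icc a b) := by
    intro s hs
    refine tendsto_iff_dist_tendsto_zero.2 ?_
    have h1 : Tendsto (fun r => C * dist (x r) (x s)) (𝓝[Icc a b] s) (𝓝 0) := by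
      simpa using (tendsto_iff_dist_tendsto_zero.1 (hxc s hs).tendsto).const_mul (C : ℝ)
    refine squeeze_zero' (Eventually.of_forall fun _ => dist_nonneg) ?_ h1
    filter_upwards [self_mem_nhdsWithin] with r hr using hy r hr s hs
  have hK : IsCompact (y '' Icc a b) := isCompact_Icc.image_of_continuousOn hyc
  have hKU : y '' Icc a b ⊆ U := by rintro _ ⟨s, hs, rfl⟩; exact hyU s hs
  obtain ⟨A, hA⟩ := hK.exists_lipschitzOnWith_of_contDiffOn hU hKU hZ
  obtain ⟨B, hB⟩ := hK.exists_bound_of_continuousOn (hZ.continuousOn.mono hKU)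
  obtain ⟨T, hT⟩ := (isCompact_Icc (a := a) (b := b)).exists_bound_of_continuousOn
    hτ.continuous.continuousOn
  have hB0 : 0 ≤ B := (norm_nonneg _).trans (hB _ (mem_image_of_mem y (left_mem_Icc.2 hab)))
  have hT0 : 0 ≤ T := (norm_nonneg _).trans (hT _ (left_mem_Icc.2 hab))
  have hD0 : (0 : ℝ) ≤ D := D.2
  have hAC : (0 : ℝ) ≤ A * C := mul_nonneg A.2 C.2
  -- `y` is controlled only on `[a, b]`. When `t` lies outside, `τ t = 0`, so `|τ s|` is itself at
  -- most `D * dist s t`.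
  have hout : ∀ s ∈ Icc a b, ∀ t ∈ Icc c d, t ∉ Icc a b →
      dist (τ s • Z (y s)) (τ t • Z (y t)) ≤ (D * B + T * (A * C)) * (dist s t + dist (x s) (x t)) := by
    intro s hs t ht ht'
    have h1 := hτ.dist_le_mul s t
    rw [h0 t ht ht', Real.dist_eq, sub_zero] at h1
    rw [h0 t ht ht', zero_smul, dist_zero_right, norm_smul]
    calc ‖τ s‖ * ‖Z (y s)‖ ≤ (D * dist s t) * B := by
          gcongr
          · exact h1
          · exact hB _ (mem_image_of_mem y hs)
      _ = (D * B + 0) * (dist s t + 0) := by ring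
      _ ≤ _ := by gcongr; exacts [mul_nonneg hT0 hAC, dist_nonneg]
  refine hx.of_dist_le hcd (K := D * B + T * (A * C)) (by positivity) fun s hs t ht => ?_
  by_cases hs' : s ∈ Icc a b
  · by_cases ht' : t ∈ Icc a b
    · have e : τ s • Z (y s) - τ t • Z (y t)
          = (τ s - τ t) • Z (y s) + τ t • (Z (y s) - Z (y t)) := by
        rw [sub_smul, smul_sub]; abel
      rw [dist_eq_norm, e]
      have h1 := hA.dist_le_mul _ (mem_image_of_mem y hs') _ (mem_image_of_mem y ht')
      have h2 := hτ.dist_le_mul s t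
      rw [dist_eq_norm] at h1
      rw [Real.dist_eq, ← Real.norm_eq_abs] at h2
      calc _ ≤ ‖τ s - τ t‖ * ‖Z (y s)‖ + ‖τ t‖ * ‖Z (y s) - Z (y t)‖ := by
            rw [← norm_smul, ← norm_smul]; exact norm_add_le _ _
        _ ≤ (D * dist s t) * B + T * (A * (C * dist (x s) (x t))) := by
            gcongr
            · exact hB _ (mem_image_of_mem y hs')
            · exact hT t ht'
            · exact h1.trans (by gcongr; exact hy s hs' t ht')
        _ = D * B * dist s t + T * (A * C) * dist (x s) (x t) := by ring
        _ ≤ (D * B + T * (A * C)) * dist s t + (D * B + T * (A * C)) * dist (x s) (x t) := by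
            gcongr
            · exact le_add_of_nonneg_right (mul_nonneg hT0 hAC)
            · exact le_add_of_nonneg_left (mul_nonneg hD0 hB0)
        _ = _ := by ring
    · exact hout s hs' t ht ht'
  · by_cases ht' : t ∈ Icc a b
    · rw [dist_comm, dist_comm s t, dist_comm (x s)]
      exact hout t ht' s hs hs'
    · rw [h0 s hs hs', h0 t ht ht', zero_smul, zero_smul, dist_self]
      positivity

theorem IsLagrangian.mono {V : Type*} [NormedAddCommGroup V] [NormedSpace ℝ V] {U U' : Set V} {L : V × V → ℝ}
    (h : IsLagrangian U L) (hU' : IsOpen U') (hsub : U' ⊆ U) : IsLagrangian U' L where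
  isOpen := hU'
  contDiffOn := h.contDiffOn.mono (prod_mono hsub Subset.rfl)
  homog u hu := h.homog u (hsub hu)
  pos u hu := h.pos u (hsub hu)
  strictMono u hu := h.strictMono u (hsub hu)

section Variations

variable {E : Type*} [NormedAddCommGroup E] [NormedSpace ℝ E] {N k : ℕ} {M : Set E}
  {F : E × E → ℝ} {Φ : E → ℝ}
  {φ : OpenPartialHomeomorph E (EuclideanSpace ℝ (Fin N) × EuclideanSpace ℝ (Fin k))}
  {x : ℝ → E} {a b : ℝ}

/-- The local expression of a curve. -/
noncomputable def coordCurve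
    (φ : OpenPartialHomeomorph E (EuclideanSpace ℝ (Fin N) × EuclideanSpace ℝ (Fin k)))
    (x : ℝ → E) (s : ℝ) : EuclideanSpace ℝ (Fin N) := (φ (x s)).1

/-- The local expression of the defining function. -/
noncomputable def localPhi (Φ : E → ℝ)
    (φ : OpenPartialHomeomorph E (EuclideanSpace ℝ (Fin N) × EuclideanSpace ℝ (Fin k)))
    (u : EuclideanSpace ℝ (Fin N)) : ℝ := Φ (param φ u)

/-- A piece of curve in `M` contained in the domain of a slice chart. -/
structure InChart (M : Set E)
    (φ : OpenPartialHomeomorph E (EuclideanSpace ℝ (Fin N) × EuclideanSpace ℝ (Fin k)))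
    (x : ℝ → E) (a b : ℝ) : Prop where
  slice : IsSliceChart M φ
  mem : ∀ s ∈ Icc a b, x s ∈ M
  mem_source : ∀ s ∈ Icc a b, x s ∈ φ.source

/-! ### The critical inequality read in a chart. -/

namespace InChart

theorem coord_mem (h : InChart M φ x a b) {s : ℝ} (hs : s ∈ Icc a b) :
    coordCurve φ x s ∈ chartDomain φ := h.slice.coord_mem (h.mem_source s hs) (h.mem s hs)

theorem param_coord (h : InChart M φ x a b) {s : ℝ} (hs : s ∈ Icc a b) :
    param φ (coordCurve φ x s) = x s := h.slice.param_coord (h.mem_source s hs) (h.mem s hs)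

theorem differentiableAt_coord (h : InChart M φ x a b) {s : ℝ} (hs : s ∈ Icc a b)
    (hx : DifferentiableAt ℝ x s) : DifferentiableAt ℝ (coordCurve φ x) s :=
  ((h.slice.contDiffAt_coord (h.mem_source s hs)).differentiableAt (by norm_num)).comp s hx

theorem eventuallyEq (h : InChart M φ x a b) {s : ℝ} (hs : s ∈ Ioo a b) :
    x =ᶠ[𝓝 s] fun r => param φ (coordCurve φ x r) := by
  filter_upwards [Icc_mem_nhds hs.1 hs.2] with r hr using (h.param_coord hr).symm

theorem hasDerivAt (h : InChart M φ x a b) {s : ℝ} (hs : s ∈ Ioo a b)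
    {v : EuclideanSpace ℝ (Fin N)} (hy : HasDerivAt (coordCurve φ x) v s) :
    HasDerivAt x (fderiv ℝ (param φ) (coordCurve φ x s) v) s :=
  ((h.slice.hasFDerivAt_param (h.coord_mem (Ioo_subset_Icc_self hs))).comp_hasDerivAt s
    hy).congr_of_eventuallyEq (h.eventuallyEq hs)

theorem deriv_eq (h : InChart M φ x a b) {s : ℝ} (hs : s ∈ Ioo a b)
    (hy : DifferentiableAt ℝ (coordCurve φ x) s) :
    (x s, deriv x s) = tangentParam φ (coordCurve φ x s, deriv (coordCurve φ x) s) :=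
  Prod.ext (h.param_coord (Ioo_subset_Icc_self hs)).symm (h.hasDerivAt hs hy.hasDerivAt).deriv

theorem localPhi_coord (h : InChart M φ x a b) {s : ℝ} (hs : s ∈ Icc a b) :
    localPhi Φ φ (coordCurve φ x s) = Φ (x s) := by rw [localPhi, h.param_coord hs]

variable [FiniteDimensional ℝ E]

theorem exists_dist_le (h : InChart M φ x a b) (hx : ContinuousOn x (Icc a b)) :
    ∃ C : NNReal, ∀ s ∈ Icc a b, ∀ t ∈ Icc a b,
      dist (coordCurve φ x s) (coordCurve φ x t) ≤ C * dist (x s) (x t) := by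
  obtain ⟨C, hC⟩ := (isCompact_Icc.image_of_continuousOn hx).exists_lipschitzOnWith_of_contDiffOn
    φ.open_source (by rintro _ ⟨s, hs, rfl⟩; exact h.mem_source s hs)
    (f := fun p => (φ p).1) (fun p hp => ((h.slice.contDiffAt_coord hp).of_le
      (by norm_num)).contDiffWithinAt)
  exact ⟨C, fun s hs t ht => hC.dist_le_mul _ (mem_image_of_mem x hs) _ (mem_image_of_mem x ht)⟩

theorem isH1On (h : InChart M φ x a b) (hab : a ≤ b) (hx : IsH1On x a b) :
    IsH1On (coordCurve φ x) a b :=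
  hx.comp hab φ.open_source h.mem_source (f := fun p => (φ p).1)
    (fun p hp => ((h.slice.contDiffAt_coord hp).of_le (by norm_num)).contDiffWithinAt)

/-- The first variation of the energy in local coordinates. -/
theorem energyDifferential_eq (h : InChart M φ x a b) (hF : IsFinslerMetric M F) (hx : IsH1 x)
    (ha : 0 ≤ a) (hab : a < b) (hb : b ≤ 1) {U : Set (EuclideanSpace ℝ (Fin N))}
    (hU : IsOpen U) (hyU : ∀ s ∈ Icc a b, coordCurve φ x s ∈ U)
    {z : EuclideanSpace ℝ (Fin N) → EuclideanSpace ℝ (Fin N)} (hz : ContDiffOn ℝ 1 z U)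
    {τ : ℝ → ℝ} {D : NNReal} (hτ : LipschitzWith D τ)
    (h0 : ∀ r ∈ Icc (0 : ℝ) 1, r ∉ Icc a b → τ r = 0) :
    energyDifferential M F x
      (fun s => τ s • fderiv ℝ (param φ) (coordCurve φ x s) (z (coordCurve φ x s)))
    = 1 / 2 * weakPairing (fun s => force (localG F φ) (coordCurve φ x s)
        (deriv (coordCurve φ x) s) (z (coordCurve φ x s))
        + momentum (localG F φ) (coordCurve φ x s) (deriv (coordCurve φ x) s)
          (fderiv ℝ z (coordCurve φ x s) (deriv (coordCurve φ x) s)))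
      (fun s => momentum (localG F φ) (coordCurve φ x s)
        (deriv (coordCurve φ x) s) (z (coordCurve φ x s))) a b τ := by
  set y := coordCurve φ x with hy
  rw [energyDifferential]
  congr 1
  set I : ℝ → ℝ := fun s => fderivWithin ℝ (sqMetric F) (tangentBundle M) (x s, deriv x s)
    (τ s • fderiv ℝ (param φ) (y s) (z (y s)),
      deriv (fun s => τ s • fderiv ℝ (param φ) (y s) (z (y s))) s) with hI
  have hxd : ∀ᵐ s, s ∈ Icc (0 : ℝ) 1 → DifferentiableAt ℝ x s :=
    IsH1On.ae_differentiableAt hx zero_le_one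
  have hτd : ∀ᵐ s, DifferentiableAt ℝ τ s := hτ.ae_differentiableAt
  have hout : ∀ s ∈ Ioo (0 : ℝ) 1, s ∉ Icc a b → I s = 0 := by
    intro s hs hs'
    have h1 : (fun s => τ s • fderiv ℝ (param φ) (y s) (z (y s))) =ᶠ[𝓝 s] fun _ => 0 := by
      filter_upwards [Ioo_mem_nhds hs.1 hs.2, isClosed_Icc.isOpen_compl.mem_nhds hs'] with r hr hr'
      rw [h0 r (Ioo_subset_Icc_self hr) hr', zero_smul]
    rw [hI]
    simp only
    rw [h1.deriv_eq, h0 s (Ioo_subset_Icc_self hs) hs', zero_smul, deriv_const]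
    exact map_zero _
  have e1 : ∫ s in (0 : ℝ)..1, I s = ∫ s in a..b, I s := by
    rw [intervalIntegral.integral_of_le zero_le_one, intervalIntegral.integral_of_le hab.le]
    refine setIntegral_eq_of_subset_of_ae_sdiff_eq_zero measurableSet_Ioc.nullMeasurableSet
      (Ioc_subset_Ioc ha hb) ?_
    filter_upwards [ae_ne_ne 1 a] with s hs hs'
    refine hout s ⟨hs'.1.1, lt_of_le_of_ne hs'.1.2 hs.1⟩ fun hs'' => hs'.2 ⟨?_, hs''.2⟩
    exact lt_of_le_of_ne hs''.1 (Ne.symm hs.2)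
  rw [show (∫ s in (0 : ℝ)..1, fderivWithin ℝ (sqMetric F) (tangentBundle M) (x s, deriv x s)
    (τ s • fderiv ℝ (param φ) (y s) (z (y s)),
      deriv (fun s => τ s • fderiv ℝ (param φ) (y s) (z (y s))) s)) = ∫ s in (0 : ℝ)..1, I s from rfl,
    e1, weakPairing]
  refine intervalIntegral.integral_congr_ae ?_
  filter_upwards [hxd, hτd, ae_ne_ne b b] with s hxs hτs hsb hs
  rw [uIoc_of_le hab.le] at hs
  have hs' : s ∈ Ioo a b := ⟨hs.1, lt_of_le_of_ne hs.2 hsb.1⟩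
  have hsI : s ∈ Icc a b := Ioo_subset_Icc_self hs'
  have hys : DifferentiableAt ℝ y s :=
    h.differentiableAt_coord hsI (hxs ⟨ha.trans hsI.1, hsI.2.trans hb⟩)
  have hus := h.coord_mem hsI
  have hzs : HasFDerivAt z (fderiv ℝ z (y s)) (y s) :=
    ((hz.contDiffAt (hU.mem_nhds (hyU s hsI))).differentiableAt (by norm_num)).hasFDerivAt
  have hzd : HasDerivAt (fun r => z (y r)) (fderiv ℝ z (y s) (deriv y s)) s :=
    hzs.comp_hasDerivAt s hys.hasDerivAt
  have hDd : HasDerivAt (fun r => fderiv ℝ (param φ) (y r))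
      (fderiv ℝ (fderiv ℝ (param φ)) (y s) (deriv y s)) s :=
    (((h.slice.contDiffAt_fderiv_param hus).differentiableAt
      (by norm_num)).hasFDerivAt).comp_hasDerivAt s hys.hasDerivAt
  have hξ := hτs.hasDerivAt.smul (hDd.clm_apply hzd)
  -- Differentiating the field along the curve yields the second derivative of the parametrization
  -- with its arguments in the order opposite to that in `fderiv_tangentParam`; Schwarz's theorem
  -- identifies the two.
  have hsymm : fderiv ℝ (fderiv ℝ (param φ)) (y s) (deriv y s) (z (y s))
      = fderiv ℝ (fderiv ℝ (param φ)) (y s) (z (y s)) (deriv y s) :=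
    ((h.slice.contDiffAt_param hus).isSymmSndFDerivAt (by simp; norm_num)).eq _ _
  have e2 : (τ s • fderiv ℝ (param φ) (y s) (z (y s)),
      deriv (fun s => τ s • fderiv ℝ (param φ) (y s) (z (y s))) s)
      = fderiv ℝ (tangentParam φ) (y s, deriv y s)
        (τ s • z (y s), τ s • fderiv ℝ z (y s) (deriv y s) + deriv τ s • z (y s)) := by
    rw [h.slice.fderiv_tangentParam (p := (y s, deriv y s)) hus]
    refine Prod.ext (by simp) ?_
    refine hξ.deriv.trans ?_
    simp only [map_add, map_smul, smul_apply, smul_add, hsymm]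
    abel
  rw [hI]
  simp only
  rw [e2, h.deriv_eq hs' hys, h.slice.fderivWithin_sqMetric hF (p := (y s, deriv y s)) hus,
    fderiv_apply_eq]
  simp only [map_add, map_smul, smul_eq_mul]
  ring

/-- The first variation is nonnegative along admissible cut off vector fields. -/
theorem weakPairing_nonneg (h : InChart M φ x a b) (hF : IsFinslerMetric M F)
    (hΦ : ContDiffOn ℝ 2 Φ M) (hx : IsVCritical M F Φ x)
    (ha : 0 ≤ a) (hab : a < b) (hb : b ≤ 1) {U : Set (EuclideanSpace ℝ (Fin N))}
    (hU : IsOpen U) (hUφ : U ⊆ chartDomain φ) (hyU : ∀ s ∈ Icc a b, coordCurve φ x s ∈ U)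
    {z : EuclideanSpace ℝ (Fin N) → EuclideanSpace ℝ (Fin N)} (hz : ContDiffOn ℝ 1 z U)
    {τ : ℝ → ℝ} {D : NNReal} (hτ : LipschitzWith D τ)
    (h0 : ∀ r ∈ Icc (0 : ℝ) 1, r ∉ Icc a b → τ r = 0)
    (hle : ∀ r ∈ Icc a b, x r ∈ bdry M Φ →
      τ r * fderiv ℝ (localPhi Φ φ) (coordCurve φ x r) (z (coordCurve φ x r)) ≤ 0)
    (heq : ∀ r ∈ Icc a b, r = 0 ∨ r = 1 →
      τ r * fderiv ℝ (localPhi Φ φ) (coordCurve φ x r) (z (coordCurve φ x r)) = 0) :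
    0 ≤ weakPairing (fun s => force (localG F φ) (coordCurve φ x s)
        (deriv (coordCurve φ x) s) (z (coordCurve φ x s))
        + momentum (localG F φ) (coordCurve φ x s) (deriv (coordCurve φ x) s)
          (fderiv ℝ z (coordCurve φ x s) (deriv (coordCurve φ x) s)))
      (fun s => momentum (localG F φ) (coordCurve φ x s)
        (deriv (coordCurve φ x) s) (z (coordCurve φ x s))) a b τ := by
  obtain ⟨⟨hx1, hxΩ, hx0, hx1'⟩, hcrit⟩ := hx
  have hE := h.energyDifferential_eq hF hx1 ha hab hb hU hyU hz hτ h0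
  set ξ : ℝ → E := fun s => τ s • fderiv ℝ (param φ) (coordCurve φ x s) (z (coordCurve φ x s))
    with hξ
  have hdPhi : ∀ r ∈ Icc a b, dPhi M Φ (x r) (ξ r)
      = τ r * fderiv ℝ (localPhi Φ φ) (coordCurve φ x r) (z (coordCurve φ x r)) := by
    intro r hr
    have := h.slice.dPhi_param hΦ (h.coord_mem hr) (τ r • z (coordCurve φ x r))
    rw [h.param_coord hr, map_smul, map_smul, smul_eq_mul] at this
    exact this
  have hout : ∀ r ∈ Icc (0 : ℝ) 1, r ∉ Icc a b → ξ r = 0 := fun r hr hr' => by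
    rw [hξ]; simp only; rw [h0 r hr hr', zero_smul]
  have hdPhi0 : ∀ q, dPhi M Φ q 0 = 0 := fun q => map_zero _
  have hend : ∀ r ∈ Icc (0 : ℝ) 1, r = 0 ∨ r = 1 → dPhi M Φ (x r) (ξ r) = 0 := by
    intro r hr hr'
    by_cases hr'' : r ∈ Icc a b
    · rw [hdPhi r hr'', heq r hr'' hr']
    · rw [hout r hr hr'', hdPhi0]
  have hadm : ξ ∈ admissibleVariations M Φ x := by
    refine ⟨?_, fun s hs => ?_, hend 0 (by simp) (Or.inl rfl), hend 1 (by simp) (Or.inr rfl),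
      fun s hs hs' => ?_⟩
    · have hxc : ContinuousOn x (Icc a b) :=
        (IsH1On.continuousOn hx1 zero_le_one).mono (Icc_subset_Icc ha hb)
      obtain ⟨C, hC⟩ := h.exists_dist_le hxc
      refine IsH1On.smul_comp (Z := fun u => fderiv ℝ (param φ) u (z u)) hx1 zero_le_one hab.le ha
        hb hC hU hyU ?_ hτ h0
      intro u hu
      exact ((((h.slice.contDiffAt_fderiv_param (hUφ hu)).of_le (by norm_num)).clm_apply
        (hz.contDiffAt (hU.mem_nhds hu)))).contDiffWithinAt
    · by_cases hs' : s ∈ Icc a b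
      · have := h.slice.fderiv_param_mem (h.coord_mem hs') (τ s • z (coordCurve φ x s))
        rwa [h.param_coord hs', map_smul] at this
      · rw [hout s hs hs']
        exact ⟨fun _ => x s, rfl, Eventually.of_forall fun _ => (hxΩ s hs).1,
          hasDerivAt_const _ _⟩
    · by_cases hs'' : s ∈ Icc a b
      · rw [hdPhi s hs'']; exact hle s hs'' hs'
      · rw [hout s (Ioo_subset_Icc_self hs) hs'', hdPhi0]
  have := hcrit ξ hadm
  rw [hE] at this
  linarith

/-- A covector field `ν` and a vector `w` adapted to the contact of `x` with the boundary over the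
times in `J`. -/
structure Adapted (Φ : E → ℝ)
    (φ : OpenPartialHomeomorph E (EuclideanSpace ℝ (Fin N) × EuclideanSpace ℝ (Fin k)))
    (x : ℝ → E) (J : Set ℝ) (U : Set (EuclideanSpace ℝ (Fin N)))
    (ν : EuclideanSpace ℝ (Fin N) → EuclideanSpace ℝ (Fin N) →L[ℝ] ℝ)
    (w : EuclideanSpace ℝ (Fin N)) : Prop where
  isOpen : IsOpen U
  subset : U ⊆ chartDomain φ
  smooth : ContDiffOn ℝ 1 ν U
  contact : ∀ s ∈ J, Φ (x s) = 0 → ν (coordCurve φ x s) w = 1 ∧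
    ∃ c : ℝ, 0 < c ∧ fderiv ℝ (localPhi Φ φ) (coordCurve φ x s) = c • ν (coordCurve φ x s)

/-- The field `e - ν(e) w` is annihilated by `dΦ` at contact times because `ν(w) = 1`, so `τ` and
`-τ` are both admissible. The cut-off may be nonzero at `0` or `1` when these belong to `J`, which
gives the free-end conditions. -/
theorem tangential_eq_zero (h : InChart M φ x a b) (hF : IsFinslerMetric M F)
    (hΦ : ContDiffOn ℝ 2 Φ M) (hx : IsVCritical M F Φ x)
    (ha : 0 ≤ a) (hab : a < b) (hb : b ≤ 1) {J : Set ℝ} {U : Set (EuclideanSpace ℝ (Fin N))}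
    {ν : EuclideanSpace ℝ (Fin N) → EuclideanSpace ℝ (Fin N) →L[ℝ] ℝ}
    {w : EuclideanSpace ℝ (Fin N)} (hν : Adapted Φ φ x J U ν w)
    (hyU : ∀ s ∈ Icc a b, coordCurve φ x s ∈ U) (e : EuclideanSpace ℝ (Fin N))
    {τ : ℝ → ℝ} (hτ : ∃ C, LipschitzWith C τ) (h0 : ∀ r ∈ Icc (0 : ℝ) 1, r ∉ Icc a b → τ r = 0)
    (hJ : ∀ r ∈ Icc a b, r ∉ J → τ r = 0) :
    weakPairing (fun s => tangentialForce (localG F φ) ν w (coordCurve φ x s)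
        (deriv (coordCurve φ x) s) e)
      (fun s => tangentialMomentum (localG F φ) ν w (coordCurve φ x s)
        (deriv (coordCurve φ x) s) e) a b τ = 0 := by
  obtain ⟨D, hD⟩ := hτ
  set z : EuclideanSpace ℝ (Fin N) → EuclideanSpace ℝ (Fin N) := fun u => e - ν u e • w with hz
  have hzs : ContDiffOn ℝ 1 z U :=
    contDiffOn_const.sub ((hν.smooth.clm_apply contDiffOn_const).smul contDiffOn_const)
  -- The variable coefficient `ν(e)` of `w` is the source of the `fderiv ν` term in
  -- `tangentialForce`.
  have hzd : ∀ s ∈ Icc a b, ∀ v, fderiv ℝ z (coordCurve φ x s) v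
      = - (fderiv ℝ ν (coordCurve φ x s) v e • w) := by
    intro s hs v
    have h1 := ((hν.smooth.contDiffAt (hν.isOpen.mem_nhds (hyU s hs))).differentiableAt
      (by norm_num)).hasFDerivAt
    have h2 := ((h1.clm_apply (hasFDerivAt_const e _)).smul_const w).const_sub e
    rw [hz, h2.fderiv]
    simp
  have hzero : ∀ r ∈ Icc a b, x r ∈ bdry M Φ →
      τ r * fderiv ℝ (localPhi Φ φ) (coordCurve φ x r) (z (coordCurve φ x r)) = 0 := by
    intro r hr hr'
    by_cases hrJ : r ∈ J
    · obtain ⟨h1, c, hc, h2⟩ := hν.contact r hrJ hr'.2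
      rw [h2, hz, smul_apply, map_sub, map_smul, h1]
      simp
    · rw [hJ r hr hrJ, zero_mul]
  have hend : ∀ r, r = 0 ∨ r = 1 → x r ∈ bdry M Φ := by
    rintro r (rfl | rfl)
    exacts [hx.1.2.2.1, hx.1.2.2.2]
  have key : (fun s => force (localG F φ) (coordCurve φ x s)
        (deriv (coordCurve φ x) s) (z (coordCurve φ x s))
        + momentum (localG F φ) (coordCurve φ x s) (deriv (coordCurve φ x) s)
          (fderiv ℝ z (coordCurve φ x s) (deriv (coordCurve φ x) s)))
      =ᵐ[volume.restrict (Ioc a b)] (fun s => tangentialForce (localG F φ) ν w (coordCurve φ x s)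
        (deriv (coordCurve φ x) s) e) := by
    filter_upwards [ae_restrict_mem measurableSet_Ioc] with s hs
    rw [hzd s (Ioc_subset_Icc_self hs), hz, tangentialForce]
    simp only [map_sub, map_smul, map_neg, sub_apply, smul_apply, smul_eq_mul]
    ring
  have key2 : ∀ τ' : ℝ → ℝ, weakPairing (fun s => force (localG F φ) (coordCurve φ x s)
        (deriv (coordCurve φ x) s) (z (coordCurve φ x s))
        + momentum (localG F φ) (coordCurve φ x s) (deriv (coordCurve φ x) s)
          (fderiv ℝ z (coordCurve φ x s) (deriv (coordCurve φ x) s)))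
      (fun s => momentum (localG F φ) (coordCurve φ x s)
        (deriv (coordCurve φ x) s) (z (coordCurve φ x s))) a b τ'
      = weakPairing (fun s => tangentialForce (localG F φ) ν w (coordCurve φ x s)
        (deriv (coordCurve φ x) s) e)
      (fun s => tangentialMomentum (localG F φ) ν w (coordCurve φ x s)
        (deriv (coordCurve φ x) s) e) a b τ' := by
    intro τ'
    rw [weakPairing, weakPairing, intervalIntegral.integral_of_le hab.le,
      intervalIntegral.integral_of_le hab.le]
    refine integral_congr_ae ?_
    filter_upwards [key] with s hs
    rw [hs, tangentialMomentum, hz]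
    simp only [map_sub, map_smul, sub_apply, smul_apply, smul_eq_mul]
    ring
  have p1 := h.weakPairing_nonneg hF hΦ hx ha hab hb hν.isOpen hν.subset hyU hzs hD h0
    (fun r hr hr' => (hzero r hr hr').le) (fun r hr hr' => hzero r hr (hend r hr'))
  have p2 := h.weakPairing_nonneg hF hΦ hx ha hab hb hν.isOpen hν.subset hyU hzs hD.neg
    (fun r hr hr' => by simp [h0 r hr hr'])
    (fun r hr hr' => by simp [hzero r hr hr'])
    (fun r hr hr' => by simp [hzero r hr (hend r hr')])
  rw [key2] at p1 p2
  have p3 := weakPairing_neg (fun s => tangentialForce (localG F φ) ν w (coordCurve φ x s)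
        (deriv (coordCurve φ x) s) e)
      (fun s => tangentialMomentum (localG F φ) ν w (coordCurve φ x s)
        (deriv (coordCurve φ x) s) e) a b τ
  have p4 : weakPairing (fun s => tangentialForce (localG F φ) ν w (coordCurve φ x s)
        (deriv (coordCurve φ x) s) e)
      (fun s => tangentialMomentum (localG F φ) ν w (coordCurve φ x s)
        (deriv (coordCurve φ x) s) e) a b (-τ) = _ := p3
  rw [p4] at p2
  linarith

/-- Tangential variations come from `tangential_eq_zero`, normal ones from the constant field `w`.
At contact `localPhi Φ φ` reaches its maximum `0` along the curve, which supplies the contact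
alternative. -/
theorem weakExtremal (h : InChart M φ x a b) (hF : IsFinslerMetric M F)
    (hΦ : ContDiffOn ℝ 2 Φ M) (hx : IsVCritical M F Φ x)
    (ha : 0 ≤ a) (hab : a < b) (hb : b ≤ 1) {J : Set ℝ} (hJ : Ioo a b ⊆ J)
    {U : Set (EuclideanSpace ℝ (Fin N))}
    {ν : EuclideanSpace ℝ (Fin N) → EuclideanSpace ℝ (Fin N) →L[ℝ] ℝ}
    {w : EuclideanSpace ℝ (Fin N)} (hν : Adapted Φ φ x J U ν w)
    (hyU : ∀ s ∈ Icc a b, coordCurve φ x s ∈ U) :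
    WeakExtremal U (localG F φ) ν w (coordCurve φ x) a b {s | Φ (x s) = 0} where
  lag := (h.slice.isLagrangian hF).mono hν.isOpen hν.subset
  lt := hab
  isH1On := h.isH1On hab.le (IsH1On.mono hx.1.1 zero_le_one hab.le ha hb)
  mem := hyU
  smooth := hν.smooth
  tangential e τ hτ h0 := h.tangential_eq_zero hF hΦ hx ha hab hb hν hyU e hτ
    (fun r _ hr => h0 r fun hr' => hr (Ioo_subset_Icc_self hr')) fun r _ hr =>
      h0 r fun hr' => hr (hJ hr')
  normal τ hτ h0 hle := by
    obtain ⟨D, hD⟩ := hτ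
    have p1 := h.weakPairing_nonneg hF hΦ hx ha hab hb hν.isOpen hν.subset hyU
      (z := fun _ => w) contDiffOn_const hD
      (fun r _ hr => h0 r fun hr' => hr (Ioo_subset_Icc_self hr')) (fun r hr hr' => by
        by_cases hr'' : r ∈ Ioo a b
        · obtain ⟨h1, c, hc, h2⟩ := hν.contact r (hJ hr'') hr'.2
          rw [h2, smul_apply, h1, smul_eq_mul, mul_one]
          exact mul_nonpos_of_nonpos_of_nonneg (hle r hr'' hr'.2) hc.le
        · rw [h0 r hr'', zero_mul]) (fun r hr hr' => by
        rw [h0 r, zero_mul]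
        rintro ⟨h1, h2⟩
        rcases hr' with rfl | rfl <;> linarith)
    simpa using p1
  contact s hs := by
    have hsI := Ioo_subset_Icc_self hs
    have hxc : ContinuousAt x s := (IsH1On.continuousOn hx.1.1 zero_le_one).continuousAt
      (Icc_mem_nhds (ha.trans_lt hs.1) (hs.2.trans_le hb))
    by_cases hs' : Φ (x s) = 0
    · right
      obtain ⟨h1, c, hc, h2⟩ := hν.contact s (hJ hs) hs'
      refine ⟨localPhi Φ φ, c, hc, fun e => by rw [e] at h1; simp at h1, ?_, ?_⟩
      · rw [← h2]
        exact (((h.slice.contDiffOn_defining hΦ).contDiffAt (isOpen_chartDomain.mem_nhds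
          (h.coord_mem hsI))).differentiableAt (by norm_num)).hasFDerivAt
      · filter_upwards [Icc_mem_nhds hs.1 hs.2] with r hr
        rw [h.localPhi_coord hr, h.localPhi_coord hsI, hs']
        exact (hx.1.2.1 r ⟨ha.trans hr.1, hr.2.trans hb⟩).2
    · left
      have h1 : ContinuousWithinAt (fun r => Φ (x r)) (Icc a b) s :=
        (hΦ.continuousOn _ (h.mem s hsI)).comp hxc.continuousWithinAt h.mem
      exact (h1.continuousAt (Icc_mem_nhds hs.1 hs.2)).eventually_ne hs'

end InChart

end Variations

/-! ### Velocities at the ends of an interval -/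

section Endpoints

/-- The interval is a neighbourhood of `s₀` relative to `[p, q]`, so that interior times and ends
are localized in the same way. -/
theorem exists_Icc_of_eventually {p q s₀ : ℝ} (hpq : p < q) (hs : s₀ ∈ Icc p q) {P : ℝ → Prop}
    (hP : ∀ᶠ s in 𝓝[Icc p q] s₀, P s) :
    ∃ a b, p ≤ a ∧ a < b ∧ b ≤ q ∧ s₀ ∈ Icc a b ∧ (s₀ = p ∨ a < s₀) ∧ (s₀ = q ∨ s₀ < b) ∧
      ∀ s ∈ Icc a b, P s := by
  obtain ⟨δ, hδ, H⟩ := Metric.mem_nhdsWithin_iff.1 hP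
  refine ⟨max p (s₀ - δ / 2), min q (s₀ + δ / 2), le_max_left _ _, ?_, min_le_left _ _,
    ⟨max_le hs.1 (by linarith), le_min hs.2 (by linarith)⟩, ?_, ?_, fun s hs' => H ⟨?_, ?_⟩⟩
  · rcases hs.1.eq_or_lt with rfl | h
    · rw [max_eq_left (by linarith)]
      exact lt_min hpq (by linarith)
    · refine (max_lt h (by linarith : s₀ - δ / 2 < s₀)).trans_le (le_min hs.2 (by linarith))
  · rcases hs.1.eq_or_lt with h | h
    · exact Or.inl h.symm
    · exact Or.inr (max_lt h (by linarith))
  · rcases hs.2.eq_or_lt with h | h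
    · exact Or.inl h
    · exact Or.inr (lt_min h (by linarith))
  · have h1 := (le_max_right _ _).trans hs'.1
    have h2 := hs'.2.trans (min_le_right _ _)
    rw [Metric.mem_ball, Real.dist_eq, abs_lt]
    constructor <;> linarith
  · exact ⟨(le_max_left _ _).trans hs'.1, hs'.2.trans (min_le_left _ _)⟩

theorem Icc_eventuallyEq {p q s₀ a b : ℝ} (hpa : p ≤ a) (hbq : b ≤ q) (hs : s₀ ∈ Icc a b)
    (h1 : s₀ = p ∨ a < s₀) (h2 : s₀ = q ∨ s₀ < b) : Icc a b =ᶠ[𝓝 s₀] Icc p q := by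
  have e1 : ∀ᶠ r in 𝓝 s₀, p ≤ r → a ≤ r := by
    rcases h1 with rfl | h1
    · exact Eventually.of_forall fun r hr => hs.1.trans hr
    · filter_upwards [Ioi_mem_nhds h1] with r hr _ using le_of_lt hr
  have e2 : ∀ᶠ r in 𝓝 s₀, r ≤ q → r ≤ b := by
    rcases h2 with rfl | h2
    · exact Eventually.of_forall fun r hr => hr.trans hs.2
    · filter_upwards [Iio_mem_nhds h2] with r hr _ using le_of_lt hr
  filter_upwards [e1, e2] with r hr1 hr2
  exact propext ⟨fun h => ⟨hpa.trans h.1, h.2.trans hbq⟩, fun h => ⟨hr1 h.1, hr2 h.2⟩⟩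

theorem hasDerivWithinAt_Icc_of_tendsto {V : Type*} [NormedAddCommGroup V] [NormedSpace ℝ V]
    {y : ℝ → V} {a b e : ℝ} {v : V} (hab : a < b) (he : e = a ∨ e = b)
    (hy : ContinuousOn y (Icc a b)) (hd : DifferentiableOn ℝ y (Ioo a b))
    (ht : Tendsto (deriv y) (𝓝[Ioo a b] e) (𝓝 v)) : HasDerivWithinAt y v (Icc a b) e := by
  rcases he with rfl | rfl
  · rw [nhdsWithin_Ioo_eq_nhdsGT hab] at ht
    exact (hasDerivWithinAt_Ici_of_tendsto_deriv hd
      ((hy e (left_mem_Icc.2 hab.le)).mono Ioo_subset_Icc_self) (Ioo_mem_nhdsGT hab) ht).mono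
      Icc_subset_Ici_self
  · rw [nhdsWithin_Ioo_eq_nhdsLT hab] at ht
    exact (hasDerivWithinAt_Iic_of_tendsto_deriv hd
      ((hy e (right_mem_Icc.2 hab.le)).mono Ioo_subset_Icc_self) (Ioo_mem_nhdsLT hab) ht).mono
      Icc_subset_Iic_self

theorem neBot_nhdsWithin_Ioo {a b e : ℝ} (hab : a < b) (he : e ∈ Icc a b) :
    (𝓝[Ioo a b] e).NeBot := by
  rw [← mem_closure_iff_nhdsWithin_neBot, closure_Ioo hab.ne]
  exact he

variable {V : Type*} [NormedAddCommGroup V] [NormedSpace ℝ V] [FiniteDimensional ℝ V]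
  {U : Set V} {L : V × V → ℝ} {ν : V → V →L[ℝ] ℝ} {w : V} {y : ℝ → V} {a b : ℝ} {K : Set ℝ}

/-- Constant energy and coercivity bound the velocity, hence the momentum, up to the ends of the
interval, where monotonicity alone would allow the multiplier to be unbounded. -/
theorem WeakExtremal.exists_multiplier_bound (h : WeakExtremal U L ν w y a b K) {E : ℝ}
    (hE : ∀ s ∈ Ioo a b, L (y s, deriv y s) = E) :
    ∃ C, ∀ s ∈ Ioo a b, |multiplier L w y a s| ≤ C := by
  obtain ⟨C, hC, H⟩ := h.exists_bound
  obtain ⟨c, hc, H'⟩ := h.lag.exists_coercive (isCompact_Icc.image_of_continuousOn h.continuousOn_curve)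
    (by rintro _ ⟨s, hs, rfl⟩; exact h.mem s hs)
  have h2 := intervalIntegral.continuousOn_primitive_interval' h.integrable_force left_mem_uIcc
  rw [uIcc_of_le h.lt.le] at h2
  obtain ⟨B, hB⟩ := isCompact_Icc.exists_bound_of_continuousOn h2
  refine ⟨C * (1 + E / c) * ‖w‖ + B, fun s hs => ?_⟩
  have hs' := Ioo_subset_Icc_self hs
  have h3 : ‖deriv y s‖ ≤ 1 + E / c := by
    refine (norm_le_one_add_sq _).trans ?_
    have := H' _ (mem_image_of_mem y hs') (deriv y s)
    rw [hE s hs] at this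
    gcongr
    rw [le_div_iff₀ hc]
    linarith
  rw [multiplier, residual]
  refine (abs_sub _ _).trans (add_le_add ?_ (hB s hs'))
  refine ((momentum L (y s) (deriv y s)).le_opNorm w).trans ?_
  gcongr
  exact (H s hs' _).1.trans (by gcongr)

/-- The velocity of a weak extremal of constant energy has a limit at the ends of the interval. -/
theorem WeakExtremal.exists_endpoint_velocity (h : WeakExtremal U L ν w y a b K) {c : V →L[ℝ] ℝ}
    (hc : ∀ s ∈ goodTimes L ν w y a b, momentum L (y s) (deriv y s) =
      regularMomentum L ν w y a c s + multiplier L w y a s • ν (y s)) {E : ℝ}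
    (hE : ∀ s ∈ Ioo a b, L (y s, deriv y s) = E) {e : ℝ} (he : e = a ∨ e = b) {κ : ℝ}
    (hκ : regularMomentum L ν w y a c e = κ • ν (y e)) :
    ∃ v₀, HasDerivWithinAt y v₀ (Icc a b) e ∧ (∃ κ' : ℝ, momentum L (y e) v₀ = κ' • ν (y e)) ∧
      L (y e, v₀) = E := by
  obtain ⟨C, hC⟩ := h.exists_multiplier_bound hE
  obtain ⟨m, hm, hreg, -⟩ := h.regularity hc le_rfl le_rfl h.lt fun s _ hs => hC s hs
  have heI : e ∈ Icc a b := by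
    rcases he with rfl | rfl
    exacts [left_mem_Icc.2 h.lt.le, right_mem_Icc.2 h.lt.le]
  have hne := neBot_nhdsWithin_Ioo h.lt heI
  -- `m` is monotone on the whole line, so its one-sided limits at `a` and `b` are finite.
  have hmt : ∃ m₀, Tendsto m (𝓝[Ioo a b] e) (𝓝 m₀) := by
    rcases he with rfl | rfl
    · rw [nhdsWithin_Ioo_eq_nhdsGT h.lt]; exact ⟨_, hm.tendsto_rightLim _⟩
    · rw [nhdsWithin_Ioo_eq_nhdsLT h.lt]; exact ⟨_, hm.tendsto_leftLim _⟩
  obtain ⟨m₀, hm₀⟩ := hmt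
  obtain ⟨v₀, hv₀, ht⟩ := h.lag.exists_tendsto_deriv h.continuousOn_curve h.mem
    (h.continuousOn_regularMomentum c) h.continuousOn_normal (fun r hr => (hreg r hr).2.2.2) heI
    le_rfl hm₀
  refine ⟨v₀, hasDerivWithinAt_Icc_of_tendsto h.lt he h.continuousOn_curve
    (fun s hs => (hreg s hs).1.differentiableWithinAt) ht, ⟨κ + m₀, ?_⟩, ?_⟩
  · rw [hv₀, hκ, add_smul]
  · have h1 : Tendsto (fun s => L (y s, deriv y s)) (𝓝[Ioo a b] e) (𝓝 (L (y e, v₀))) :=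
      (h.lag.hasFDerivAt (h.mem e heI) v₀).continuousAt.tendsto.comp
        (((h.continuousOn_curve e heI).mono Ioo_subset_Icc_self).tendsto.prodMk_nhds ht)
    refine tendsto_nhds_unique h1 ((tendsto_const_nhds (x := E)).congr' ?_)
    filter_upwards [self_mem_nhdsWithin] with s hs using (hE s hs).symm

end Endpoints

/-! ### Critical curves: localization, constant energy, behaviour at the ends. -/

section Curves

variable {E : Type*} [NormedAddCommGroup E] [NormedSpace ℝ E] [FiniteDimensional ℝ E] {N k : ℕ}
  {M : Set E} {F : E × E → ℝ} {Φ : E → ℝ}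
  {φ : OpenPartialHomeomorph E (EuclideanSpace ℝ (Fin N) × EuclideanSpace ℝ (Fin k))}
  {x : ℝ → E}

theorem IsVCritical.continuousOn (hx : IsVCritical M F Φ x) : ContinuousOn x (Icc 0 1) :=
  IsH1On.continuousOn hx.1.1 zero_le_one

theorem IsVCritical.mem (hx : IsVCritical M F Φ x) {s : ℝ} (hs : s ∈ Icc (0 : ℝ) 1) : x s ∈ M :=
  (hx.1.2.1 s hs).1

theorem IsVCritical.phi_nonpos (hx : IsVCritical M F Φ x) {s : ℝ} (hs : s ∈ Icc (0 : ℝ) 1) :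
    Φ (x s) ≤ 0 := (hx.1.2.1 s hs).2

theorem IsVCritical.continuousOn_phi (hx : IsVCritical M F Φ x) (hΦ : ContDiffOn ℝ 2 Φ M) :
    ContinuousOn (fun s => Φ (x s)) (Icc 0 1) :=
  hΦ.continuousOn.comp hx.continuousOn fun _ hs => hx.mem hs

open InChart WeakExtremal

/-- At a contact point pick `w` with `dΦ(w) > 0`; this persists nearby, and `ν = dΦ / dΦ(w)` is `C¹`
because `Φ` is `C²`. -/
theorem IsVCritical.exists_adapted (hx : IsVCritical M F Φ x) (hΦ : IsDiskDomain N M Φ)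
    (hφ : IsSliceChart M φ) {s₀ : ℝ} (hs₀ : s₀ ∈ Icc (0 : ℝ) 1) (hsrc : x s₀ ∈ φ.source) :
    ∃ U ν w, ∃ J ∈ 𝓝[Icc 0 1] s₀, Adapted Φ φ x J U ν w ∧
      ∀ s ∈ J, x s ∈ φ.source ∧ coordCurve φ x s ∈ U := by
  have hxs := hx.continuousOn s₀ hs₀
  have hJ : x ⁻¹' φ.source ∩ Icc 0 1 ∈ 𝓝[Icc 0 1] s₀ :=
    inter_mem (hxs (φ.open_source.mem_nhds hsrc)) self_mem_nhdsWithin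
  have hmem : ∀ s ∈ x ⁻¹' φ.source ∩ Icc 0 1, coordCurve φ x s ∈ chartDomain φ := fun s hs =>
    hφ.coord_mem hs.1 (hx.mem hs.2)
  have hu₀ := hmem s₀ ⟨hsrc, hs₀⟩
  have hp₀ : param φ (coordCurve φ x s₀) = x s₀ := hφ.param_coord hsrc (hx.mem hs₀)
  by_cases h0 : Φ (x s₀) = 0
  · obtain ⟨v, hv, hv0⟩ := hΦ.regular (x s₀) ⟨hx.mem hs₀, h0⟩
    rw [← hp₀] at hv hv0
    obtain ⟨ζ, rfl⟩ := hφ.exists_fderiv_param_eq hu₀ hv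
    rw [hφ.dPhi_param hΦ.contDiffOn hu₀] at hv0
    obtain ⟨w, hw⟩ : ∃ w, 0 < fderiv ℝ (localPhi Φ φ) (coordCurve φ x s₀) w := by
      rcases lt_or_gt_of_ne hv0 with h | h
      · exact ⟨-ζ, by rw [map_neg]; exact neg_pos.2 h⟩
      · exact ⟨ζ, h⟩
    have hdf : ContDiffOn ℝ 1 (fderiv ℝ (localPhi Φ φ)) (chartDomain φ) :=
      (hφ.contDiffOn_defining hΦ.contDiffOn).fderiv_of_isOpen isOpen_chartDomain (by norm_num)
    have hdfw : ContDiffOn ℝ 1 (fun u => fderiv ℝ (localPhi Φ φ) u w) (chartDomain φ) :=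
      hdf.clm_apply contDiffOn_const
    set U := chartDomain φ ∩ (fun u => fderiv ℝ (localPhi Φ φ) u w) ⁻¹' Ioi 0 with hU
    have hUo : IsOpen U := hdfw.continuousOn.isOpen_inter_preimage isOpen_chartDomain isOpen_Ioi
    have hyc : ContinuousWithinAt (coordCurve φ x) (Icc 0 1) s₀ :=
      ((hφ.contDiffAt_coord hsrc).continuousAt).comp_continuousWithinAt hxs
    refine ⟨U, fun u => (fderiv ℝ (localPhi Φ φ) u w)⁻¹ • fderiv ℝ (localPhi Φ φ) u, w,
      (x ⁻¹' φ.source ∩ Icc 0 1) ∩ coordCurve φ x ⁻¹' U,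
      inter_mem hJ (hyc (hUo.mem_nhds ⟨hu₀, hw⟩)), ⟨hUo, inter_subset_left, ?_, ?_⟩,
      fun s hs => ⟨hs.1.1, hs.2⟩⟩
    · exact ((hdfw.mono inter_subset_left).inv fun u hu => ne_of_gt hu.2).smul
        (hdf.mono inter_subset_left)
    · intro s hs _
      have hpos : 0 < fderiv ℝ (localPhi Φ φ) (coordCurve φ x s) w := hs.2.2
      refine ⟨?_, _, hpos, ?_⟩
      · rw [smul_apply, smul_eq_mul, inv_mul_cancel₀ hpos.ne']
      · rw [smul_smul, mul_inv_cancel₀ hpos.ne', one_smul]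
  -- Off contact the condition is vacuous, and `ν = 0`, `w = 0` will do.
  · refine ⟨chartDomain φ, fun _ => 0, 0, (x ⁻¹' φ.source ∩ Icc 0 1) ∩ {s | Φ (x s) ≠ 0},
      inter_mem hJ ((hx.continuousOn_phi hΦ.contDiffOn s₀ hs₀).eventually_ne h0),
      ⟨isOpen_chartDomain, Subset.rfl, contDiffOn_const, fun s hs h => (hs.2 h).elim⟩,
      fun s hs => ⟨hs.1.1, hmem s hs.1⟩⟩

/-- Around every time there is an interval on which the curve is a weak extremal in a chart. -/
theorem IsVCritical.exists_weakExtremal (hx : IsVCritical M F Φ x) (hM : IsSubmanifold N k M)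
    (hF : IsFinslerMetric M F) (hΦ : IsDiskDomain N M Φ) {s₀ : ℝ} (hs₀ : s₀ ∈ Icc (0 : ℝ) 1) :
    ∃ φ : OpenPartialHomeomorph E (EuclideanSpace ℝ (Fin N) × EuclideanSpace ℝ (Fin k)),
    ∃ U ν w a b, 0 ≤ a ∧ a < b ∧ b ≤ 1 ∧ s₀ ∈ Icc a b ∧ (s₀ = 0 ∨ a < s₀) ∧ (s₀ = 1 ∨ s₀ < b) ∧
      InChart M φ x a b ∧ Adapted Φ φ x (Icc a b) U ν w ∧ (∀ s ∈ Icc a b, coordCurve φ x s ∈ U) ∧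
      WeakExtremal U (localG F φ) ν w (coordCurve φ x) a b {s | Φ (x s) = 0} := by
  obtain ⟨φ, hsrc, hφ⟩ := hM (x s₀) (hx.mem hs₀)
  obtain ⟨U, ν, w, J, hJ, hA, hJ'⟩ := hx.exists_adapted hΦ hφ hs₀ hsrc
  obtain ⟨a, b, h1, h2, h3, h4, h5, h6, h7⟩ := exists_Icc_of_eventually zero_lt_one hs₀ hJ
  have hA' : Adapted Φ φ x (Icc a b) U ν w :=
    ⟨hA.isOpen, hA.subset, hA.smooth, fun s hs => hA.contact s (h7 s hs)⟩
  have hI : InChart M φ x a b := ⟨hφ, fun s hs => hx.mem ⟨h1.trans hs.1, hs.2.trans h3⟩,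
    fun s hs => (hJ' s (h7 s hs)).1⟩
  exact ⟨φ, U, ν, w, a, b, h1, h2, h3, h4, h5, h6, hI, hA', fun s hs => (hJ' s (h7 s hs)).2,
    hI.weakExtremal hF hΦ.contDiffOn hx h1 h2 h3 Ioo_subset_Icc_self hA' fun s hs =>
      (hJ' s (h7 s hs)).2⟩

/-- Between two good times on either side of `s₀` monotonicity bounds the multiplier by its values
at these times. This gives regularity and constant energy near `s₀` before any bound up to the ends
is known. -/
theorem IsVCritical.eventually_regular (hx : IsVCritical M F Φ x) (hM : IsSubmanifold N k M)
    (hF : IsFinslerMetric M F) (hΦ : IsDiskDomain N M Φ) {s₀ : ℝ} (hs₀ : s₀ ∈ Ioo (0 : ℝ) 1) :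
    ∀ᶠ s in 𝓝 s₀, DifferentiableAt ℝ x s ∧
      sqMetric F (x s₀, deriv x s₀) = sqMetric F (x s, deriv x s) := by
  obtain ⟨φ, U, ν, w, a, b, h1, h2, h3, h4, h5, h6, hI, hA, hyU, hW⟩ :=
    hx.exists_weakExtremal hM hF hΦ (Ioo_subset_Icc_self hs₀)
  replace h5 : a < s₀ := h5.resolve_left hs₀.1.ne'
  replace h6 : s₀ < b := h6.resolve_left hs₀.2.ne
  obtain ⟨c, hc⟩ := hW.exists_momentum_eq
  obtain ⟨a', ha', haa⟩ := hW.exists_goodTime h5 le_rfl h6.le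
  obtain ⟨b', hb', hbb⟩ := hW.exists_goodTime h6 h5.le le_rfl
  have hab' : a' < b' := haa.2.trans hbb.1
  have hmon := hW.monotoneOn_multiplier
  obtain ⟨m, hm, hreg, hE⟩ := hW.regularity hc haa.1.le hbb.2.le hab'
    (C := max |multiplier (localG F φ) w (coordCurve φ x) a a'|
      |multiplier (localG F φ) w (coordCurve φ x) a b'|) fun s hs hs' =>
      abs_le_max_abs_abs (hmon ha' hs hs'.1.le) (hmon hs hb' hs'.2.le)
  have hsub : Ioo a' b' ⊆ Ioo a b := Ioo_subset_Ioo haa.1.le hbb.2.le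
  have hG : ∀ s ∈ Ioo a' b', sqMetric F (x s, deriv x s)
      = localG F φ (coordCurve φ x s, deriv (coordCurve φ x) s) := fun s hs => by
    rw [hI.deriv_eq (hsub hs) (hreg s hs).1, localG_eq]
  filter_upwards [Ioo_mem_nhds haa.2 hbb.1] with s hs
  refine ⟨(hI.hasDerivAt (hsub hs) (hreg s hs).1.hasDerivAt).differentiableAt, ?_⟩
  rw [hG s hs, hG s₀ ⟨haa.2, hbb.1⟩]
  exact hE _ ⟨haa.2, hbb.1⟩ _ hs

theorem IsVCritical.differentiableAt (hx : IsVCritical M F Φ x) (hM : IsSubmanifold N k M)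
    (hF : IsFinslerMetric M F) (hΦ : IsDiskDomain N M Φ) {s : ℝ} (hs : s ∈ Ioo (0 : ℝ) 1) :
    DifferentiableAt ℝ x s := (hx.eventually_regular hM hF hΦ hs).self_of_nhds.1

theorem IsVCritical.deriv_mem (hx : IsVCritical M F Φ x) (hM : IsSubmanifold N k M)
    (hF : IsFinslerMetric M F) (hΦ : IsDiskDomain N M Φ) {s : ℝ} (hs : s ∈ Ioo (0 : ℝ) 1) :
    deriv x s ∈ tangentVectors M (x s) := by
  have h1 : HasDerivAt (fun t : ℝ => s + t) 1 0 := by simpa using (hasDerivAt_id (0 : ℝ)).const_add s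
  refine ⟨fun t => x (s + t), by simp, ?_, ?_⟩
  · have h2 : Tendsto (fun t : ℝ => s + t) (𝓝 0) (𝓝 s) := by simpa using h1.continuousAt.tendsto
    filter_upwards [h2 (Icc_mem_nhds hs.1 hs.2)] with t ht using hx.mem ht
  · have h2 := HasDerivAt.scomp_of_eq (0 : ℝ)
      (hx.differentiableAt hM hF hΦ hs).hasDerivAt h1 (by simp)
    rwa [one_smul] at h2

/-- The energy of a nonconstant critical curve is a positive constant. -/
theorem IsVCritical.exists_energy (hx : IsVCritical M F Φ x) (hM : IsSubmanifold N k M)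
    (hF : IsFinslerMetric M F) (hΦ : IsDiskDomain N M Φ)
    (hne : ¬ ∃ p, ∀ s ∈ Icc (0 : ℝ) 1, x s = p) :
    ∃ e > 0, ∀ s ∈ Ioo (0 : ℝ) 1, sqMetric F (x s, deriv x s) = e := by
  have hconst : ∀ s ∈ Ioo (0 : ℝ) 1, ∀ t ∈ Ioo (0 : ℝ) 1,
      sqMetric F (x s, deriv x s) = sqMetric F (x t, deriv x t) := fun s hs t ht =>
    isPreconnected_Ioo.induction₂
      (fun s t => sqMetric F (x s, deriv x s) = sqMetric F (x t, deriv x t))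
      (fun s hs => mem_nhdsWithin_of_mem_nhds
        ((hx.eventually_regular hM hF hΦ hs).mono fun _ h => h.2))
      (fun _ _ _ _ _ _ h1 h2 => h1.trans h2) (fun _ _ _ _ h => h.symm) hs ht
  have hpos : ∀ s ∈ Ioo (0 : ℝ) 1, deriv x s ≠ 0 → 0 < sqMetric F (x s, deriv x s) :=
    fun s hs h => pow_pos (hF.pos _ (hx.mem (Ioo_subset_Icc_self hs)) _
      (hx.deriv_mem hM hF hΦ hs) h) 2
  by_cases h0 : ∃ s ∈ Ioo (0 : ℝ) 1, deriv x s ≠ 0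
  · obtain ⟨s, hs, h0⟩ := h0
    exact ⟨_, hpos s hs h0, fun t ht => hconst t ht s hs⟩
  -- A velocity vanishing throughout `]0,1[` would integrate to a constant curve.
  · push Not at h0
    refine (hne ⟨x 0, fun s hs => ?_⟩).elim
    have h1 := (IsH1On.mono hx.1.1 zero_le_one hs.1 le_rfl hs.2).integral_deriv hs.1
    rw [intervalIntegral.integral_of_le hs.1, integral_Ioc_eq_integral_Ioo,
      setIntegral_congr_fun measurableSet_Ioo (g := fun _ => 0) fun r hr =>
        h0 r ⟨hr.1, hr.2.trans_le hs.2⟩, integral_zero] at h1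
    exact (sub_eq_zero.1 h1.symm)

/-- At its ends, a nonconstant critical curve leaves the boundary orthogonally. -/
theorem IsVCritical.exists_end_velocity (hx : IsVCritical M F Φ x) (hM : IsSubmanifold N k M)
    (hF : IsFinslerMetric M F) (hΦ : IsDiskDomain N M Φ) {κ : ℝ} (hκ : 0 < κ)
    (hE : ∀ s ∈ Ioo (0 : ℝ) 1, sqMetric F (x s, deriv x s) = κ) {s₀ : ℝ} (hs : s₀ = 0 ∨ s₀ = 1) :
    ∃ v, HasDerivWithinAt x v (Icc 0 1) s₀ ∧ OrthogonalToBdry M F Φ (x s₀) v ∧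
      ∀ᶠ r in 𝓝[Icc 0 1 \ {s₀}] s₀, Φ (x r) ≠ 0 := by
  have hs₀ : s₀ ∈ Icc (0 : ℝ) 1 := by rcases hs with rfl | rfl <;> simp
  obtain ⟨φ, U, ν, w, a, b, h1, h2, h3, h4, h5, h6, hI, hA, hyU, hW⟩ :=
    hx.exists_weakExtremal hM hF hΦ hs₀
  have hxb : Φ (x s₀) = 0 := by
    rcases hs with rfl | rfl
    exacts [hx.1.2.2.1.2, hx.1.2.2.2.2]
  have hEy : ∀ s ∈ Ioo a b, localG F φ (coordCurve φ x s, deriv (coordCurve φ x) s) = κ := by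
    intro s hs'
    have hs'' : s ∈ Ioo (0 : ℝ) 1 := ⟨h1.trans_lt hs'.1, hs'.2.trans_le h3⟩
    rw [localG_eq, ← hI.deriv_eq hs' (hI.differentiableAt_coord (Ioo_subset_Icc_self hs')
      (hx.differentiableAt hM hF hΦ hs'')), hE s hs'']
  have key : ∃ v₀, HasDerivWithinAt (coordCurve φ x) v₀ (Icc a b) s₀ ∧
      (∃ κ' : ℝ, momentum (localG F φ) (coordCurve φ x s₀) v₀ = κ' • ν (coordCurve φ x s₀)) ∧
      localG F φ (coordCurve φ x s₀, v₀) = κ := by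
    rcases hs with rfl | rfl
    -- With `c = 0` the regular part of the momentum vanishes at `a`.
    · have ha : (0 : ℝ) = a := le_antisymm h1 h4.1
      have hc := hW.momentum_eq_of_left_free fun e τ hτ h0 =>
        hI.tangential_eq_zero hF hΦ.contDiffOn hx h1 h2 h3 hA hyU e hτ
          (fun r hr hr' => h0 r (not_lt.1 fun h => hr' ⟨ha ▸ hr.1, h.le⟩))
          (fun r hr hr' => (hr' hr).elim)
      refine hW.exists_endpoint_velocity hc hEy (Or.inl ha) (κ := 0) ?_
      rw [regularMomentum, ← ha]
      simp
    · have hb : (1 : ℝ) = b := le_antisymm h4.2 h3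
      have hc := hW.momentum_eq_of_right_free fun e τ hτ h0 =>
        hI.tangential_eq_zero hF hΦ.contDiffOn hx h1 h2 h3 hA hyU e hτ
          (fun r hr hr' => h0 r (not_lt.1 fun h => hr' ⟨h.le, hb ▸ hr.2⟩))
          (fun r hr hr' => (hr' hr).elim)
      -- At `b` the constant `c` cancels the tangential integral, and the coefficient of `ν` left
      -- over is the integral of the normal force.
      refine hW.exists_endpoint_velocity hc hEy (Or.inr hb)
        (κ := ∫ r in a..b, force (localG F φ) (coordCurve φ x r) (deriv (coordCurve φ x) r) w) ?_
      rw [regularMomentum, hb, neg_add_cancel, zero_add]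
  obtain ⟨v₀, hv₀, ⟨κ', hκ'⟩, hL⟩ := key
  have hu₀ := hI.coord_mem h4
  have hev := Icc_eventuallyEq h1 h3 h4 h5 h6
  obtain ⟨hw, c, hc, hdf⟩ := hA.contact s₀ h4 hxb
  -- Euler's identity gives `κ' ν(v₀) = 2 κ > 0`: a nonzero orthogonal velocity is transversal to
  -- the boundary.
  have hνv : ν (coordCurve φ x s₀) v₀ ≠ 0 := by
    intro h0
    have := hW.lag.momentum_self (hyU s₀ h4) v₀
    rw [hκ', smul_apply, h0, hL] at this
    simp at this
    linarith
  refine ⟨fderiv ℝ (param φ) (coordCurve φ x s₀) v₀, ?_, ?_, ?_⟩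
  · have h7 : HasDerivWithinAt x (fderiv ℝ (param φ) (coordCurve φ x s₀) v₀) (Icc a b) s₀ :=
      ((hI.slice.hasFDerivAt_param hu₀).comp_hasDerivWithinAt s₀ hv₀).congr
        (fun r hr => (hI.param_coord hr).symm) (hI.param_coord h4).symm
    exact (hasDerivWithinAt_congr_set hev).1 h7
  · have := hI.slice.orthogonalToBdry hF hΦ.contDiffOn hu₀ (v := v₀) fun ξ hξ => by
      have hξ' : fderiv ℝ (localPhi Φ φ) (coordCurve φ x s₀) ξ = 0 := hξ
      rw [hdf, smul_apply, smul_eq_mul, mul_eq_zero] at hξ'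
      rw [hκ', smul_apply, hξ'.resolve_left hc.ne', smul_zero]
    rwa [hI.param_coord h4] at this
  · have h7 : HasDerivWithinAt (fun r => Φ (x r)) (c * ν (coordCurve φ x s₀) v₀) (Icc a b) s₀ := by
      have h8 : HasFDerivAt (localPhi Φ φ) (c • ν (coordCurve φ x s₀)) (coordCurve φ x s₀) := by
        rw [← hdf]
        exact (((hI.slice.contDiffOn_defining hΦ.contDiffOn).contDiffAt
          (isOpen_chartDomain.mem_nhds hu₀)).differentiableAt (by norm_num)).hasFDerivAt
      exact (h8.comp_hasDerivWithinAt s₀ hv₀).congr (fun r hr => (hI.localPhi_coord hr).symm)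
        (hI.localPhi_coord h4).symm
    exact ((hasDerivWithinAt_congr_set hev).1 h7).eventually_ne (mul_ne_zero hc.ne' hνv)

end Curves

/-! ### The Euler-Lagrange equation and the Chern connection -/

section Regular

/-- A Lagrangian which is smooth off the zero section, with positive definite Hessian in the
velocity. -/
structure IsRegularLagrangian {V : Type*} [NormedAddCommGroup V] [NormedSpace ℝ V] (U : Set V)
    (L : V × V → ℝ) : Prop extends IsLagrangian U L where
  contDiffAt_two : ∀ p : V × V, p.1 ∈ U → p.2 ≠ 0 → ContDiffAt ℝ 2 L p
  contDiffAt_momentum : ∀ p : V × V, p.1 ∈ U → p.2 ≠ 0 →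
    ContDiffAt ℝ 2 (fun q : V × V => momentum L q.1 q.2) p
  posDef : ∀ p : V × V, p.1 ∈ U → p.2 ≠ 0 → ∀ w : V, w ≠ 0 →
    0 < fderiv ℝ (fun q : V × V => momentum L q.1 q.2) p (0, w) w

variable {V : Type*} [NormedAddCommGroup V] [NormedSpace ℝ V] {U : Set V} {L : V × V → ℝ}

/-- The derivative of the momentum in the position and the velocity. -/
noncomputable def hess (L : V × V → ℝ) (p : V × V) : V × V →L[ℝ] V →L[ℝ] ℝ :=
  fderiv ℝ (fun q : V × V => momentum L q.1 q.2) p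

namespace IsRegularLagrangian

theorem eventually (h : IsRegularLagrangian U L) {p : V × V} (hp : p.1 ∈ U) (hp2 : p.2 ≠ 0) :
    ∀ᶠ q : V × V in 𝓝 p, q.1 ∈ U ∧ q.2 ≠ 0 := by
  filter_upwards [continuousAt_fst (h.isOpen.mem_nhds hp), continuousAt_snd.eventually_ne hp2]
    with q h1 h2 using ⟨h1, h2⟩

theorem hasFDerivAt_hess (h : IsRegularLagrangian U L) {p : V × V} (hp : p.1 ∈ U)
    (hp2 : p.2 ≠ 0) :
    HasFDerivAt (fun q : V × V => momentum L q.1 q.2) (hess L p) p :=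
  ((h.contDiffAt_momentum p hp hp2).differentiableAt (by norm_num)).hasFDerivAt

theorem hess_symm (h : IsRegularLagrangian U L) {p : V × V} (hp : p.1 ∈ U) (hp2 : p.2 ≠ 0)
    (ξ η : V) : hess L p (0, ξ) η = hess L p (0, η) ξ := by
  have h1 : HasFDerivAt (fderiv ℝ L) (fderiv ℝ (fderiv ℝ L) p) p :=
    (((h.contDiffAt_two p hp hp2).fderiv_right (m := 1) (by norm_num)).differentiableAt
      (by norm_num)).hasFDerivAt
  have h2 : ∀ X w, hess L p X w = fderiv ℝ (fderiv ℝ L) p X (0, w) := by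
    intro X w
    have h3 := (h.hasFDerivAt_hess hp hp2).clm_apply (hasFDerivAt_const w p)
    have h4 := h1.clm_apply (hasFDerivAt_const ((0 : V), w) p)
    have h5 := congrArg (fun l : V × V →L[ℝ] ℝ => l X) (h3.unique h4)
    simpa using h5
  rw [h2, h2]
  exact ((h.contDiffAt_two p hp hp2).isSymmSndFDerivAt (by simp)).eq _ _

/-- The derivative of Euler's identity `momentum(v) = 2 L`. -/
theorem hess_velocity (h : IsRegularLagrangian U L) {p : V × V} (hp : p.1 ∈ U) (hp2 : p.2 ≠ 0)
    (X : V × V) : hess L p X p.2 = 2 * force L p.1 p.2 X.1 + momentum L p.1 p.2 X.2 := by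
  have h1 := (h.hasFDerivAt_hess hp hp2).clm_apply (hasFDerivAt_snd (𝕜 := ℝ) (p := p))
  have h2 : HasFDerivAt (fun q : V × V => momentum L q.1 q.2 q.2) _ p :=
    ((h.hasFDerivAt hp p.2).const_mul 2).congr_of_eventuallyEq (by
      filter_upwards [h.eventually hp hp2] with q hq using h.momentum_self hq.1 q.2)
  have h3 := congrArg (fun l : V × V →L[ℝ] ℝ => l X) (h1.unique h2)
  have h4 : momentum L p.1 p.2 X.2 + hess L p X p.2 = 2 * fderiv ℝ L (p.1, p.2) (X.1, X.2) := h3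
  rw [fderiv_apply_eq] at h4
  linarith

theorem hasFDerivAt_fderiv_hess (h : IsRegularLagrangian U L) {p : V × V} (hp : p.1 ∈ U)
    (hp2 : p.2 ≠ 0) : HasFDerivAt (hess L) (fderiv ℝ (hess L) p) p :=
  (((h.contDiffAt_momentum p hp hp2).fderiv_right (m := 1) (by norm_num)).differentiableAt
    (by norm_num)).hasFDerivAt

theorem fderiv_hess_symm (h : IsRegularLagrangian U L) {p : V × V} (hp : p.1 ∈ U)
    (hp2 : p.2 ≠ 0) (X : V × V) (ξ η : V) :
    fderiv ℝ (hess L) p X (0, ξ) η = fderiv ℝ (hess L) p X (0, η) ξ := by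
  have h0 := h.hasFDerivAt_fderiv_hess hp hp2
  have h1 := fun ξ η : V => (h0.clm_apply (hasFDerivAt_const ((0 : V), ξ) p)).clm_apply
    (hasFDerivAt_const η p)
  have h2 := (h1 η ξ).congr_of_eventuallyEq (f₁ := fun q => hess L q (0, ξ) η) (by
    filter_upwards [h.eventually hp hp2] with q hq using h.hess_symm hq.1 hq.2 ξ η)
  have h3 := congrArg (fun l : V × V →L[ℝ] ℝ => l X) ((h1 ξ η).unique h2)
  simpa using h3

/-- The derivative of `hess (0, η) v = momentum η`. The velocity component of `X` drops out, which
says that the Cartan tensor is annihilated by the velocity. -/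
theorem fderiv_hess_velocity (h : IsRegularLagrangian U L) {p : V × V} (hp : p.1 ∈ U)
    (hp2 : p.2 ≠ 0) (X : V × V) (η : V) :
    fderiv ℝ (hess L) p X (0, η) p.2 = hess L p (X.1, 0) η := by
  have h0 := h.hasFDerivAt_fderiv_hess hp hp2
  have h1 := (h0.clm_apply (hasFDerivAt_const ((0 : V), η) p)).clm_apply
    (hasFDerivAt_snd (𝕜 := ℝ) (p := p))
  have h2 := ((h.hasFDerivAt_hess hp hp2).clm_apply
    (hasFDerivAt_const η p)).congr_of_eventuallyEq (f₁ := fun q => hess L q (0, η) q.2) (by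
    filter_upwards [h.eventually hp hp2] with q hq
    rw [h.hess_velocity hq.1 hq.2, map_zero]; simp)
  have h3 := congrArg (fun l : V × V →L[ℝ] ℝ => l X) (h1.unique h2)
  have h4 : hess L p (0, η) X.2 + fderiv ℝ (hess L) p X (0, η) p.2 = hess L p X η := by
    simpa using h3
  have h5 : hess L p X η = hess L p (X.1, 0) η + hess L p (0, X.2) η := by
    rw [← add_apply, ← map_add]; simp
  rw [h.hess_symm hp hp2] at h4
  linarith

/-- The Legendre transform is a local diffeomorphism, so the velocity is as regular as the
momentum. -/
theorem contDiffOn_velocity [FiniteDimensional ℝ V] (h : IsRegularLagrangian U L) {y D : ℝ → V}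
    {I : Set ℝ} (hyU : ∀ s ∈ I, y s ∈ U) (hD0 : ∀ s ∈ I, D s ≠ 0) (hD : ContinuousOn D I)
    (hy : ContDiffOn ℝ 1 y I) (hP : ContDiffOn ℝ 1 (fun s => momentum L (y s) (D s)) I) :
    ContDiffOn ℝ 1 D I := by
  have : CompleteSpace V := FiniteDimensional.complete ℝ V
  intro s hs
  set p : V × V := (y s, D s) with hp
  have hp1 : p.1 ∈ U := hyU s hs
  have hp2 : p.2 ≠ 0 := hD0 s hs
  set Ψ : V × V → V × (V →L[ℝ] ℝ) := fun q => (q.1, momentum L q.1 q.2) with hΨ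
  have hΨs : ContDiffAt ℝ 2 Ψ p := contDiffAt_fst.prodMk (h.contDiffAt_momentum p hp1 hp2)
  set A : V × V →L[ℝ] V × (V →L[ℝ] ℝ) := (ContinuousLinearMap.fst ℝ V V).prod (hess L p) with hA
  have hΨd : HasFDerivAt Ψ A p := hasFDerivAt_fst.prodMk (h.hasFDerivAt_hess hp1 hp2)
  -- The differential of the Legendre map is block triangular with the positive definite Hessian as
  -- its diagonal block, hence invertible in finite dimension.
  have hinj : Function.Injective A := by
    rw [injective_iff_map_eq_zero]
    rintro ⟨ξ, η⟩ hq
    have h1 : ξ = 0 := congrArg Prod.fst hq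
    have h2 : hess L p (ξ, η) = 0 := congrArg Prod.snd hq
    subst h1
    by_contra hne
    have hη : η ≠ 0 := fun e => hne (by rw [e]; rfl)
    have := h.posDef p hp1 hp2 η hη
    rw [← hess, h2] at this
    simp at this
  have hdim : Module.finrank ℝ (V × V) = Module.finrank ℝ (V × (V →L[ℝ] ℝ)) := by
    rw [Module.finrank_prod, Module.finrank_prod,
      ← (LinearMap.toContinuousLinearMap (𝕜 := ℝ) (E := V) (F' := ℝ)).finrank_eq]
    congr 1
    exact (Subspace.dual_finrank_eq (K := ℝ) (V := V)).symm
  set A' : (V × V) ≃L[ℝ] V × (V →L[ℝ] ℝ) :=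
    (LinearMap.linearEquivOfInjective (A : V × V →ₗ[ℝ] V × (V →L[ℝ] ℝ)) hinj
      hdim).toContinuousLinearEquiv with hA'
  have hAA : (A' : V × V →L[ℝ] V × (V →L[ℝ] ℝ)) = A := by ext q <;> rfl
  have hΨd' : HasFDerivAt Ψ (A' : V × V →L[ℝ] V × (V →L[ℝ] ℝ)) p := hAA ▸ hΨd
  have hinv := (hΨs.to_localInverse hΨd' (by norm_num)).of_le (m := 1) (by norm_num)
  have hleft : ∀ᶠ q in 𝓝 p, hΨs.localInverse hΨd' (by norm_num) (Ψ q) = q :=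
    (hΨs.hasStrictFDerivAt' hΨd' (by norm_num)).eventually_left_inverse
  have hcont : Tendsto (fun r => (y r, D r)) (𝓝[I] s) (𝓝 p) :=
    ((hy.continuousOn s hs).tendsto).prodMk_nhds (hD s hs)
  have h1 : ContDiffWithinAt ℝ 1 (fun r => (y r, momentum L (y r) (D r))) I s :=
    (hy s hs).prodMk (hP s hs)
  -- By continuity of `D` the pair `(y, D)` stays where the local inverse is a left inverse, so `D`
  -- is the second component of the local inverse applied to position and momentum.
  have h2 : ContDiffWithinAt ℝ 1 (fun r => (hΨs.localInverse hΨd' (by norm_num)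
      (y r, momentum L (y r) (D r))).2) I s :=
    (ContDiffAt.comp_contDiffWithinAt s hinv h1).snd
  refine h2.congr_of_eventuallyEq ?_ ?_
  · filter_upwards [hcont hleft] with r hr
    exact (congrArg Prod.snd hr).symm
  · exact (congrArg Prod.snd hleft.self_of_nhds).symm

end IsRegularLagrangian

end Regular

/-! ### The Chern connection in coordinates. -/

section Chern

variable {N : ℕ} {U : Set (EuclideanSpace ℝ (Fin N))}
  {L : EuclideanSpace ℝ (Fin N) × EuclideanSpace ℝ (Fin N) → ℝ}

theorem sum_apply_single (l : EuclideanSpace ℝ (Fin N) →L[ℝ] ℝ) (v : EuclideanSpace ℝ (Fin N)) :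
    ∑ i, l (EuclideanSpace.single i 1) * v i = l v := by
  have h1 : v = ∑ i, v i • EuclideanSpace.single i (1 : ℝ) := by
    have := (EuclideanSpace.basisFun (Fin N) ℝ).sum_repr v
    simpa using this.symm
  conv_rhs => rw [h1]
  rw [map_sum]
  exact Finset.sum_congr rfl fun i _ => by rw [map_smul, smul_eq_mul, mul_comm]

namespace IsRegularLagrangian

variable {p : EuclideanSpace ℝ (Fin N) × EuclideanSpace ℝ (Fin N)}

theorem fderiv_dv (h : IsRegularLagrangian U L) (hp : p.1 ∈ U) (hp2 : p.2 ≠ 0) (l : Fin N)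
    (X : EuclideanSpace ℝ (Fin N) × EuclideanSpace ℝ (Fin N)) :
    fderiv ℝ (dv l L) p X = hess L p X (EuclideanSpace.single l 1) := by
  have h1 := (h.hasFDerivAt_hess hp hp2).clm_apply
    (hasFDerivAt_const (EuclideanSpace.single l (1 : ℝ)) p)
  have h2 : HasFDerivAt (dv l L) _ p := h1
  rw [h2.fderiv]
  simp

theorem gLow_eq (h : IsRegularLagrangian U L) (hp : p.1 ∈ U) (hp2 : p.2 ≠ 0) (i j : Fin N) :
    gLow L i j p
      = 1 / 2 * hess L p (0, EuclideanSpace.single i 1) (EuclideanSpace.single j 1) := by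
  rw [gLow, dv, h.fderiv_dv hp hp2]

theorem fderiv_gLow (h : IsRegularLagrangian U L) (hp : p.1 ∈ U) (hp2 : p.2 ≠ 0) (i j : Fin N)
    (X : EuclideanSpace ℝ (Fin N) × EuclideanSpace ℝ (Fin N)) :
    fderiv ℝ (gLow L i j) p X = 1 / 2 * fderiv ℝ (hess L) p X (0, EuclideanSpace.single i 1)
      (EuclideanSpace.single j 1) := by
  have h1 := (((h.hasFDerivAt_fderiv_hess hp hp2).clm_apply
    (hasFDerivAt_const ((0 : EuclideanSpace ℝ (Fin N)), EuclideanSpace.single i (1 : ℝ))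
      p)).clm_apply (hasFDerivAt_const (EuclideanSpace.single j (1 : ℝ)) p)).const_mul (1 / 2)
  have h2 := h1.congr_of_eventuallyEq (f₁ := gLow L i j) (by
    filter_upwards [h.eventually hp hp2] with q hq using h.gLow_eq hq.1 hq.2 i j)
  rw [h2.fderiv]
  simp

theorem horizontalDeriv_eq (f : EuclideanSpace ℝ (Fin N) × EuclideanSpace ℝ (Fin N) → ℝ)
    (j : Fin N) : horizontalDeriv L j f p = fderiv ℝ f p (EuclideanSpace.single j 1,
      - ∑ m, dv j (spray L m) p • EuclideanSpace.single m (1 : ℝ)) := by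
  have h1 : fderiv ℝ f p (EuclideanSpace.single j 1,
      - ∑ m, dv j (spray L m) p • EuclideanSpace.single m (1 : ℝ))
      = fderiv ℝ f p (EuclideanSpace.single j 1, 0) + ((fderiv ℝ f p).comp
        (ContinuousLinearMap.inr ℝ _ _))
        (- ∑ m, dv j (spray L m) p • EuclideanSpace.single m (1 : ℝ)) := by
    rw [ContinuousLinearMap.comp_apply, ContinuousLinearMap.inr_apply, ← map_add]
    simp
  rw [h1, map_neg, map_sum, horizontalDeriv, sub_eq_add_neg]
  congr 2
  exact Finset.sum_congr rfl fun m _ => by rw [map_smul, smul_eq_mul]; rfl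

/-- The contraction of the Chern connection with the velocity. -/
theorem sum_chern (h : IsRegularLagrangian U L) (hp : p.1 ∈ U) (hp2 : p.2 ≠ 0) (i : Fin N) :
    ∑ j, ∑ l, chern L i j l p * p.2 j * p.2 l = 1 / 2 * ∑ m, gUp L i m p *
      (hess L p (p.2, 0) (EuclideanSpace.single m 1)
        - force L p.1 p.2 (EuclideanSpace.single m 1)) := by
  set v := p.2 with hv
  set e : Fin N → EuclideanSpace ℝ (Fin N) := fun i => EuclideanSpace.single i 1 with he
  set H : Fin N → EuclideanSpace ℝ (Fin N) × EuclideanSpace ℝ (Fin N) := fun j =>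
    (e j, - ∑ m, dv j (spray L m) p • e m) with hH
  set T := fderiv ℝ (hess L) p with hT
  have hδ : ∀ j m l, horizontalDeriv L j (gLow L m l) p = 1 / 2 * T (H j) (0, e m) (e l) :=
    fun j m l => by rw [horizontalDeriv_eq, h.fderiv_gLow hp hp2]
  -- Contraction with the velocity removes the vertical part of the horizontal vector `H j`, so the
  -- coefficients of the nonlinear connection never have to be computed.
  have hT1 : ∀ j m, ∑ l, T (H j) (0, e m) (e l) * v l = hess L p (e j, 0) (e m) := fun j m => by
    rw [sum_apply_single (T (H j) (0, e m)), h.fderiv_hess_velocity hp hp2]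
  have hT2 : ∀ w, ∑ j, hess L p (e j, 0) w * v j = hess L p (v, 0) w := fun w => by
    have := sum_apply_single (((hess L p).comp (ContinuousLinearMap.inl ℝ _ _)).flip w) v
    simpa using this
  have hsum : ∀ m, ∑ j, ∑ l, (horizontalDeriv L j (gLow L m l) p
      + horizontalDeriv L l (gLow L j m) p - horizontalDeriv L m (gLow L j l) p) * v j * v l
      = hess L p (v, 0) (e m) - force L p.1 p.2 (e m) := by
    intro m
    have s1 : ∑ j, ∑ l, T (H j) (0, e m) (e l) * v j * v l = hess L p (v, 0) (e m) := by
      rw [← hT2]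
      refine Finset.sum_congr rfl fun j _ => ?_
      rw [← hT1, Finset.sum_mul]
      exact Finset.sum_congr rfl fun l _ => by ring
    have s2 : ∑ j, ∑ l, T (H l) (0, e j) (e m) * v j * v l = hess L p (v, 0) (e m) := by
      rw [← s1, Finset.sum_comm]
      refine Finset.sum_congr rfl fun j _ => Finset.sum_congr rfl fun l _ => ?_
      rw [hT, h.fderiv_hess_symm hp hp2]; ring
    -- Two contractions with the velocity leave the mixed Hessian on `v`, which Euler's identity
    -- turns into twice the force.
    have s3 : ∑ j, ∑ l, T (H m) (0, e j) (e l) * v j * v l = 2 * force L p.1 p.2 (e m) := by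
      have := h.hess_velocity hp hp2 (e m, 0)
      rw [map_zero, add_zero] at this
      rw [← this, ← sum_apply_single (hess L p (e m, 0)) p.2]
      refine Finset.sum_congr rfl fun j _ => ?_
      rw [← hT1, Finset.sum_mul]
      exact Finset.sum_congr rfl fun l _ => by ring
    have s4 : ∀ j l, (horizontalDeriv L j (gLow L m l) p
      + horizontalDeriv L l (gLow L j m) p - horizontalDeriv L m (gLow L j l) p) * v j * v l
      = 1 / 2 * (T (H j) (0, e m) (e l) * v j * v l) + 1 / 2 * (T (H l) (0, e j) (e m) * v j * v l)
        - 1 / 2 * (T (H m) (0, e j) (e l) * v j * v l) := fun j l => by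
      rw [hδ, hδ, hδ]; ring
    simp only [s4, Finset.sum_sub_distrib, Finset.sum_add_distrib, ← Finset.mul_sum]
    rw [s1, s2, s3]
    ring
  have c1 : ∀ j l, chern L i j l p * v j * v l = ∑ m, 1 / 2 * (gUp L i m p *
      ((horizontalDeriv L j (gLow L m l) p
      + horizontalDeriv L l (gLow L j m) p - horizontalDeriv L m (gLow L j l) p) * v j * v l)) := by
    intro j l
    rw [chern, Finset.mul_sum, Finset.sum_mul, Finset.sum_mul]
    exact Finset.sum_congr rfl fun m _ => by ring
  simp only [c1]
  rw [Finset.mul_sum]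
  calc _ = ∑ j, ∑ m, ∑ l, 1 / 2 * (gUp L i m p * ((horizontalDeriv L j (gLow L m l) p
      + horizontalDeriv L l (gLow L j m) p - horizontalDeriv L m (gLow L j l) p) * v j * v l)) :=
        Finset.sum_congr rfl fun j _ => Finset.sum_comm
    _ = ∑ m, ∑ j, ∑ l, 1 / 2 * (gUp L i m p * ((horizontalDeriv L j (gLow L m l) p
      + horizontalDeriv L l (gLow L j m) p - horizontalDeriv L m (gLow L j l) p) * v j * v l)) :=
        Finset.sum_comm
    _ = _ := Finset.sum_congr rfl fun m _ => by
      rw [← hsum m]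
      simp only [Finset.mul_sum]

/-- The Euler-Lagrange equation is the geodesic equation of the Chern connection. -/
theorem geodesic_equation (h : IsRegularLagrangian U L) (hp : p.1 ∈ U) (hp2 : p.2 ≠ 0)
    {a : EuclideanSpace ℝ (Fin N)} (ha : hess L p (p.2, a) = force L p.1 p.2) (i : Fin N) :
    a i + ∑ j, ∑ l, chern L i j l p * p.2 j * p.2 l = 0 := by
  set A : Matrix (Fin N) (Fin N) ℝ := Matrix.of fun a b => gLow L a b p with hA
  have hmul : ∀ b : EuclideanSpace ℝ (Fin N), ∀ m,
      (A.mulVec fun l => b l) m = 1 / 2 * hess L p (0, b) (EuclideanSpace.single m 1) := by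
    intro b m
    have : ∀ l, A m l * b l
        = 1 / 2 * (hess L p (0, EuclideanSpace.single m 1) (EuclideanSpace.single l 1) * b l) :=
      fun l => by rw [hA, Matrix.of_apply, h.gLow_eq hp hp2]; ring
    rw [Matrix.mulVec, dotProduct]
    simp only [this]
    rw [← Finset.mul_sum, sum_apply_single, h.hess_symm hp hp2]
  have hdet : IsUnit A.det := by
    rw [isUnit_iff_ne_zero]
    intro h0
    obtain ⟨b, hb, hb0⟩ := Matrix.exists_mulVec_eq_zero_iff.2 h0
    have h1 := h.posDef p hp hp2 (WithLp.toLp 2 b) (fun e => hb (by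
      ext l; exact congrArg (fun w : EuclideanSpace ℝ (Fin N) => w l) e))
    rw [← hess, ← sum_apply_single] at h1
    refine h1.ne' (Finset.sum_eq_zero fun m _ => ?_)
    have h2 := hmul (WithLp.toLp 2 b) m
    have h3 : (A.mulVec fun l => (WithLp.toLp 2 b : EuclideanSpace ℝ (Fin N)) l) m = 0 :=
      congrFun hb0 m
    rw [h3] at h2
    rw [show hess L p (0, WithLp.toLp 2 b) (EuclideanSpace.single m 1) = 0 by linarith, zero_mul]
  -- The velocity Hessian is twice the matrix `g_ij`, hence the factor `-2`, which cancels the `1 /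
  -- 2` in `sum_chern`.
  have hEL : ∀ m, hess L p (p.2, 0) (EuclideanSpace.single m 1)
        - force L p.1 p.2 (EuclideanSpace.single m 1) = -2 * (A.mulVec fun l => a l) m := by
    intro m
    have h1 : hess L p (p.2, a) (EuclideanSpace.single m 1) = hess L p (p.2, 0)
        (EuclideanSpace.single m 1) + hess L p (0, a) (EuclideanSpace.single m 1) := by
      rw [← add_apply, ← map_add]; simp
    rw [hmul, ← ha, h1]; ring
  rw [h.sum_chern hp hp2]
  simp only [hEL]
  have h2 : ∑ m, gUp L i m p * (-2 * (A.mulVec fun l => a l) m)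
      = -2 * (A⁻¹.mulVec (A.mulVec fun l => a l)) i := by
    rw [Matrix.mulVec, dotProduct, Finset.mul_sum]
    exact Finset.sum_congr rfl fun m _ => by rw [gUp]; ring
  rw [h2, Matrix.mulVec_mulVec, Matrix.nonsing_inv_mul A hdet, Matrix.one_mulVec]
  ring

end IsRegularLagrangian

end Chern

theorem IsSliceChart.isRegularLagrangian {E : Type*} [NormedAddCommGroup E] [NormedSpace ℝ E]
    {N k : ℕ} {M : Set E} {F : E × E → ℝ}
    {φ : OpenPartialHomeomorph E (EuclideanSpace ℝ (Fin N) × EuclideanSpace ℝ (Fin k))}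
    (hφ : IsSliceChart M φ) (hF : IsFinslerMetric M F) :
    IsRegularLagrangian (chartDomain φ) (localG F φ) where
  toIsLagrangian := hφ.isLagrangian hF
  contDiffAt_two _ := hφ.contDiffAt_localG hF
  contDiffAt_momentum _ := hφ.contDiffAt_momentum_localG hF
  posDef p hp hp2 w hw := by
    have h1 := hF.posDef _ (hφ.param_mem hp) _ (hφ.fderiv_param_mem hp p.2)
      (hφ.fderiv_param_ne_zero hp hp2) _ (hφ.fderiv_param_mem hp w)
      (hφ.fderiv_param_ne_zero hp hw)
    rw [hφ.fundamentalTensor_param hF hp hp2] at h1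
    have h2 : HasFDerivAt (fun q : EuclideanSpace ℝ (Fin N) × EuclideanSpace ℝ (Fin N) =>
        momentum (localG F φ) q.1 q.2) _ (p.1, p.2) :=
      ((hφ.contDiffAt_momentum_localG hF hp hp2).differentiableAt (by norm_num)).hasFDerivAt
    have h3 : HasFDerivAt (fun v' => momentum (localG F φ) p.1 v') _ p.2 :=
      h2.comp p.2 (hasFDerivAt_prodMk_right p.1 p.2)
    rw [h3.fderiv] at h1
    have h4 : (0 : ℝ) < 1 / 2 * fderiv ℝ (fun q : EuclideanSpace ℝ (Fin N) ×
      EuclideanSpace ℝ (Fin N) => momentum (localG F φ) q.1 q.2) p (0, w) w := h1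
    linarith

/-! ### Geodesics -/

theorem contDiffOn_succ_of_hasDerivWithinAt {V : Type*} [NormedAddCommGroup V] [NormedSpace ℝ V]
    {f f' : ℝ → V} {a b : ℝ} (hab : a < b) {n : ℕ}
    (h : ∀ s ∈ Icc a b, HasDerivWithinAt f (f' s) (Icc a b) s) (h' : ContDiffOn ℝ n f' (Icc a b)) :
    ContDiffOn ℝ (n + 1) f (Icc a b) := by
  rw [contDiffOn_succ_iff_derivWithin (uniqueDiffOn_Icc hab)]
  refine ⟨fun s hs => (h s hs).differentiableWithinAt, by simp, h'.congr fun s hs => ?_⟩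
  exact (h s hs).derivWithin (uniqueDiffOn_Icc hab s hs)

section Curves

variable {E : Type*} [NormedAddCommGroup E] [NormedSpace ℝ E] [FiniteDimensional ℝ E] {N k : ℕ}
  {M : Set E} {F : E × E → ℝ} {Φ : E → ℝ}
  {φ : OpenPartialHomeomorph E (EuclideanSpace ℝ (Fin N) × EuclideanSpace ℝ (Fin k))}
  {x : ℝ → E} {a b : ℝ}

open InChart WeakExtremal

/-- While there is no contact, a critical curve satisfies the Euler-Lagrange equation. -/
theorem InChart.exists_velocity (h : InChart M φ x a b) (hF : IsFinslerMetric M F)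
    (hΦ : ContDiffOn ℝ 2 Φ M) (hx : IsVCritical M F Φ x) (ha : 0 ≤ a) (hab : a < b) (hb : b ≤ 1)
    (hfree : ∀ s ∈ Ioo a b, Φ (x s) ≠ 0) :
    ∃ D : ℝ → EuclideanSpace ℝ (Fin N), ContinuousOn D (Icc a b) ∧
      (∀ s ∈ Icc a b, HasDerivWithinAt (coordCurve φ x) (D s) (Icc a b) s) ∧
      ∀ s ∈ Icc a b, HasDerivWithinAt (fun r => momentum (localG F φ) (coordCurve φ x r) (D r))
        (force (localG F φ) (coordCurve φ x s) (D s)) (Icc a b) s := by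
  set y := coordCurve φ x with hy
  set L := localG F φ with hL
  -- Without contact the choice `ν = 0`, `w = 0` makes the multiplier zero and the tangential
  -- conditions the full Euler-Lagrange equation. The ends may be contact times, since only the open
  -- interval matters.
  have hA : Adapted Φ φ x (Ioo a b) (chartDomain φ) (fun _ => 0) 0 :=
    ⟨isOpen_chartDomain, Subset.rfl, contDiffOn_const, fun s hs h0 => (hfree s hs h0).elim⟩
  have hW := h.weakExtremal hF hΦ hx ha hab hb Subset.rfl hA fun s hs => h.coord_mem hs
  obtain ⟨c, hc⟩ := hW.exists_momentum_eq
  obtain ⟨m, hm, hreg, -⟩ := hW.regularity hc le_rfl le_rfl hab (C := 0) fun s _ _ => by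
    simp [multiplier, residual]
  set Q := regularMomentum L (fun _ => 0) 0 y a c with hQ
  have hyc := hW.continuousOn_curve
  have hQc : ContinuousOn Q (Icc a b) := hW.continuousOn_regularMomentum c
  have hv : ∀ s ∈ Icc a b, ∃ v, momentum L (y s) v = Q s ∧ HasDerivWithinAt y v (Icc a b) s := by
    intro s hs
    have := neBot_nhdsWithin_Ioo hab hs
    obtain ⟨v, hv, ht⟩ := hW.lag.exists_tendsto_deriv hyc hW.mem hQc
      (continuousOn_const (c := (0 : EuclideanSpace ℝ (Fin N) →L[ℝ] ℝ))) (m := fun _ => 0)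
      (fun r hr => by rw [(hreg r hr).2.2.2]; simp [hQ, hL]) hs le_rfl
      (tendsto_const_nhds (x := (0 : ℝ)))
    refine ⟨v, by rw [hv]; simp, ?_⟩
    by_cases hs' : s ∈ Ioo a b
    · have e : v = deriv y s := tendsto_nhds_unique ht
        ((hreg s hs').2.1.tendsto.mono_left nhdsWithin_le_nhds)
      rw [e]
      exact (hreg s hs').1.hasDerivAt.hasDerivWithinAt
    · refine hasDerivWithinAt_Icc_of_tendsto hab ?_ hyc
        (fun r hr => (hreg r hr).1.differentiableWithinAt) ht
      by_contra! hne
      exact hs' ⟨lt_of_le_of_ne hs.1 (Ne.symm hne.1), lt_of_le_of_ne hs.2 hne.2⟩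
  choose! D hD1 hD2 using hv
  have hDc : ContinuousOn D (Icc a b) := by
    intro s hs
    have : (𝓝[Icc a b] s).NeBot := mem_closure_iff_nhdsWithin_neBot.1 (subset_closure hs)
    obtain ⟨v, hv, ht⟩ := hW.lag.exists_tendsto_of_momentum (v := D) (hW.mem s hs)
      (hyc s hs).tendsto (P := Q s) ((hQc s hs).tendsto.congr' (by
        filter_upwards [self_mem_nhdsWithin] with r hr using (hD1 r hr).symm))
    rw [← hD1 s hs] at hv
    have e : v = D s := hW.lag.momentum_injective (hW.mem s hs) hv
    rw [e] at ht
    exact ht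
  have hDd : ∀ s ∈ Ioo a b, deriv y s = D s := fun s hs =>
    ((hD2 s (Ioo_subset_Icc_self hs)).hasDerivAt (Icc_mem_nhds hs.1 hs.2)).deriv
  set g : ℝ → EuclideanSpace ℝ (Fin N) →L[ℝ] ℝ := fun s => force L (y s) (D s) with hg
  have hgc : ContinuousOn g (Icc a b) := fun s hs =>
    (hW.lag.continuousAt_force (hW.mem s hs) (D s)).comp_continuousWithinAt
      (f := fun r => (y r, D r)) ((hyc s hs).prodMk (hDc s hs))
  have hQg : ∀ s ∈ Icc a b, Q s = c + ∫ r in a..s, g r := by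
    intro s hs
    rw [hQ, regularMomentum, smul_zero, add_zero]
    congr 1
    rw [intervalIntegral.integral_of_le hs.1, intervalIntegral.integral_of_le hs.1,
      integral_Ioc_eq_integral_Ioo, integral_Ioc_eq_integral_Ioo]
    refine setIntegral_congr_fun measurableSet_Ioo fun r hr => ?_
    have hr' : r ∈ Ioo a b := ⟨hr.1, hr.2.trans_le hs.2⟩
    rw [hDd r hr', tangentialForce]
    simp [hg]
  refine ⟨D, hDc, hD2, fun s hs => ?_⟩
  have : Fact (s ∈ Icc a b) := ⟨hs⟩
  have h1 : HasDerivWithinAt (fun u => ∫ r in a..u, g r) (g s) (Icc a b) s :=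
    intervalIntegral.integral_hasDerivWithinAt_right
      ((hgc.mono (Icc_subset_Icc le_rfl hs.2)).intervalIntegrable_of_Icc hs.1)
      (hgc.stronglyMeasurableAtFilter_nhdsWithin measurableSet_Icc s) (hgc s hs)
  exact (h1.const_add c).congr (fun r hr => by rw [hD1 r hr, hQg r hr])
    (by rw [hD1 s hs, hQg s hs])

/-- Bootstrap: a continuous velocity makes the force continuous, so the momentum is `C¹`. Positive
energy keeps the velocity off the zero section, where the Legendre map can be inverted smoothly, so
the velocity is `C¹` too and the Euler-Lagrange equation can be expanded. -/
theorem InChart.geodesic_equation (h : InChart M φ x a b) (hF : IsFinslerMetric M F)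
    (hΦ : IsDiskDomain N M Φ)
    (hx : IsVCritical M F Φ x) (ha : 0 ≤ a) (hab : a < b) (hb : b ≤ 1)
    (hfree : ∀ s ∈ Ioo a b, Φ (x s) ≠ 0) {κ : ℝ} (hκ : 0 < κ)
    (hE : ∀ s ∈ Ioo (0 : ℝ) 1, sqMetric F (x s, deriv x s) = κ) :
    ContDiffOn ℝ 2 (coordCurve φ x) (Icc a b) ∧ ∀ s ∈ Icc a b,
      derivWithin (coordCurve φ x) (Icc a b) s ≠ 0 ∧ ∀ i,
      derivWithin (derivWithin (coordCurve φ x) (Icc a b)) (Icc a b) s i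
        + ∑ j, ∑ l, chern (localG F φ) i j l
            (coordCurve φ x s, derivWithin (coordCurve φ x) (Icc a b) s)
          * derivWithin (coordCurve φ x) (Icc a b) s j
          * derivWithin (coordCurve φ x) (Icc a b) s l = 0 := by
  obtain ⟨D, hDc, hD, hP⟩ := h.exists_velocity hF hΦ.contDiffOn hx ha hab hb hfree
  set y := coordCurve φ x with hy
  have hL := h.slice.isRegularLagrangian hF
  have huniq := uniqueDiffOn_Icc hab
  have hyU : ∀ s ∈ Icc a b, y s ∈ chartDomain φ := fun s hs => h.coord_mem hs
  have hyc : ContinuousOn y (Icc a b) := fun s hs => (hD s hs).continuousWithinAt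
  have hEy : ∀ s ∈ Icc a b, localG F φ (y s, D s) = κ := by
    intro s hs
    have := neBot_nhdsWithin_Ioo hab hs
    have h1 : ContinuousWithinAt (fun r => localG F φ (y r, D r)) (Icc a b) s :=
      (hL.hasFDerivAt (hyU s hs) (D s)).continuousAt.comp_continuousWithinAt
        (f := fun r => (y r, D r)) ((hyc s hs).prodMk (hDc s hs))
    refine tendsto_nhds_unique (h1.mono Ioo_subset_Icc_self).tendsto
      ((tendsto_const_nhds (x := κ)).congr' ?_)
    filter_upwards [self_mem_nhdsWithin] with r hr
    have hr' : r ∈ Ioo (0 : ℝ) 1 := ⟨ha.trans_lt hr.1, hr.2.trans_le hb⟩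
    have hd := (hD r (Ioo_subset_Icc_self hr)).hasDerivAt (Icc_mem_nhds hr.1 hr.2)
    rw [← hE r hr', h.deriv_eq hr hd.differentiableAt, hd.deriv, localG_eq]
  have hD0 : ∀ s ∈ Icc a b, D s ≠ 0 := by
    intro s hs h0
    have := hEy s hs
    rw [h0, hL.apply_zero (hyU s hs)] at this
    exact hκ.ne this
  have hforce : ContinuousOn (fun s => force (localG F φ) (y s) (D s)) (Icc a b) := fun s hs =>
    (hL.continuousAt_force (hyU s hs) (D s)).comp_continuousWithinAt
      (f := fun r => (y r, D r)) ((hyc s hs).prodMk (hDc s hs))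
  have hy1 : ContDiffOn ℝ 1 y (Icc a b) := by
    have := contDiffOn_succ_of_hasDerivWithinAt hab (n := 0) hD (contDiffOn_zero.2 hDc)
    simpa using this
  have hP1 : ContDiffOn ℝ 1 (fun r => momentum (localG F φ) (y r) (D r)) (Icc a b) := by
    have := contDiffOn_succ_of_hasDerivWithinAt hab (n := 0) hP (contDiffOn_zero.2 hforce)
    simpa using this
  have hD1 := hL.contDiffOn_velocity hyU hD0 hDc hy1 hP1
  have hDeq : ∀ s ∈ Icc a b, derivWithin y (Icc a b) s = D s := fun s hs =>
    (hD s hs).derivWithin (huniq s hs)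
  refine ⟨?_, fun s hs => ?_⟩
  · have := contDiffOn_succ_of_hasDerivWithinAt hab (n := 1) hD (by simpa using hD1)
    exact this.of_le (by norm_num)
  · rw [hDeq s hs]
    refine ⟨hD0 s hs, fun i => ?_⟩
    rw [derivWithin_congr hDeq (hDeq s hs)]
    have h1 : HasDerivWithinAt D (derivWithin D (Icc a b) s) (Icc a b) s :=
      ((hD1 s hs).differentiableWithinAt (by norm_num)).hasDerivWithinAt
    have h2 := HasFDerivAt.comp_hasDerivWithinAt (f := fun r => (y r, D r)) s
      (hL.hasFDerivAt_hess (p := (y s, D s)) (hyU s hs) (hD0 s hs)) ((hD s hs).prodMk h1)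
    exact hL.geodesic_equation (p := (y s, D s)) (hyU s hs) (hD0 s hs)
      ((huniq s hs).eq_deriv _ h2 (hP s hs)) i

/-- A critical curve is a geodesic as long as it does not touch the boundary. -/
theorem IsVCritical.isGeodesicOn (hx : IsVCritical M F Φ x) (hM : IsSubmanifold N k M)
    (hF : IsFinslerMetric M F) (hΦ : IsDiskDomain N M Φ) {κ : ℝ} (hκ : 0 < κ)
    (hE : ∀ s ∈ Ioo (0 : ℝ) 1, sqMetric F (x s, deriv x s) = κ) {t : ℝ} (ht : 0 < t)
    (ht1 : t ≤ 1) (hfree : ∀ s ∈ Ioo 0 t, Φ (x s) ≠ 0) : IsGeodesicOn N k M F x 0 t := by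
  have hmem : ∀ s ∈ Icc 0 t, x s ∈ M := fun s hs => hx.mem ⟨hs.1, hs.2.trans ht1⟩
  have hxc : ContinuousOn x (Icc 0 t) := hx.continuousOn.mono (Icc_subset_Icc le_rfl ht1)
  have key : ∀ φ : OpenPartialHomeomorph E (EuclideanSpace ℝ (Fin N) × EuclideanSpace ℝ (Fin k)),
      IsSliceChart M φ → ∀ s ∈ Icc 0 t, x s ∈ φ.source → ∃ a b, a < b ∧ s ∈ Icc a b ∧
      Icc a b =ᶠ[𝓝 s] Icc 0 t ∧ InChart M φ x a b ∧
      ContDiffOn ℝ 2 (coordCurve φ x) (Icc a b) ∧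
      derivWithin (coordCurve φ x) (Icc a b) s ≠ 0 ∧ ∀ i,
      derivWithin (derivWithin (coordCurve φ x) (Icc a b)) (Icc a b) s i
        + ∑ j, ∑ l, chern (localG F φ) i j l
            (coordCurve φ x s, derivWithin (coordCurve φ x) (Icc a b) s)
          * derivWithin (coordCurve φ x) (Icc a b) s j
          * derivWithin (coordCurve φ x) (Icc a b) s l = 0 := by
    intro φ hφ s hs hsrc
    obtain ⟨a, b, h1, h2, h3, h4, h5, h6, h7⟩ := exists_Icc_of_eventually ht hs
      (hxc s hs (φ.open_source.mem_nhds hsrc))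
    have hI : InChart M φ x a b := ⟨hφ, fun r hr => hmem r ⟨h1.trans hr.1, hr.2.trans h3⟩, h7⟩
    obtain ⟨g1, g2⟩ := hI.geodesic_equation hF hΦ hx h1 h2 (h3.trans ht1)
      (fun r hr => hfree r ⟨h1.trans_lt hr.1, hr.2.trans_le h3⟩) hκ hE
    exact ⟨a, b, h2, h4, Icc_eventuallyEq h1 h3 h4 h5 h6, hI, g1, g2 s h4⟩
  refine ⟨hmem, fun s hs => ?_, fun s hs => ?_, fun φ hφ s hs hsrc i => ?_⟩
  · obtain ⟨φ, hsrc, hφ⟩ := hM (x s) (hmem s hs)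
    obtain ⟨a, b, hab, hsI, hev, hI, g1, -⟩ := key φ hφ s hs hsrc
    have h1 : ContDiffWithinAt ℝ 2 x (Icc a b) s :=
      (((hI.slice.contDiffAt_param (hI.coord_mem hsI)).of_le (by norm_num)).comp_contDiffWithinAt s
        (g1 s hsI)).congr (fun r hr => (hI.param_coord hr).symm) (hI.param_coord hsI).symm
    exact (contDiffWithinAt_congr_set hev).1 h1
  · obtain ⟨φ, hsrc, hφ⟩ := hM (x s) (hmem s hs)
    obtain ⟨a, b, hab, hsI, hev, hI, g1, g2, -⟩ := key φ hφ s hs hsrc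
    have h1 := ((g1 s hsI).differentiableWithinAt (by norm_num)).hasDerivWithinAt
    have h2 : HasDerivWithinAt x _ (Icc a b) s :=
      ((hI.slice.hasFDerivAt_param (hI.coord_mem hsI)).comp_hasDerivWithinAt s h1).congr
        (fun r hr => (hI.param_coord hr).symm) (hI.param_coord hsI).symm
    rw [← derivWithin_congr_set hev, h2.derivWithin (uniqueDiffOn_Icc hab s hsI)]
    exact hI.slice.fderiv_param_ne_zero (hI.coord_mem hsI) g2
  · obtain ⟨a, b, hab, hsI, hev, hI, g1, g2, g3⟩ := key φ hφ s hs hsrc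
    -- The chart interval and `[0, t]` coincide near every point close to `s`, so first derivatives
    -- agree near `s` and hence second derivatives agree at `s`.
    have e1 : derivWithin (coordCurve φ x) (Icc a b) =ᶠ[𝓝 s] derivWithin (coordCurve φ x) (Icc 0 t) :=
      hev.eventually_nhds.mono fun r hr => derivWithin_congr_set hr
    have e2 : derivWithin (derivWithin (coordCurve φ x) (Icc a b)) (Icc a b) s
        = derivWithin (derivWithin (coordCurve φ x) (Icc 0 t)) (Icc 0 t) s := by
      rw [(e1.filter_mono nhdsWithin_le_nhds).derivWithin_eq e1.self_of_nhds,
        derivWithin_congr_set hev]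
    have := g3 i
    rw [e2, e1.self_of_nhds] at this
    exact this

/-- Contact times cannot accumulate at `0`, so those up to a given one form a nonempty compact
subset of `[δ, s₁]`, which has a least element. -/
theorem IsVCritical.exists_contact_free (hx : IsVCritical M F Φ x) (hΦ : ContDiffOn ℝ 2 Φ M)
    (h0 : ∀ᶠ r in 𝓝[Icc 0 1 \ {0}] (0 : ℝ), Φ (x r) ≠ 0)
    (hc : ∃ s ∈ Ioo (0 : ℝ) 1, Φ (x s) = 0) :
    ∃ s ∈ Ioo (0 : ℝ) 1, Φ (x s) = 0 ∧ ∀ r ∈ Ioo 0 s, Φ (x r) ≠ 0 := by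
  obtain ⟨s₁, hs₁, hs₁'⟩ := hc
  obtain ⟨δ, hδ, H⟩ := Metric.mem_nhdsWithin_iff.1 h0
  have hδ' : ∀ r ∈ Ioo (0 : ℝ) 1, r < δ → Φ (x r) ≠ 0 := fun r hr hrδ =>
    H ⟨by rw [Metric.mem_ball, Real.dist_eq, sub_zero, abs_of_pos hr.1]; exact hrδ,
      ⟨Ioo_subset_Icc_self hr, hr.1.ne'⟩⟩
  have hsub : Icc δ s₁ ⊆ Icc 0 1 := Icc_subset_Icc hδ.le hs₁.2.le
  have hcomp : IsCompact (Icc δ s₁ ∩ (fun r => Φ (x r)) ⁻¹' {0}) :=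
    isCompact_Icc.of_isClosed_subset (((hx.continuousOn_phi hΦ).mono
      hsub).preimage_isClosed_of_isClosed isClosed_Icc isClosed_singleton) inter_subset_left
  have hδs : δ ≤ s₁ := not_lt.1 fun h => hδ' s₁ hs₁ h hs₁'
  obtain ⟨s, hs, hmin⟩ := hcomp.exists_isLeast ⟨s₁, right_mem_Icc.2 hδs, hs₁'⟩
  refine ⟨s, ⟨hδ.trans_le hs.1.1, hs.1.2.trans_lt hs₁.2⟩, hs.2, fun r hr hr' => ?_⟩
  have hr1 : r < 1 := hr.2.trans (hs.1.2.trans_lt hs₁.2)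
  rcases lt_or_ge r δ with h | h
  · exact hδ' r ⟨hr.1, hr1⟩ h hr'
  · exact (hmin ⟨⟨h, hr.2.le.trans hs.1.2⟩, hr'⟩).not_gt hr.2

/-- A critical curve is tangent to the boundary at interior contact times. -/
theorem IsVCritical.deriv_mem_bdryTangent (hx : IsVCritical M F Φ x) (hM : IsSubmanifold N k M)
    (hF : IsFinslerMetric M F) (hΦ : IsDiskDomain N M Φ) {s : ℝ} (hs : s ∈ Ioo (0 : ℝ) 1)
    (hs0 : Φ (x s) = 0) : deriv x s ∈ bdryTangent M Φ (x s) := by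
  refine ⟨hx.deriv_mem hM hF hΦ hs, ?_⟩
  have h1 := ((hΦ.contDiffOn (x s) (hx.mem (Ioo_subset_Icc_self hs))).differentiableWithinAt
    (by norm_num)).hasFDerivWithinAt
  have hI := Icc_mem_nhds hs.1 hs.2
  have h2 : HasDerivAt (fun r => Φ (x r)) (fderivWithin ℝ Φ M (x s) (deriv x s)) s :=
    (h1.comp_hasDerivWithinAt s (hx.differentiableAt hM hF hΦ hs).hasDerivAt.hasDerivWithinAt
      fun r hr => hx.mem hr).hasDerivAt hI
  -- `Φ ≤ 0` along the curve, so the value `0` is a maximum.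
  refine IsLocalMax.hasDerivAt_eq_zero (f := fun r => Φ (x r)) ?_ h2
  filter_upwards [hI] with r hr
  rw [hs0]
  exact hx.phi_nonpos hr

theorem IsVCritical.isGeodesicChord (hx : IsVCritical M F Φ x) (hM : IsSubmanifold N k M)
    (hF : IsFinslerMetric M F) (hΦ : IsDiskDomain N M Φ) {κ : ℝ} (hκ : 0 < κ)
    (hE : ∀ s ∈ Ioo (0 : ℝ) 1, sqMetric F (x s, deriv x s) = κ) {t : ℝ} (ht : 0 < t)
    (ht1 : t ≤ 1) (hfree : ∀ s ∈ Ioo 0 t, Φ (x s) ≠ 0) (hxt : Φ (x t) = 0) :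
    IsGeodesicChord N k M F Φ x 0 t where
  lt := ht
  geodesic := hx.isGeodesicOn hM hF hΦ hκ hE ht ht1 hfree
  left_mem := hx.1.2.2.1
  right_mem := ⟨hx.mem ⟨ht.le, ht1⟩, hxt⟩
  interior_mem s hs :=
    have hs' : s ∈ Icc (0 : ℝ) 1 := ⟨hs.1.le, hs.2.le.trans ht1⟩
    ⟨hx.mem hs', lt_of_le_of_ne (hx.phi_nonpos hs') (hfree s hs)⟩

end Curves

end FinslerChord

/-! ### The dichotomy: a first interior contact, or none. -/

theorem mainTheorem4 (N k : ℕ) (hN : 2 ≤ N)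
    (M : Set (EuclideanSpace ℝ (Fin (N + k)))) (hM : IsSubmanifold N k M)
    (F : EuclideanSpace ℝ (Fin (N + k)) × EuclideanSpace ℝ (Fin (N + k)) → ℝ)
    (hF : IsFinslerMetric M F)
    (Φ : EuclideanSpace ℝ (Fin (N + k)) → ℝ) (hΦ : IsDiskDomain N M Φ)
    (x : ℝ → EuclideanSpace ℝ (Fin (N + k))) (hx : IsVCritical M F Φ x)
    (hne : ¬ ∃ p, ∀ s ∈ Icc (0 : ℝ) 1, x s = p) :
    (∃ sbar ∈ Ioo (0 : ℝ) 1, IsOrthogonalTangentChord N k M F Φ x 0 sbar) ∨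
      IsOrthogonalChord N k M F Φ x 0 1 := by
  obtain ⟨κ, hκ, hE⟩ := hx.exists_energy hM hF hΦ hne
  obtain ⟨v₀, hv₀, horth₀, hfree₀⟩ := hx.exists_end_velocity hM hF hΦ hκ hE (Or.inl rfl)
  obtain ⟨v₁, hv₁, horth₁, -⟩ := hx.exists_end_velocity hM hF hΦ hκ hE (Or.inr rfl)
  have hleft : ∀ t : ℝ, 0 < t → t ≤ 1 →
      OrthogonalToBdry M F Φ (x 0) (derivWithin x (Icc 0 t) 0) := fun t ht ht1 => by
    rwa [(hv₀.mono (Icc_subset_Icc le_rfl ht1)).derivWithin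
      (uniqueDiffOn_Icc ht 0 (left_mem_Icc.2 ht.le))]
  by_cases hc : ∃ s ∈ Ioo (0 : ℝ) 1, Φ (x s) = 0
  · obtain ⟨s, hs, hs0, hfree⟩ := hx.exists_contact_free hΦ.contDiffOn hfree₀ hc
    refine Or.inl ⟨s, hs, hx.isGeodesicChord hM hF hΦ hκ hE hs.1 hs.2.le hfree hs0,
      hleft s hs.1 hs.2.le, ?_⟩
    rw [(hx.differentiableAt hM hF hΦ hs).derivWithin
      (uniqueDiffOn_Icc hs.1 s (right_mem_Icc.2 hs.1.le))]
    exact hx.deriv_mem_bdryTangent hM hF hΦ hs hs0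
  · push Not at hc
    refine Or.inr ⟨hx.isGeodesicChord hM hF hΦ hκ hE one_pos le_rfl hc hx.1.2.2.2.2,
      hleft 1 one_pos le_rfl, ?_⟩
    rwa [hv₁.derivWithin (uniqueDiffOn_Icc one_pos 1 (right_mem_Icc.2 zero_le_one))]
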